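/- Machine model. Algorithms are programs for a randomized random access machine. Its memory consists of cells holding integers and cells holding real numbers; cells are addressed by computed integers, and the machine can toss fair coins. Integers are charged by the logarithmic cost criterion: each access and each operation ($+,-,\times$, integer division and remainder, bitwise AND and XOR, left shift) costs one plus the bit lengths of the integers involved, addresses included. A field operation on, or a comparison of, real numbers costs one unit; there is no conversion of reals to integers, no root extraction, and all constants of a program are integers. The running time is the total cost, in the worst case over all coin tosses. We write $t=\tilde O(f)$ if $t\le C\,f\,(\log(f+2))^{C}$ for a constant $C$. Let $T$ be a tree on the vertex set $\{1,\dots,k\}$ and let $G$ be a simple undirected graph on $n\ge 1$ vertices with edge weights $w$, given by their adjacency matrices and the matrix of weights. A copy of $T$ in $G$ is an injective map $\varphi:V(T)\to V(G)$ with $\varphi(i)\varphi(j)\in E(G)$ for all $ij\in E(T)$; its weight is $w(\varphi)=\sum_{ij\in E(T)}w(\varphi(i)\varphi(j))$. **Theorem.** For every constant $c$ the following hold. 1. (Exact solution.) There is a randomized algorithm, computing with integers only, that, given $T$, $G$, an integer $M\ge 1$ and integer edge weights in $[-M,M]$, always halts in time $$\tilde O\bigl(2^k\,\mathrm{poly}(k)\,M\,n^3\bigr)$$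 and, with probability at least $1-(n+1)^{-c}$, outputs a copy of $T$ in $G$ of minimum weight, or reports that there is none if $G$ contains no copy of $T$. 2. (Approximation.) There is a randomized algorithm that, given $T$, $G$, a real $M\ge 1$, real edge weights in $[1,M]$ and a real $\varepsilon>0$, always halts in time $$\tilde O\Bigl(2^k\,\mathrm{poly}(k)\,n^3\bigl(\log(2+\log M)+1/\varepsilon\bigr)\Bigr)$$ and, with probability at least $1-(n+1)^{-c}$, outputs a copy $\varphi$ of $T$ in $G$ with $w(\varphi)\le(1+\varepsilon)\,w(\psi)$ for every copy $\psi$ of $T$ in $G$, or reports that there is none if $G$ contains no copy of $T$. In both parts the algorithm, the degree of the polynomial $\mathrm{poly}(k)$ and the constants in $\tilde O$ depend only on $c$. -/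

import Mathlib

open MeasureTheory

/-! ### Randomized random access machines

Programs for a random access machine with structured control flow.  The memory is divided into
integer arrays and real arrays.  The name of an array is fixed in the program text (so a program
uses finitely many of them); the indices are computed at run time (indirect addressing).

* Integers are charged by the logarithmic cost criterion: every access and every operation costs
  one plus the bit lengths of the integers involved, addresses included.
* Real numbers are treated as on a real random access machine: field operations and comparisons
  cost one unit.  There is no rounding, no root extraction, and no conversion of reals to
  integers, and all constants of a program are integers.
* A program may toss fair coins, one bit at a time. -/

namespace RandRAM

/-- A memory state: `int a i` and `real a i` are the contents of cell `i` of the integer array,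
resp. the real array, with name `a`; `coins` is the sequence of the coin tosses still to come. -/
structure State where
  int : ℕ → ℤ → ℤ
  real : ℕ → ℤ → ℝ
  coins : ℕ → Bool

/-- Bit length of an integer, the sign included. -/
def bits (z : ℤ) : ℕ := Nat.size z.natAbs + 1

/-- Operations on integers (`band` and `bxor` act bitwise on two's complement). -/
inductive IntOp
  | add | sub | mul | div | mod | band | bxor | shl

def IntOp.eval : IntOp → ℤ → ℤ → ℤ
  | .add, a, b => a + b
  | .sub, a, b => a - b
  | .mul, a, b => a * b
  | .div, a, b => a / b
  | .mod, a, b => a % b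
  | .band, a, b => Int.land a b
  | .bxor, a, b => Int.xor a b
  | .shl, a, b => a * 2 ^ b.toNat

/-- Integer expressions. -/
inductive IntExpr
  | const (c : ℤ)
  | read (a : ℕ) (i : IntExpr)
  | op (o : IntOp) (e f : IntExpr)

def IntExpr.eval (s : State) : IntExpr → ℤ
  | .const c => c
  | .read a i => s.int a (i.eval s)
  | .op o e f => o.eval (e.eval s) (f.eval s)

/-- Every node of an expression costs one plus the bit length of its value; the bit lengths of the
operands, or of the address, are accounted for at the nodes below it. -/
def IntExpr.cost (s : State) : IntExpr → ℕ
  | .const c => 1 + bits c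
  | .read a i => 1 + bits (s.int a (i.eval s)) + i.cost s
  | .op o e f => 1 + bits (o.eval (e.eval s) (f.eval s)) + e.cost s + f.cost s

/-- Operations on reals. -/
inductive RealOp
  | add | sub | mul | div

noncomputable def RealOp.eval : RealOp → ℝ → ℝ → ℝ
  | .add, a, b => a + b
  | .sub, a, b => a - b
  | .mul, a, b => a * b
  | .div, a, b => a / b

/-- Real expressions. -/
inductive RealExpr
  | ofInt (e : IntExpr)
  | read (a : ℕ) (i : IntExpr)
  | op (o : RealOp) (e f : RealExpr)

noncomputable def RealExpr.eval (s : State) : RealExpr → ℝ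
  | .ofInt e => (e.eval s : ℝ)
  | .read a i => s.real a (i.eval s)
  | .op o e f => o.eval (e.eval s) (f.eval s)

def RealExpr.cost (s : State) : RealExpr → ℕ
  | .ofInt e => 1 + e.cost s
  | .read _ i => 1 + i.cost s
  | .op _ e f => 1 + e.cost s + f.cost s

/-- Tests. -/
inductive Test
  | intLt (e f : IntExpr)
  | intEq (e f : IntExpr)
  | realLt (e f : RealExpr)
  | realLe (e f : RealExpr)

def Test.Holds (s : State) : Test → Prop
  | .intLt e f => e.eval s < f.eval s
  | .intEq e f => e.eval s = f.eval s
  | .realLt e f => e.eval s < f.eval s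
  | .realLe e f => e.eval s ≤ f.eval s

def Test.cost (s : State) : Test → ℕ
  | .intLt e f => 1 + e.cost s + f.cost s
  | .intEq e f => 1 + e.cost s + f.cost s
  | .realLt e f => 1 + e.cost s + f.cost s
  | .realLe e f => 1 + e.cost s + f.cost s

/-- The test compares integers. -/
def Test.IntegerOnly : Test → Prop
  | .intLt _ _ => True
  | .intEq _ _ => True
  | .realLt _ _ => False
  | .realLe _ _ => False

/-- Programs.  `setInt a i v` and `setReal a i v` store the value `v` in cell `i` of array `a`,
`toss a i` stores a fresh random bit there, and `loop b p` repeats `p` while `b` holds. -/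
inductive Program
  | skip
  | setInt (a : ℕ) (i v : IntExpr)
  | setReal (a : ℕ) (i : IntExpr) (v : RealExpr)
  | toss (a : ℕ) (i : IntExpr)
  | seq (p q : Program)
  | cond (b : Test) (p q : Program)
  | loop (b : Test) (p : Program)

/-- The program computes with integers only. -/
def Program.IntegerOnly : Program → Prop
  | .skip => True
  | .setInt _ _ _ => True
  | .setReal _ _ _ => False
  | .toss _ _ => True
  | .seq p q => p.IntegerOnly ∧ q.IntegerOnly
  | .cond b p q => b.IntegerOnly ∧ p.IntegerOnly ∧ q.IntegerOnly
  | .loop b p => b.IntegerOnly ∧ p.IntegerOnly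

def State.setInt (s : State) (a : ℕ) (i v : ℤ) : State :=
  { s with int := Function.update s.int a (Function.update (s.int a) i v) }

def State.setReal (s : State) (a : ℕ) (i : ℤ) (v : ℝ) : State :=
  { s with real := Function.update s.real a (Function.update (s.real a) i v) }

def State.toss (s : State) (a : ℕ) (i : ℤ) : State :=
  { s.setInt a i (if s.coins 0 then 1 else 0) with coins := fun m => s.coins (m + 1) }

/-- `Runs p s t s'`: started in the state `s`, the program `p` halts in the state `s'` after a
computation of cost exactly `t`. -/
inductive Runs : Program → State → ℕ → State → Prop
  | skip (s : State) : Runs .skip s 1 s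
  | setInt (a : ℕ) (i v : IntExpr) (s : State) :
      Runs (.setInt a i v) s (1 + i.cost s + v.cost s) (s.setInt a (i.eval s) (v.eval s))
  | setReal (a : ℕ) (i : IntExpr) (v : RealExpr) (s : State) :
      Runs (.setReal a i v) s (1 + i.cost s + v.cost s) (s.setReal a (i.eval s) (v.eval s))
  | toss (a : ℕ) (i : IntExpr) (s : State) :
      Runs (.toss a i) s (1 + i.cost s) (s.toss a (i.eval s))
  | seq {p q : Program} {s s' s'' : State} {t t' : ℕ} :
      Runs p s t s' → Runs q s' t' s'' → Runs (.seq p q) s (t + t') s''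
  | condTrue {b : Test} {p q : Program} {s s' : State} {t : ℕ} :
      b.Holds s → Runs p s t s' → Runs (.cond b p q) s (b.cost s + t) s'
  | condFalse {b : Test} {p q : Program} {s s' : State} {t : ℕ} :
      ¬ b.Holds s → Runs q s t s' → Runs (.cond b p q) s (b.cost s + t) s'
  | loopTrue {b : Test} {p : Program} {s s' s'' : State} {t t' : ℕ} :
      b.Holds s → Runs p s t s' → Runs (.loop b p) s' t' s'' →
        Runs (.loop b p) s (b.cost s + t + t') s''
  | loopFalse {b : Test} {p : Program} {s : State} :
      ¬ b.Holds s → Runs (.loop b p) s (b.cost s) s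

/-- Computations are deterministic once the coin tosses are fixed. -/
theorem Runs.unique {p : Program} {s s₁ : State} {t₁ : ℕ} (h₁ : Runs p s t₁ s₁) :
    ∀ {t₂ : ℕ} {s₂ : State}, Runs p s t₂ s₂ → t₁ = t₂ ∧ s₁ = s₂ := by
  induction h₁ with
  | skip s => intro _ _ h; cases h; exact ⟨rfl, rfl⟩
  | setInt a i v s => intro _ _ h; cases h; exact ⟨rfl, rfl⟩
  | setReal a i v s => intro _ _ h; cases h; exact ⟨rfl, rfl⟩
  | toss a i s => intro _ _ h; cases h; exact ⟨rfl, rfl⟩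
  | seq _ _ ih₁ ih₂ =>
    intro _ _ h
    cases h with
    | seq h h' =>
      obtain ⟨rfl, rfl⟩ := ih₁ h
      obtain ⟨rfl, rfl⟩ := ih₂ h'
      exact ⟨rfl, rfl⟩
  | condTrue hb _ ih =>
    intro _ _ h
    cases h with
    | condTrue _ h => obtain ⟨rfl, rfl⟩ := ih h; exact ⟨rfl, rfl⟩
    | condFalse hn _ => exact absurd hb hn
  | condFalse hb _ ih =>
    intro _ _ h
    cases h with
    | condTrue hn _ => exact absurd hn hb
    | condFalse _ h => obtain ⟨rfl, rfl⟩ := ih h; exact ⟨rfl, rfl⟩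
  | loopTrue hb _ _ ih₁ ih₂ =>
    intro _ _ h
    cases h with
    | loopTrue _ h h' =>
      obtain ⟨rfl, rfl⟩ := ih₁ h
      obtain ⟨rfl, rfl⟩ := ih₂ h'
      exact ⟨rfl, rfl⟩
    | loopFalse hn => exact absurd hb hn
  | loopFalse hb =>
    intro _ _ h
    cases h with
    | loopTrue hn _ _ => exact absurd hn hb
    | loopFalse _ => exact ⟨rfl, rfl⟩

/-- The distribution of an infinite sequence of independent fair coin tosses. -/
noncomputable def coinMeasure : Measure (ℕ → Bool) :=
  Measure.infinitePi fun _ : ℕ => (PMF.uniformOfFintype Bool).toMeasure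

/-- The program `p`, started on the memory contents `input`, halts for every outcome of the coin
tosses after a computation of cost at most `time`, and the probability that its final state
violates `Good` is at most `δ`. -/
structure Solves (p : Program) (input : (ℕ → Bool) → State) (Good : State → Prop)
    (time δ : ℝ) : Prop where
  halts : ∀ ω, ∃ t s, Runs p (input ω) t s ∧ (t : ℝ) ≤ time
  error : coinMeasure {ω | ∃ t s, Runs p (input ω) t s ∧ ¬ Good s} ≤ ENNReal.ofReal δ

end RandRAM

/-- `C · f · (log (f + 2)) ^ C`; a function is `Õ(f)` if it is bounded by this for some `C`. -/
noncomputable def softBound (C : ℕ) (f : ℝ) : ℝ := C * f * Real.log (f + 2) ^ C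

namespace MinWeightTree

open RandRAM

/-- The weight of a copy of `T` in `G`: the sum of the weights of the edges of the copy. -/
noncomputable def copyWeight {k n : ℕ} {R : Type} [AddCommMonoid R] {T : SimpleGraph (Fin k)}
    {G : SimpleGraph (Fin n)} (w : Sym2 (Fin n) → R) (φ : T.Copy G) : R :=
  open Classical in ∑ e ∈ T.edgeFinset, w (e.map φ)

/-- An `n × n` matrix stored row by row in an array: the entry `(i, j)` is in cell `i * n + j`. -/
def rowMajor {R : Type} [AddCommMonoid R] (n : ℕ) (A : Fin n → Fin n → R) : ℤ → R :=
  fun c => ∑ i : Fin n, ∑ j : Fin n, if c = (i : ℤ) * n + j then A i j else 0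

/-- Adjacency matrix. -/
noncomputable def adjTable {n : ℕ} (G : SimpleGraph (Fin n)) : Fin n → Fin n → ℤ :=
  open Classical in fun i j => if G.Adj i j then 1 else 0

/-- The matrix of the edge weights, with `0` at the pairs that are not edges. -/
noncomputable def weightTable {n : ℕ} {R : Type} [Zero R] (G : SimpleGraph (Fin n))
    (w : Sym2 (Fin n) → R) : Fin n → Fin n → R :=
  open Classical in fun i j => if G.Adj i j then w s(i, j) else 0

/-- The input with integer weights: `n`, `k`, `M` in cells `0`, `1`, `2` of integer array `0`, the
adjacency matrices of `T` and of `G` in the integer arrays `1` and `2`, the weights in integer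
array `3`, and `0` in all other cells. -/
noncomputable def intInput {n k : ℕ} (T : SimpleGraph (Fin k)) (G : SimpleGraph (Fin n)) (M : ℕ)
    (w : Sym2 (Fin n) → ℤ) (ω : ℕ → Bool) : State where
  int
    | 0 => fun c => if c = 0 then (n : ℤ) else if c = 1 then (k : ℤ)
        else if c = 2 then (M : ℤ) else 0
    | 1 => rowMajor k (adjTable T)
    | 2 => rowMajor n (adjTable G)
    | 3 => rowMajor n (weightTable G w)
    | _ => fun _ => 0
  real := fun _ _ => 0
  coins := ω

/-- The input with real weights: `n`, `k` in cells `0`, `1` of integer array `0`, the adjacency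
matrices of `T` and of `G` in the integer arrays `1` and `2`, `M` and `ε` in cells `0`, `1` of real
array `0`, the weights in real array `1`, and `0` in all other cells. -/
noncomputable def realInput {n k : ℕ} (T : SimpleGraph (Fin k)) (G : SimpleGraph (Fin n))
    (M ε : ℝ) (w : Sym2 (Fin n) → ℝ) (ω : ℕ → Bool) : State where
  int
    | 0 => fun c => if c = 0 then (n : ℤ) else if c = 1 then (k : ℤ) else 0
    | 1 => rowMajor k (adjTable T)
    | 2 => rowMajor n (adjTable G)
    | _ => fun _ => 0
  real
    | 0 => fun c => if c = 0 then M else if c = 1 then ε else 0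
    | 1 => rowMajor n (weightTable G w)
    | _ => fun _ => 0
  coins := ω

/-- The output is in integer array `4`.  Either cell `0` holds `1`, and the cells `1, …, k` hold the
images of the vertices of `T` under a copy of `T` in `G` that satisfies `P`; or cell `0` holds
`0`, and `G` contains no copy of `T`. -/
def Outputs {n k : ℕ} (T : SimpleGraph (Fin k)) (G : SimpleGraph (Fin n))
    (P : T.Copy G → Prop) (s : State) : Prop :=
  (∃ φ : T.Copy G, P φ ∧ s.int 4 0 = 1 ∧ ∀ i : Fin k, s.int 4 ((i : ℤ) + 1) = (φ i : ℕ)) ∨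
    (IsEmpty (T.Copy G) ∧ s.int 4 0 = 0)

end MinWeightTree

open RandRAM MinWeightTree

/-!
# Lightest copies of a tree in a weighted graph

The algorithm is an algebraic sieve over a ring of characteristic two.

*The sieve.* Order the vertices of `T` such that each one but the first has an earlier neighbour,
its parent. Give independent labels `x` to the pairs (position, vertex of `G`) and labels `z` to
the pairs (vertex of `G`, `l`) with `l < k`. For a set `X` of numbers below `k`, consider the sum
over all homomorphisms `φ` from `T` to `G` of `∏ p, x p (φ p) * ∑ l ∈ X, z (φ p) l`. It is
computed with `O(k n²)` operations by absorbing the leaves into their parents (`homSum`). Summed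
over the `2 ^ k` sets `X`, the products of the inner sums become in characteristic two the
determinant of the matrix `z (φ p) l`, which vanishes when two rows coincide. Hence only the
injective `φ` remain (`sieveSum_eq_sum_term`).

*Weights and random labels in one variable.* The labels are random polynomials of degree less than
`d` with coefficients `0` and `1` in a variable `Y`, and an edge of weight `r` contributes a
factor `Y ^ (r * D)` with `D = 2 * k * d`, which exceeds the degree of every product of labels
that occurs. So the coefficients at the exponents from `w * D` to `w * D + D - 1` belong to the
embeddings of weight `w` (`coeff_sievePoly`). The machine computes over the integers, with a power
of two so large in place of `Y` that the coefficients do not overlap; their parities are single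
bits of the result (`testBit_sieveNat`). The lowest set bit among these belongs to the minimum
weight, provided that the terms of the lightest embeddings do not sum to zero. By the
Schwartz–Zippel lemma over the polynomials modulo two this fails with probability at most
`2 * k / 2 ^ d` (`coinMeasure_sum_term_eq_zero_le`).

*Reconstruction.* The sieve is the sum, over the images `v` of a given position, of the sieves
with that image fixed to `v`. So some choice of `v` keeps the selected coefficient odd
(`exists_coeff_update_ne_zero`), and fixing all positions one after the other finds an embedding.
No further coins are needed and no further errors occur (`ok_coreProg_favorable`). This takes
`k * n` evaluations with numbers of `O(M)` bits, up to factors polynomial in `k` and logarithmic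
in `n`.

*Approximation.* The thresholds `θ` for which the edges of weight at most `θ` contain a copy are
detected by the sieve without weights. A binary search on the exponents, with thresholds from
repeated squaring, finds within `O(log log M)` tests a number `cur` such that the minimum weight
is at least `cur`, unless `T` is a single vertex, and some copy has only edges of weight at most
`2 * cur`. Edges heavier than `2 * k * cur` can be dropped, and rounding the others down to
multiples of `min ε 1 * cur / k` changes the weight of a copy by at most the factor `1 + ε`
(`copyWeight_le_of_rounded`), leaving integers that are `O(k² (1 + 1 / ε))`.

*Costs.* `Ok β p s N Q` says that `p`, started in `s` with integers of at most `β` bits, halts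
after `N` elementary steps in a state with property `Q`, while all integers keep at most `β` bits;
each step costs at most `p.weight * (β + 1)`. The two parts are `exact_solution` and
`approximate_solution`.
-/

/-! ### Cost and footprint of programs -/

namespace RandRAM

theorem bits_le_of_abs_lt {z : ℤ} {m : ℕ} (h : |z| < 2 ^ m) : bits z ≤ m + 1 := by
  unfold bits
  have : z.natAbs < 2 ^ m := by
    zify
    exact h
  have := Nat.size_le.2 this
  omega

theorem bits_le_of_lt {z : ℤ} {m : ℕ} (h0 : 0 ≤ z) (h : z < 2 ^ m) : bits z ≤ m + 1 :=
  bits_le_of_abs_lt (by rwa [abs_of_nonneg h0])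

theorem bits_add_le (a b : ℤ) : bits (a + b) ≤ bits a + bits b := by
  have ha := Nat.size_le.1 (le_refl (Nat.size a.natAbs))
  have hb := Nat.size_le.1 (le_refl (Nat.size b.natAbs))
  have h : (a + b).natAbs < 2 ^ (Nat.size a.natAbs + Nat.size b.natAbs + 1) := by
    have := Int.natAbs_add_le a b
    have h1 : 2 ^ Nat.size a.natAbs ≤ 2 ^ (Nat.size a.natAbs + Nat.size b.natAbs) :=
      Nat.pow_le_pow_right (by norm_num) (by omega)
    have h2 : 2 ^ Nat.size b.natAbs ≤ 2 ^ (Nat.size a.natAbs + Nat.size b.natAbs) :=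
      Nat.pow_le_pow_right (by norm_num) (by omega)
    rw [pow_succ]
    omega
  have := Nat.size_le.2 h
  unfold bits
  omega

theorem bits_neg (a : ℤ) : bits (-a) = bits a := by simp [bits]

theorem bits_mul_le (a b : ℤ) : bits (a * b) ≤ bits a + bits b := by
  have ha := Nat.size_le.1 (le_refl (Nat.size a.natAbs))
  have hb := Nat.size_le.1 (le_refl (Nat.size b.natAbs))
  have h : (a * b).natAbs < 2 ^ (Nat.size a.natAbs + Nat.size b.natAbs) := by
    rw [Int.natAbs_mul, pow_add]
    exact Nat.mul_lt_mul'' ha hb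
  have := Nat.size_le.2 h
  unfold bits
  omega

theorem bits_mono {a b : ℤ} (h : a.natAbs ≤ b.natAbs) : bits a ≤ bits b :=
  Nat.add_le_add_right (Nat.size_le_size h) 1

theorem bits_ediv_le (a b : ℤ) : bits (a / b) ≤ bits a :=
  bits_mono (Int.natAbs_ediv_le_natAbs a b)

theorem bits_emod_le (a b : ℤ) : bits (a % b) ≤ bits a + bits b := by
  by_cases hb : b = 0
  · simp [hb]
  · have h1 := Int.emod_nonneg a hb
    have h2 := Int.emod_lt_abs a hb
    have : bits (a % b) ≤ bits b := bits_mono (by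
      zify
      rw [abs_of_nonneg h1]
      exact h2.le)
    omega

/-- Every integer in the memory has at most `β` bits. -/
def MemBdd (β : ℕ) (s : State) : Prop := ∀ a i, bits (s.int a i) ≤ β

theorem MemBdd.mono {β β' : ℕ} {s : State} (h : MemBdd β s) (hβ : β ≤ β') : MemBdd β' s :=
  fun a i => (h a i).trans hβ

/-- A static measure of an expression: constants count with their length. -/
def IntExpr.size : IntExpr → ℕ
  | .const c => bits c + 1
  | .read _ i => 1 + i.size
  | .op _ e f => 1 + e.size + f.size

theorem IntExpr.one_le_size (e : IntExpr) : 1 ≤ e.size := by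
  cases e <;> simp only [IntExpr.size] <;> omega

/-- The operations whose results are not longer than both operands together. For the other
operations, `IntExpr.Fits` asks for an explicit bound. -/
def IntOp.Free : IntOp → Prop
  | .add => True
  | .sub => True
  | .mul => True
  | .div => True
  | .mod => True
  | _ => False

theorem IntOp.bits_eval_le {o : IntOp} (h : o.Free) (a b : ℤ) :
    bits (o.eval a b) ≤ bits a + bits b := by
  cases o with
  | add => exact bits_add_le a b
  | sub =>
    have := bits_add_le a (-b)
    rwa [bits_neg, ← sub_eq_add_neg] at this
  | mul => exact bits_mul_le a b
  | div => exact (bits_ediv_le a b).trans (Nat.le_add_right _ _)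
  | mod => exact bits_emod_le a b
  | _ => exact h.elim

/-- The results of the bitwise operations and shifts in the expression have at most `β` bits. -/
def IntExpr.Fits (β : ℕ) (s : State) : IntExpr → Prop
  | .const _ => True
  | .read _ i => i.Fits β s
  | .op o e f => e.Fits β s ∧ f.Fits β s ∧ (o.Free ∨ bits (o.eval (e.eval s) (f.eval s)) ≤ β)

theorem IntExpr.bits_eval_le {β : ℕ} {s : State} (hs : MemBdd β s) :
    ∀ {e : IntExpr}, e.Fits β s → bits (e.eval s) ≤ e.size * (β + 1)
  | .const c, _ => by
    simp only [IntExpr.eval, IntExpr.size]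
    nlinarith [Nat.zero_le (bits c * β)]
  | .read a i, _ => by
    have := hs a (i.eval s)
    simp only [IntExpr.eval, IntExpr.size]
    nlinarith [Nat.zero_le (i.size * (β + 1))]
  | .op o e f, h => by
    obtain ⟨he, hf, ho | ho⟩ := h
    · have h1 := IntExpr.bits_eval_le hs he
      have h2 := IntExpr.bits_eval_le hs hf
      have h3 := IntOp.bits_eval_le ho (e.eval s) (f.eval s)
      simp only [IntExpr.eval, IntExpr.size]
      nlinarith
    · simp only [IntExpr.eval, IntExpr.size]
      nlinarith [Nat.zero_le (e.size * (β + 1)), Nat.zero_le (f.size * (β + 1))]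

theorem IntExpr.cost_le {β : ℕ} {s : State} (hs : MemBdd β s) :
    ∀ {e : IntExpr}, e.Fits β s → e.cost s ≤ e.size ^ 2 * (β + 1)
  | .const c, _ => by
    simp only [IntExpr.cost, IntExpr.size]
    nlinarith [Nat.zero_le (bits c), Nat.zero_le ((bits c + 1) ^ 2 * β)]
  | .read a i, h => by
    have h1 := hs a (i.eval s)
    have h2 := IntExpr.cost_le hs (e := i) h
    simp only [IntExpr.cost, IntExpr.size]
    nlinarith [Nat.zero_le (i.size * (β + 1))]
  | .op o e f, h => by
    have h0 := IntExpr.bits_eval_le hs h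
    have h1 := IntExpr.cost_le hs h.1
    have h2 := IntExpr.cost_le hs h.2.1
    have h3 := e.one_le_size
    have h4 := f.one_le_size
    simp only [IntExpr.eval, IntExpr.size] at h0
    simp only [IntExpr.cost, IntExpr.size]
    have h5 : 2 + e.size + f.size + e.size ^ 2 + f.size ^ 2 ≤ (1 + e.size + f.size) ^ 2 := by
      nlinarith
    have h6 := Nat.mul_le_mul_right (β + 1) h5
    nlinarith

/-- See `IntExpr.size`. -/
def RealExpr.size : RealExpr → ℕ
  | .ofInt e => 1 + e.size
  | .read _ i => 1 + i.size
  | .op _ e f => 1 + e.size + f.size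

/-- See `IntExpr.Fits`. -/
def RealExpr.Fits (β : ℕ) (s : State) : RealExpr → Prop
  | .ofInt e => e.Fits β s
  | .read _ i => i.Fits β s
  | .op _ e f => e.Fits β s ∧ f.Fits β s

theorem RealExpr.cost_le {β : ℕ} {s : State} (hs : MemBdd β s) :
    ∀ {e : RealExpr}, e.Fits β s → e.cost s ≤ e.size ^ 2 * (β + 1)
  | .ofInt e, h => by
    have := IntExpr.cost_le hs (e := e) h
    simp only [RealExpr.cost, RealExpr.size]
    nlinarith [Nat.zero_le (e.size * (β + 1))]
  | .read a i, h => by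
    have := IntExpr.cost_le hs (e := i) h
    simp only [RealExpr.cost, RealExpr.size]
    nlinarith [Nat.zero_le (i.size * (β + 1))]
  | .op o e f, h => by
    have h1 := RealExpr.cost_le hs h.1
    have h2 := RealExpr.cost_le hs h.2
    simp only [RealExpr.cost, RealExpr.size]
    have h5 : 1 + e.size ^ 2 + f.size ^ 2 ≤ (1 + e.size + f.size) ^ 2 := by
      nlinarith [Nat.zero_le (e.size * f.size)]
    have h6 := Nat.mul_le_mul_right (β + 1) h5
    nlinarith

/-- See `IntExpr.size`. -/
def Test.size : Test → ℕ
  | .intLt e f => 1 + e.size + f.size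
  | .intEq e f => 1 + e.size + f.size
  | .realLt e f => 1 + e.size + f.size
  | .realLe e f => 1 + e.size + f.size

/-- See `IntExpr.Fits`. -/
def Test.Fits (β : ℕ) (s : State) : Test → Prop
  | .intLt e f => e.Fits β s ∧ f.Fits β s
  | .intEq e f => e.Fits β s ∧ f.Fits β s
  | .realLt e f => e.Fits β s ∧ f.Fits β s
  | .realLe e f => e.Fits β s ∧ f.Fits β s

theorem cost_pair_le {β c d m n : ℕ} (hc : c ≤ m ^ 2 * (β + 1)) (hd : d ≤ n ^ 2 * (β + 1)) :
    1 + c + d ≤ (1 + m + n) ^ 2 * (β + 1) := by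
  have h5 : 1 + m ^ 2 + n ^ 2 ≤ (1 + m + n) ^ 2 := by
    nlinarith [Nat.zero_le (m * n)]
  have h6 := Nat.mul_le_mul_right (β + 1) h5
  nlinarith

theorem Test.cost_le {β : ℕ} {s : State} (hs : MemBdd β s) :
    ∀ {b : Test}, b.Fits β s → b.cost s ≤ b.size ^ 2 * (β + 1)
  | .intLt _ _, h => cost_pair_le (IntExpr.cost_le hs h.1) (IntExpr.cost_le hs h.2)
  | .intEq _ _, h => cost_pair_le (IntExpr.cost_le hs h.1) (IntExpr.cost_le hs h.2)
  | .realLt _ _, h => cost_pair_le (RealExpr.cost_le hs h.1) (RealExpr.cost_le hs h.2)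
  | .realLe _ _, h => cost_pair_le (RealExpr.cost_le hs h.1) (RealExpr.cost_le hs h.2)

/-- A constant, depending on the program text only, such that every elementary step of the program
costs at most `weight * (β + 1)` while the memory is bounded by `β`. -/
def Program.weight : Program → ℕ
  | .skip => 1
  | .setInt _ i v => (1 + i.size + v.size) ^ 2
  | .setReal _ i v => (1 + i.size + v.size) ^ 2
  | .toss _ i => (1 + i.size + 1) ^ 2
  | .seq p q => p.weight + q.weight
  | .cond b p q => b.size ^ 2 + p.weight + q.weight
  | .loop b p => b.size ^ 2 + p.weight

/-- The integer arrays that the program may write to. -/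
def Program.ints : Program → List ℕ
  | .skip => []
  | .setInt a _ _ => [a]
  | .setReal _ _ _ => []
  | .toss a _ => [a]
  | .seq p q => p.ints ++ q.ints
  | .cond _ p q => p.ints ++ q.ints
  | .loop _ p => p.ints

/-- The real arrays that the program may write to. -/
def Program.reals : Program → List ℕ
  | .skip => []
  | .setInt _ _ _ => []
  | .setReal a _ _ => [a]
  | .toss _ _ => []
  | .seq p q => p.reals ++ q.reals
  | .cond _ p q => p.reals ++ q.reals
  | .loop _ p => p.reals

/-- Whether coin tosses occur in the program. -/
def Program.tosses : Program → Bool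
  | .skip => false
  | .setInt _ _ _ => false
  | .setReal _ _ _ => false
  | .toss _ _ => true
  | .seq p q => p.tosses || q.tosses
  | .cond _ p q => p.tosses || q.tosses
  | .loop _ p => p.tosses

@[simp] theorem State.setInt_int_same (s : State) (a : ℕ) (i v : ℤ) :
    (s.setInt a i v).int a = Function.update (s.int a) i v := by
  simp [State.setInt]

@[simp] theorem State.setInt_int_ne (s : State) {a b : ℕ} (i v : ℤ) (h : b ≠ a) :
    (s.setInt a i v).int b = s.int b := by
  simp [State.setInt, h]

@[simp] theorem State.setInt_real (s : State) (a : ℕ) (i v : ℤ) :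
    (s.setInt a i v).real = s.real := rfl

@[simp] theorem State.setInt_coins (s : State) (a : ℕ) (i v : ℤ) :
    (s.setInt a i v).coins = s.coins := rfl

@[simp] theorem State.setReal_real_same (s : State) (a : ℕ) (i : ℤ) (v : ℝ) :
    (s.setReal a i v).real a = Function.update (s.real a) i v := by
  simp [State.setReal]

@[simp] theorem State.setReal_real_ne (s : State) {a b : ℕ} (i : ℤ) (v : ℝ) (h : b ≠ a) :
    (s.setReal a i v).real b = s.real b := by
  simp [State.setReal, h]

@[simp] theorem State.setReal_int (s : State) (a : ℕ) (i : ℤ) (v : ℝ) :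
    (s.setReal a i v).int = s.int := rfl

@[simp] theorem State.toss_int_same (s : State) (a : ℕ) (i : ℤ) :
    (s.toss a i).int a = Function.update (s.int a) i (if s.coins 0 then 1 else 0) := by
  simp [State.toss]

@[simp] theorem State.toss_int_ne (s : State) {a b : ℕ} (i : ℤ) (h : b ≠ a) :
    (s.toss a i).int b = s.int b := by
  simp [State.toss, h]

@[simp] theorem State.toss_real (s : State) (a : ℕ) (i : ℤ) : (s.toss a i).real = s.real := rfl

@[simp] theorem State.toss_coins (s : State) (a : ℕ) (i : ℤ) :
    (s.toss a i).coins = fun m => s.coins (m + 1) := rfl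

theorem MemBdd.setInt {β : ℕ} {s : State} (h : MemBdd β s) {v : ℤ} (hv : bits v ≤ β) (a : ℕ)
    (i : ℤ) : MemBdd β (s.setInt a i v) := by
  intro b j
  by_cases hb : b = a
  · subst hb
    rw [State.setInt_int_same, Function.update_apply]
    split_ifs
    · exact hv
    · exact h _ _
  · rw [State.setInt_int_ne _ _ _ hb]
    exact h _ _

/-- The state `s'` agrees with `s` except on the arrays that `p` may write to. -/
structure Frame (p : Program) (s s' : State) : Prop where
  int : ∀ a, a ∉ p.ints → s'.int a = s.int a
  real : ∀ a, a ∉ p.reals → s'.real a = s.real a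
  coins : p.tosses = false → s'.coins = s.coins

theorem Frame.refl (p : Program) (s : State) : Frame p s s :=
  ⟨fun _ _ => rfl, fun _ _ => rfl, fun _ => rfl⟩

theorem Frame.trans {p : Program} {s s' s'' : State} (h : Frame p s s') (h' : Frame p s' s'') :
    Frame p s s'' :=
  ⟨fun a ha => (h'.int a ha).trans (h.int a ha), fun a ha => (h'.real a ha).trans (h.real a ha),
    fun hc => (h'.coins hc).trans (h.coins hc)⟩

theorem Frame.widen {p q : Program} {s s' : State} (h : Frame p s s')
    (hi : p.ints ⊆ q.ints) (hr : p.reals ⊆ q.reals) (hc : q.tosses = false → p.tosses = false) :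
    Frame q s s' :=
  ⟨fun a ha => h.int a fun hp => ha (hi hp), fun a ha => h.real a fun hp => ha (hr hp),
    fun hq => h.coins (hc hq)⟩

theorem Frame.seq_left {p q : Program} {s s' : State} (h : Frame p s s') :
    Frame (p.seq q) s s' :=
  h.widen (by simp [Program.ints]) (by simp [Program.reals]) (by simp +contextual [Program.tosses])

theorem Frame.seq_right {p q : Program} {s s' : State} (h : Frame q s s') :
    Frame (p.seq q) s s' :=
  h.widen (by simp [Program.ints]) (by simp [Program.reals]) (by simp +contextual [Program.tosses])

/-- Programs write to no arrays but those named in assignments of their text. -/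
theorem Runs.frame {p : Program} {s s' : State} {t : ℕ} (h : Runs p s t s') : Frame p s s' := by
  induction h with
  | skip s => exact Frame.refl _ _
  | setInt a i v s =>
    refine ⟨fun b hb => ?_, fun b _ => rfl, fun _ => rfl⟩
    exact State.setInt_int_ne _ _ _ (by simpa [Program.ints] using hb)
  | setReal a i v s =>
    refine ⟨fun b _ => rfl, fun b hb => ?_, fun _ => rfl⟩
    exact State.setReal_real_ne _ _ _ (by simpa [Program.reals] using hb)
  | toss a i s =>
    refine ⟨fun b hb => ?_, fun b _ => rfl, fun h => by simp [Program.tosses] at h⟩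
    exact State.toss_int_ne _ _ (by simpa [Program.ints] using hb)
  | seq _ _ ih₁ ih₂ => exact ih₁.seq_left.trans ih₂.seq_right
  | condTrue _ _ ih =>
    exact ih.widen (by simp [Program.ints]) (by simp [Program.reals])
      (by simp +contextual [Program.tosses])
  | condFalse _ _ ih =>
    exact ih.widen (by simp [Program.ints]) (by simp [Program.reals])
      (by simp +contextual [Program.tosses])
  | loopTrue _ _ _ ih₁ ih₂ =>
    exact Frame.trans (ih₁.widen (by simp [Program.ints]) (by simp [Program.reals])
      (by simp +contextual [Program.tosses])) ih₂
  | loopFalse _ => exact Frame.refl _ _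

/-! ### A program logic with step counts -/

/-- Started in `s` with a memory bounded by `β`, the program halts after at most `N` elementary
steps in a state that satisfies `Q`, and the memory is bounded by `β` throughout. -/
def Ok (β : ℕ) (p : Program) (s : State) (N : ℕ) (Q : State → Prop) : Prop :=
  MemBdd β s → ∃ t s', Runs p s t s' ∧ t ≤ p.weight * (β + 1) * N ∧ MemBdd β s' ∧ Q s'

variable {β : ℕ} {s : State} {Q : State → Prop}

theorem Ok.mono {p : Program} {N N' : ℕ} {Q' : State → Prop} (h : Ok β p s N Q) (hN : N ≤ N')
    (hQ : ∀ s', Frame p s s' → Q s' → Q' s') : Ok β p s N' Q' := fun hs => by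
  obtain ⟨t, s', hr, ht, hb, hq⟩ := h hs
  exact ⟨t, s', hr, ht.trans (Nat.mul_le_mul_left _ hN), hb, hQ s' hr.frame hq⟩

theorem ok_of_memBdd {p : Program} {N : ℕ} (h : MemBdd β s → Ok β p s N Q) : Ok β p s N Q :=
  fun hs => h hs hs

theorem ok_skip {N : ℕ} (hN : 1 ≤ N) (hQ : Q s) : Ok β .skip s N Q := fun hs =>
  ⟨1, s, .skip s, by simp only [Program.weight]; nlinarith, hs, hQ⟩

theorem ok_setInt {N a : ℕ} {i v : IntExpr} (hN : 1 ≤ N) (hi : i.Fits β s) (hv : v.Fits β s)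
    (hb : bits (v.eval s) ≤ β) (hQ : Q (s.setInt a (i.eval s) (v.eval s))) :
    Ok β (.setInt a i v) s N Q := fun hs => by
  refine ⟨_, _, .setInt a i v s, ?_, hs.setInt hb _ _, hQ⟩
  refine (cost_pair_le (IntExpr.cost_le hs hi) (IntExpr.cost_le hs hv)).trans ?_
  exact Nat.le_mul_of_pos_right _ hN

theorem ok_setReal {N a : ℕ} {i : IntExpr} {v : RealExpr} (hN : 1 ≤ N) (hi : i.Fits β s)
    (hv : v.Fits β s) (hQ : Q (s.setReal a (i.eval s) (v.eval s))) :
    Ok β (.setReal a i v) s N Q := fun hs => by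
  refine ⟨_, _, .setReal a i v s, ?_, hs, hQ⟩
  refine (cost_pair_le (IntExpr.cost_le hs hi) (RealExpr.cost_le hs hv)).trans ?_
  exact Nat.le_mul_of_pos_right _ hN

theorem ok_toss {N a : ℕ} {i : IntExpr} (hN : 1 ≤ N) (hi : i.Fits β s) (hβ : 2 ≤ β)
    (hQ : Q (s.toss a (i.eval s))) : Ok β (.toss a i) s N Q := fun hs => by
  refine ⟨_, _, .toss a i s, ?_, ?_, hQ⟩
  · have := cost_pair_le (IntExpr.cost_le hs hi) (show 0 ≤ 1 ^ 2 * (β + 1) by omega)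
    exact this.trans (Nat.le_mul_of_pos_right _ hN)
  · exact hs.setInt (v := if s.coins 0 then 1 else 0)
      (by split_ifs <;> simp [bits] <;> omega) a (i.eval s)

theorem ok_seq {p q : Program} (N₁ N₂ : ℕ) {N : ℕ} {R : State → Prop} (hN : N₁ + N₂ ≤ N)
    (hp : Ok β p s N₁ R) (hq : ∀ s', Frame p s s' → R s' → Ok β q s' N₂ Q) :
    Ok β (.seq p q) s N Q := fun hs => by
  obtain ⟨t, s', hr, ht, hb, hR⟩ := hp hs
  obtain ⟨t', s'', hr', ht', hb', hQ⟩ := hq s' hr.frame hR hb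
  refine ⟨_, _, .seq hr hr', ?_, hb', hQ⟩
  simp only [Program.weight]
  have h1 : p.weight * (β + 1) * N₁ ≤ (p.weight + q.weight) * (β + 1) * N₁ := by gcongr; omega
  have h2 : q.weight * (β + 1) * N₂ ≤ (p.weight + q.weight) * (β + 1) * N₂ := by gcongr; omega
  have h3 := Nat.mul_le_mul_left ((p.weight + q.weight) * (β + 1)) hN
  nlinarith

theorem ok_cond {b : Test} {p q : Program} (N₁ : ℕ) {N : ℕ} (hN : N₁ + 1 ≤ N) (hb : b.Fits β s)
    (hp : b.Holds s → Ok β p s N₁ Q) (hq : ¬ b.Holds s → Ok β q s N₁ Q) :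
    Ok β (.cond b p q) s N Q := fun hs => by
  have hc := Test.cost_le hs hb
  have h3 := Nat.mul_le_mul_left ((b.size ^ 2 + p.weight + q.weight) * (β + 1)) hN
  by_cases h : b.Holds s
  · obtain ⟨t, s', hr, ht, hb', hQ⟩ := hp h hs
    refine ⟨_, _, .condTrue h hr, ?_, hb', hQ⟩
    simp only [Program.weight]
    have h1 : p.weight * (β + 1) * N₁ ≤ (b.size ^ 2 + p.weight + q.weight) * (β + 1) * N₁ := by
      gcongr; omega
    have h2 : b.size ^ 2 * (β + 1) ≤ (b.size ^ 2 + p.weight + q.weight) * (β + 1) := by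
      gcongr; omega
    nlinarith
  · obtain ⟨t, s', hr, ht, hb', hQ⟩ := hq h hs
    refine ⟨_, _, .condFalse h hr, ?_, hb', hQ⟩
    simp only [Program.weight]
    have h1 : q.weight * (β + 1) * N₁ ≤ (b.size ^ 2 + p.weight + q.weight) * (β + 1) * N₁ := by
      gcongr; omega
    have h2 : b.size ^ 2 * (β + 1) ≤ (b.size ^ 2 + p.weight + q.weight) * (β + 1) := by
      gcongr; omega
    nlinarith

/-- A loop that is run exactly `m` times. -/
theorem ok_loop {b : Test} {p : Program} (m N₁ : ℕ) {N : ℕ} (Inv : ℕ → State → Prop)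
    (hN : m * (N₁ + 1) + 1 ≤ N) (h0 : Inv 0 s)
    (hstep : ∀ j < m, ∀ s', MemBdd β s' → Frame p s s' → Inv j s' →
      b.Fits β s' ∧ b.Holds s' ∧ Ok β p s' N₁ (Inv (j + 1)))
    (hend : ∀ s', MemBdd β s' → Frame p s s' → Inv m s' →
      b.Fits β s' ∧ ¬ b.Holds s' ∧ Q s') :
    Ok β (.loop b p) s N Q := fun hs => by
  have key : ∀ r j, r + j = m → ∀ s', MemBdd β s' → Frame p s s' → Inv j s' →
      ∃ t s'', Runs (.loop b p) s' t s'' ∧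
        t ≤ (b.size ^ 2 + p.weight) * (β + 1) * (r * (N₁ + 1) + 1) ∧ MemBdd β s'' ∧ Q s'' := by
    intro r
    induction r with
    | zero =>
      intro j hj s' hb hf hi
      obtain rfl : j = m := by omega
      obtain ⟨h1, h2, h3⟩ := hend s' hb hf hi
      refine ⟨_, _, .loopFalse h2, (Test.cost_le hb h1).trans ?_, hb, h3⟩
      nlinarith [Nat.zero_le (p.weight * (β + 1))]
    | succ r ih =>
      intro j hj s' hb hf hi
      obtain ⟨h1, h2, h3⟩ := hstep j (by omega) s' hb hf hi
      obtain ⟨t, s₁, hr, ht, hb₁, hi₁⟩ := h3 hb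
      obtain ⟨t', s₂, hr', ht', hb₂, hQ⟩ :=
        ih (j + 1) (by omega) s₁ hb₁ (hf.trans hr.frame) hi₁
      refine ⟨_, _, .loopTrue h2 hr hr', ?_, hb₂, hQ⟩
      have hc := Test.cost_le hb h1
      have e1 : p.weight * (β + 1) * N₁ ≤ (b.size ^ 2 + p.weight) * (β + 1) * N₁ := by
        gcongr; omega
      have e2 : b.size ^ 2 * (β + 1) ≤ (b.size ^ 2 + p.weight) * (β + 1) := by
        gcongr; omega
      nlinarith
  obtain ⟨t, s', hr, ht, hb, hQ⟩ := key m 0 (by omega) s hs (Frame.refl _ _) h0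
  refine ⟨t, s', hr, ht.trans ?_, hb, hQ⟩
  exact Nat.mul_le_mul_left _ hN

instance : Add IntExpr := ⟨.op .add⟩
instance : Sub IntExpr := ⟨.op .sub⟩
instance : Mul IntExpr := ⟨.op .mul⟩
instance : Div IntExpr := ⟨.op .div⟩
instance : Mod IntExpr := ⟨.op .mod⟩
instance (m : ℕ) : OfNat IntExpr m := ⟨.const m⟩
instance : Mul RealExpr := ⟨.op .mul⟩
instance : Div RealExpr := ⟨.op .div⟩

/-- The expression `2 ^ e`, computed by a shift. -/
def IntExpr.twoPow (e : IntExpr) : IntExpr := .op .shl 1 e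

/-- The integer variable kept in cell `0` of the array `a`. -/
def IntExpr.var (a : ℕ) : IntExpr := .read a 0

/-- The real variable kept in cell `0` of the real array `a`. -/
def RealExpr.var (a : ℕ) : RealExpr := .read a 0

section simps
variable (s : State) (e f : IntExpr) (x y : RealExpr) (a : ℕ)

@[simp] theorem IntExpr.eval_const (c : ℤ) : (IntExpr.const c).eval s = c := rfl
@[simp] theorem IntExpr.eval_add : (e + f).eval s = e.eval s + f.eval s := rfl
@[simp] theorem IntExpr.eval_sub : (e - f).eval s = e.eval s - f.eval s := rfl
@[simp] theorem IntExpr.eval_mul : (e * f).eval s = e.eval s * f.eval s := rfl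
@[simp] theorem IntExpr.eval_div : (e / f).eval s = e.eval s / f.eval s := rfl
@[simp] theorem IntExpr.eval_mod : (e % f).eval s = e.eval s % f.eval s := rfl
@[simp] theorem IntExpr.eval_zero : (0 : IntExpr).eval s = 0 := rfl
@[simp] theorem IntExpr.eval_one : (1 : IntExpr).eval s = 1 := rfl
@[simp] theorem IntExpr.eval_two : (2 : IntExpr).eval s = 2 := rfl
@[simp] theorem IntExpr.eval_read : (IntExpr.read a e).eval s = s.int a (e.eval s) := rfl
@[simp] theorem IntExpr.eval_var : (IntExpr.var a).eval s = s.int a 0 := rfl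
@[simp] theorem IntExpr.eval_twoPow : (IntExpr.twoPow e).eval s = 2 ^ (e.eval s).toNat :=
  one_mul _
@[simp] theorem IntExpr.eval_band : (IntExpr.op .band e f).eval s =
    Int.land (e.eval s) (f.eval s) := rfl

variable (β : ℕ)
@[simp] theorem IntExpr.fits_add : (e + f).Fits β s ↔ e.Fits β s ∧ f.Fits β s :=
  ⟨fun h => ⟨h.1, h.2.1⟩, fun h => ⟨h.1, h.2, .inl trivial⟩⟩
@[simp] theorem IntExpr.fits_sub : (e - f).Fits β s ↔ e.Fits β s ∧ f.Fits β s :=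
  ⟨fun h => ⟨h.1, h.2.1⟩, fun h => ⟨h.1, h.2, .inl trivial⟩⟩
@[simp] theorem IntExpr.fits_mul : (e * f).Fits β s ↔ e.Fits β s ∧ f.Fits β s :=
  ⟨fun h => ⟨h.1, h.2.1⟩, fun h => ⟨h.1, h.2, .inl trivial⟩⟩
@[simp] theorem IntExpr.fits_div : (e / f).Fits β s ↔ e.Fits β s ∧ f.Fits β s :=
  ⟨fun h => ⟨h.1, h.2.1⟩, fun h => ⟨h.1, h.2, .inl trivial⟩⟩
@[simp] theorem IntExpr.fits_mod : (e % f).Fits β s ↔ e.Fits β s ∧ f.Fits β s :=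
  ⟨fun h => ⟨h.1, h.2.1⟩, fun h => ⟨h.1, h.2, .inl trivial⟩⟩
@[simp] theorem IntExpr.fits_zero : (0 : IntExpr).Fits β s := trivial
@[simp] theorem IntExpr.fits_one : (1 : IntExpr).Fits β s := trivial
@[simp] theorem IntExpr.fits_two : (2 : IntExpr).Fits β s := trivial
@[simp] theorem IntExpr.fits_const (c : ℤ) : (IntExpr.const c).Fits β s := trivial
@[simp] theorem IntExpr.fits_read : (IntExpr.read a e).Fits β s ↔ e.Fits β s := Iff.rfl
@[simp] theorem IntExpr.fits_var : (IntExpr.var a).Fits β s := trivial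
@[simp] theorem IntExpr.fits_twoPow : (IntExpr.twoPow e).Fits β s ↔
    e.Fits β s ∧ bits (2 ^ (e.eval s).toNat) ≤ β := by
  rw [← IntExpr.eval_twoPow]
  exact ⟨fun h => ⟨h.2.1, h.2.2.resolve_left id⟩, fun h => ⟨trivial, h.1, .inr h.2⟩⟩
@[simp] theorem IntExpr.fits_band : (IntExpr.op .band e f).Fits β s ↔
    e.Fits β s ∧ f.Fits β s ∧ bits (Int.land (e.eval s) (f.eval s)) ≤ β :=
  ⟨fun h => ⟨h.1, h.2.1, h.2.2.resolve_left id⟩, fun h => ⟨h.1, h.2.1, .inr h.2.2⟩⟩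

@[simp] theorem RealExpr.eval_mul : (x * y).eval s = x.eval s * y.eval s := rfl
@[simp] theorem RealExpr.eval_div : (x / y).eval s = x.eval s / y.eval s := rfl
@[simp] theorem RealExpr.eval_ofInt : (RealExpr.ofInt e).eval s = (e.eval s : ℝ) := rfl
@[simp] theorem RealExpr.eval_read : (RealExpr.read a e).eval s = s.real a (e.eval s) := rfl
@[simp] theorem RealExpr.eval_var : (RealExpr.var a).eval s = s.real a 0 := rfl
@[simp] theorem RealExpr.fits_mul : (x * y).Fits β s ↔ x.Fits β s ∧ y.Fits β s := Iff.rfl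
@[simp] theorem RealExpr.fits_div : (x / y).Fits β s ↔ x.Fits β s ∧ y.Fits β s := Iff.rfl
@[simp] theorem RealExpr.fits_ofInt : (RealExpr.ofInt e).Fits β s ↔ e.Fits β s := Iff.rfl
@[simp] theorem RealExpr.fits_read : (RealExpr.read a e).Fits β s ↔ e.Fits β s := Iff.rfl
@[simp] theorem RealExpr.fits_var : (RealExpr.var a).Fits β s := trivial

@[simp] theorem Test.holds_intLt : (Test.intLt e f).Holds s ↔ e.eval s < f.eval s := Iff.rfl
@[simp] theorem Test.holds_intEq : (Test.intEq e f).Holds s ↔ e.eval s = f.eval s := Iff.rfl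
@[simp] theorem Test.holds_realLt : (Test.realLt x y).Holds s ↔ x.eval s < y.eval s := Iff.rfl
@[simp] theorem Test.holds_realLe : (Test.realLe x y).Holds s ↔ x.eval s ≤ y.eval s := Iff.rfl
@[simp] theorem Test.fits_intLt : (Test.intLt e f).Fits β s ↔ e.Fits β s ∧ f.Fits β s := Iff.rfl
@[simp] theorem Test.fits_intEq : (Test.intEq e f).Fits β s ↔ e.Fits β s ∧ f.Fits β s := Iff.rfl
@[simp] theorem Test.fits_realLt : (Test.realLt x y).Fits β s ↔ x.Fits β s ∧ y.Fits β s := Iff.rfl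
@[simp] theorem Test.fits_realLe : (Test.realLe x y).Fits β s ↔ x.Fits β s ∧ y.Fits β s := Iff.rfl

end simps

theorem bits_two_pow_le {m β : ℕ} (h : m + 2 ≤ β) : bits (2 ^ m) ≤ β :=
  (bits_le_of_lt (m := m + 1) (by positivity)
    (pow_lt_pow_right₀ (by norm_num) (Nat.lt_succ_self m))).trans h

theorem bits_natCast_le {m β : ℕ} (h : m + 1 ≤ β) : bits (m : ℤ) ≤ β :=
  (bits_le_of_lt (m := m) (by positivity) (by exact_mod_cast Nat.lt_two_pow_self)).trans h

theorem bits_natCast_mono {m m' : ℕ} (h : m ≤ m') : bits (m : ℤ) ≤ bits (m' : ℤ) :=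
  bits_mono (by simpa using h)

/-- Assignment to the integer variable `a`. -/
def Program.assign (a : ℕ) (v : IntExpr) : Program := .setInt a 0 v

/-- `for i = 0, …, e - 1 do p`. -/
def Program.forTo (i : ℕ) (e : IntExpr) (p : Program) : Program :=
  (Program.assign i 0).seq (.loop (.intLt (.var i) e) (p.seq (.assign i (.var i + 1))))

theorem ok_assign {N a : ℕ} {v : IntExpr} (hN : 1 ≤ N) (hv : v.Fits β s)
    (hb : bits (v.eval s) ≤ β) (hQ : Q (s.setInt a 0 (v.eval s))) :
    Ok β (.assign a v) s N Q :=
  ok_setInt hN trivial hv hb hQ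

/-- The invariant `Inv j` holds before round `j`, with the counter set to `j`. -/
theorem ok_forTo {i : ℕ} {e : IntExpr} {p : Program} (m N₁ : ℕ) {N : ℕ}
    (Inv : ℕ → State → Prop) (hN : m * (N₁ + 2) + 2 ≤ N) (hm : bits (m : ℤ) ≤ β)
    (hi : i ∉ p.ints)
    (he : ∀ s', MemBdd β s' → Frame (.forTo i e p) s s' → e.Fits β s' ∧ e.eval s' = m)
    (h0 : Inv 0 (s.setInt i 0 0))
    (hstep : ∀ j < m, ∀ s', MemBdd β s' → Frame (.forTo i e p) s s' → s'.int i 0 = j → Inv j s' →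
      Ok β p s' N₁ fun s'' => Inv (j + 1) (s''.setInt i 0 (j + 1)))
    (hQ : ∀ s', Frame (.forTo i e p) s s' → Inv m s' → Q s') :
    Ok β (.forTo i e p) s N Q := by
  have hβ : 1 ≤ β := le_trans (by simp [bits]) hm
  have hfr : ∀ s', Frame (p.seq (.assign i (.var i + 1))) (s.setInt i 0 0) s' →
      Frame (.forTo i e p) s s' := by
    intro s' h
    refine ⟨fun a ha => ?_, fun a ha => ?_, fun hc => ?_⟩
    · simp only [Program.forTo, Program.ints, Program.assign, List.mem_append,
        List.mem_singleton, not_or] at ha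
      rw [h.int a (by simp [Program.ints, Program.assign, ha]),
        State.setInt_int_ne _ _ _ ha.1]
    · simp only [Program.forTo, Program.reals, Program.assign, List.mem_append] at ha
      rw [h.real a (by simpa [Program.reals, Program.assign] using ha)]
      rfl
    · simp only [Program.forTo, Program.tosses, Program.assign] at hc
      rw [h.coins (by simpa [Program.tosses, Program.assign] using hc)]
      rfl
  refine ok_seq (R := fun s' => s' = s.setInt i 0 0) 1 (m * (N₁ + 2) + 1) (by omega)
    (ok_assign le_rfl trivial (by simpa [bits] using hβ) (by simp)) ?_
  rintro _ - rfl
  refine ok_loop m (N₁ + 1) (fun j s' => s'.int i 0 = j ∧ Inv j s') le_rfl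
    (by simpa using h0) ?_ ?_
  · rintro j hj s' hb hf ⟨hij, hI⟩
    have hF := hfr s' hf
    refine ⟨by simpa using (he s' hb hF).1, ?_, ?_⟩
    · simp [hij, (he s' hb hF).2, hj]
    refine ok_seq N₁ 1 le_rfl (hstep j hj s' hb hF hij hI) ?_
    intro s'' hf' hI'
    have h1 : s''.int i 0 = j := by rw [hf'.int i hi, hij]
    refine ok_assign le_rfl (by simp) ?_ ?_
    · simp only [IntExpr.eval_add, IntExpr.eval_var, h1, IntExpr.eval_one]
      refine le_trans ?_ hm
      exact_mod_cast bits_natCast_mono (Nat.succ_le_of_lt hj)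
    · simp only [IntExpr.eval_add, IntExpr.eval_var, h1, IntExpr.eval_one]
      exact ⟨by simp, hI'⟩
  · rintro s' hb hf ⟨hij, hI⟩
    have hF := hfr s' hf
    refine ⟨by simpa using (he s' hb hF).1, ?_, hQ s' hF hI⟩
    simp [hij, (he s' hb hF).2]

end RandRAM

namespace RandRAM

variable {β : ℕ} {s : State} {Q : State → Prop}

/-- A loop whose body fills cell `j` of the array `a` in round `j`. -/
theorem ok_fill {i a : ℕ} {e : IntExpr} {p : Program} (m N₁ : ℕ) (F : ℕ → ℤ)
    {N : ℕ} (hN : m * (N₁ + 2) + 2 ≤ N) (hm : bits (m : ℤ) ≤ β) (hi : i ∉ p.ints) (hia : a ≠ i)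
    (he : ∀ s', MemBdd β s' → Frame (.forTo i e p) s s' → e.Fits β s' ∧ e.eval s' = m)
    (hstep : ∀ j < m, ∀ s', MemBdd β s' → Frame (.forTo i e p) s s' → s'.int i 0 = j →
      (∀ c : ℕ, m ≤ c → s'.int a c = s.int a c) →
      Ok β p s' N₁ fun s'' => s''.int a = Function.update (s'.int a) j (F j)) :
    Ok β (.forTo i e p) s N fun s' => (∀ j < m, s'.int a j = F j) ∧
      ∀ c : ℕ, m ≤ c → s'.int a c = s.int a c := by
  refine ok_forTo m N₁ (fun r s' => (∀ j < r, s'.int a j = F j) ∧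
    ∀ c : ℕ, r ≤ c → s'.int a c = s.int a c) hN hm hi he
    (by simp [hia]) ?_ (fun s' _ h => h)
  rintro j hj s' hb hf hij ⟨h1, h2⟩
  refine (hstep j hj s' hb hf hij fun c hc => h2 c (by omega)).mono le_rfl ?_
  intro s'' _ h
  simp only [State.setInt_int_ne _ _ _ hia, h, Function.update_apply, Nat.cast_inj]
  refine ⟨fun c hc => ?_, fun c hc => ?_⟩
  · split_ifs with h3
    · rw [h3]
    · exact h1 c (by omega)
  · rw [if_neg (by omega), h2 c (by omega)]

/-- A loop that adds the values of an expression to the variable `y`. -/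
theorem ok_sum {i y : ℕ} {e v : IntExpr} (m : ℕ) (f : ℕ → ℤ) {N : ℕ} (hN : m * 3 + 2 ≤ N)
    (hm : bits (m : ℤ) ≤ β) (hiy : y ≠ i)
    (he : ∀ s' : State, (∀ a, a ≠ i → a ≠ y → s'.int a = s.int a) → e.Fits β s' ∧ e.eval s' = m)
    (hv : ∀ j < m, ∀ s' : State, (∀ a, a ≠ i → a ≠ y → s'.int a = s.int a) → s'.int i 0 = j →
      v.Fits β s' ∧ v.eval s' = f j)
    (hb : ∀ j ≤ m, bits (s.int y 0 + ∑ l ∈ Finset.range j, f l) ≤ β) :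
    Ok β (.forTo i e (.assign y (.var y + v))) s N fun s' =>
      s'.int y 0 = s.int y 0 + ∑ l ∈ Finset.range m, f l := by
  have hfr : ∀ s', Frame (.forTo i e (.assign y (.var y + v))) s s' →
      ∀ a, a ≠ i → a ≠ y → s'.int a = s.int a := fun s' h a h1 h2 =>
    h.int a (by simp [Program.forTo, Program.assign, Program.ints, h1, h2])
  refine ok_forTo m 1 (fun r s' => s'.int y 0 = s.int y 0 + ∑ l ∈ Finset.range r, f l) hN hm
    (by simpa [Program.assign, Program.ints] using hiy.symm) (fun s' _ h => he s' (hfr s' h))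
    (by simp [hiy]) ?_ (fun s' _ h => h)
  intro j hj s' _ hf hij hI
  obtain ⟨h1, h2⟩ := hv j hj s' (hfr s' hf) hij
  have h3 : (IntExpr.var y + v).eval s' = s.int y 0 + ∑ l ∈ Finset.range (j + 1), f l := by
    rw [IntExpr.eval_add, IntExpr.eval_var, hI, h2, Finset.sum_range_succ, add_assoc]
  refine ok_assign le_rfl (by simp [h1]) (h3 ▸ hb (j + 1) hj) ?_
  rw [h3]
  simp [hiy]

end RandRAM

/-! ### Names of the arrays -/

/-! The names `0` to `4` are those of the input and the output. The prefix `a` marks a table, `v`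
a variable kept in cell `0`, and `i` a counter. The tables are the marked vertices of the tree,
the order of its vertices, the parents, the labels, the adjacency matrix and the weights in use,
the edge factors, the values that are folded, and the fixed images. The variables `vB` and `vD`
are the length of vertex numbers and the number of coins per label; `vSLOT` is the number of bits
per coefficient of the sieve, `vDEG` the number of coefficients per weight, and `vNSLOTS` the
number of all coefficients; `vH`, `vQ`, `vU`, `vMASK` are the value of the sieve, its parities,
the selected one among them, and the mask for the parities. The number of squarings is `vL`, a
bound for its length is `vBL`, and `vMI` is the bound for the rounded weights. -/

local notation "aMARK" => (5 : ℕ)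
local notation "aORD" => (6 : ℕ)
local notation "aPAR" => (7 : ℕ)
local notation "vB" => (8 : ℕ)
local notation "vD" => (9 : ℕ)
local notation "vSLOT" => (10 : ℕ)
local notation "vDEG" => (11 : ℕ)
local notation "aXZ" => (12 : ℕ)
local notation "aADJ" => (13 : ℕ)
local notation "aWT" => (14 : ℕ)
local notation "aEDGE" => (15 : ℕ)
local notation "aG" => (16 : ℕ)
local notation "aFIX" => (17 : ℕ)
local notation "vH" => (18 : ℕ)
local notation "vQ" => (19 : ℕ)
local notation "vU" => (20 : ℕ)
local notation "vMASK" => (21 : ℕ)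
local notation "vY" => (22 : ℕ)
local notation "vNSLOTS" => (23 : ℕ)
local notation "vCH" => (24 : ℕ)
local notation "vCOIN" => (25 : ℕ)
local notation "vNA" => (26 : ℕ)
local notation "vNV" => (27 : ℕ)
local notation "vBL" => (28 : ℕ)
local notation "vL" => (29 : ℕ)
local notation "vMI" => (30 : ℕ)
local notation "iX" => (31 : ℕ)
local notation "iP" => (32 : ℕ)
local notation "iV" => (33 : ℕ)
local notation "iU" => (34 : ℕ)
local notation "iL" => (35 : ℕ)
local notation "iM" => (36 : ℕ)
local notation "iE" => (37 : ℕ)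
local notation "iFP" => (38 : ℕ)
local notation "iFV" => (39 : ℕ)
local notation "iT" => (40 : ℕ)
local notation "iI" => (42 : ℕ)
local notation "vR" => (43 : ℕ)
local infixr:30 " ;; " => Program.seq

namespace MinWeightTree

/-! ### Sums over the homomorphisms from a tree -/

section homSum
variable {R : Type*} [CommSemiring R]

/-- Absorb the last position `q` of the tree into its parent: the value at the parent is multiplied
by the sum over all images of `q`. -/
def foldAt (n : ℕ) (par : ℕ → ℕ) (E : ℕ → ℕ → R) (q : ℕ) (g : ℕ → ℕ → R) : ℕ → ℕ → R :=
  fun p v => if p = par q then g p v * ∑ u ∈ Finset.range n, E v u * g q u else g p v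

/-- For the tree on the positions `0, …, q` in which `p > 0` is a child of `par p < p`, the sum over
all maps `φ` from the positions to `{0, …, n - 1}` of
`(∏ p, g p (φ p)) * ∏ p > 0, E (φ (par p)) (φ p)`. -/
def homSum (n : ℕ) (par : ℕ → ℕ) (E : ℕ → ℕ → R) : ℕ → (ℕ → ℕ → R) → R
  | 0, g => ∑ v ∈ Finset.range n, g 0 v
  | q + 1, g => homSum n par E q (foldAt n par E (q + 1) g)

theorem homSum_congr {n : ℕ} {par : ℕ → ℕ} {E E' : ℕ → ℕ → R}
    (hE : ∀ v < n, ∀ u < n, E v u = E' v u) :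
    ∀ (q : ℕ) {g g' : ℕ → ℕ → R}, (∀ p ≤ q, ∀ v < n, g p v = g' p v) →
      homSum n par E q g = homSum n par E' q g'
  | 0, g, g', h => Finset.sum_congr rfl fun v hv => h 0 le_rfl v (Finset.mem_range.1 hv)
  | q + 1, g, g', h => by
    refine homSum_congr hE q fun p hp v hv => ?_
    unfold foldAt
    rw [h p (by omega) v hv]
    have : ∑ u ∈ Finset.range n, E v u * g (q + 1) u =
        ∑ u ∈ Finset.range n, E' v u * g' (q + 1) u :=
      Finset.sum_congr rfl fun u hu => by
        rw [hE v hv u (Finset.mem_range.1 hu), h _ le_rfl u (Finset.mem_range.1 hu)]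
    rw [this]

/-- The sum over the homomorphisms commutes with ring homomorphisms, so that one and the same
summation can be read over the integers, over polynomials, and modulo two. -/
theorem homSum_map {S : Type*} [CommSemiring S] (f : R →+* S) {n : ℕ} {par : ℕ → ℕ}
    {E : ℕ → ℕ → R} : ∀ (q : ℕ) (g : ℕ → ℕ → R),
      f (homSum n par E q g) = homSum n par (fun v u => f (E v u)) q (fun p v => f (g p v))
  | 0, g => by simp [homSum]
  | q + 1, g => by
    rw [homSum, homSum_map f q, homSum]
    congr 1
    funext p v
    unfold foldAt
    split_ifs <;> simp

/-- The initial value at the cell `m = p * n + v`: zero if position `p` is fixed to an image other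
than `v`, and otherwise the product of the label `x m` and of the part selected by the bits of `X`
of the sum of the labels of `v`. -/
def initVal (n k : ℕ) (x : ℕ → R) (fix : ℕ → ℕ) (X m : ℕ) : R :=
  if fix (m / n) = 0 ∨ fix (m / n) = m % n + 1 then
    x m * ∑ l ∈ Finset.range k, ((X / 2 ^ l % 2 : ℕ) : R) * x (k * n + (m % n) * k + l)
  else 0

/-- The sum over all sets `X` of labels of the homomorphism sums for `initVal`. -/
def sieveSum (n k : ℕ) (par : ℕ → ℕ) (E : ℕ → ℕ → R) (x : ℕ → R) (fix : ℕ → ℕ) : R :=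
  ∑ X ∈ Finset.range (2 ^ k),
    homSum n par E (k - 1) fun p v => initVal n k x fix X (p * n + v)

theorem sieveSum_map {S : Type*} [CommSemiring S] (f : R →+* S) {n k : ℕ} {par fix : ℕ → ℕ}
    {E : ℕ → ℕ → R} {x : ℕ → R} : f (sieveSum n k par E x fix) =
      sieveSum n k par (fun v u => f (E v u)) (fun m => f (x m)) fix := by
  unfold sieveSum
  rw [map_sum]
  refine Finset.sum_congr rfl fun X _ => ?_
  rw [homSum_map]
  congr 1
  funext p v
  unfold initVal
  split_ifs <;> simp

end homSum

theorem sum_lt_two_pow {a b j : ℕ} {f : ℕ → ℤ} (hj : j ≤ 2 ^ b)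
    (h : ∀ u < j, 0 ≤ f u ∧ f u < 2 ^ a) :
    0 ≤ ∑ u ∈ Finset.range j, f u ∧ ∑ u ∈ Finset.range j, f u < 2 ^ (a + b) := by
  refine ⟨Finset.sum_nonneg fun u hu => (h u (Finset.mem_range.1 hu)).1, ?_⟩
  have h1 : ∑ u ∈ Finset.range j, f u ≤ ∑ u ∈ Finset.range j, ((2 : ℤ) ^ a - 1) :=
    Finset.sum_le_sum fun u hu => by have := (h u (Finset.mem_range.1 hu)).2; omega
  rw [Finset.sum_const, Finset.card_range, nsmul_eq_mul] at h1
  have h2 : (j : ℤ) ≤ 2 ^ b := by exact_mod_cast hj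
  have h3 : (1 : ℤ) ≤ 2 ^ a := one_le_pow₀ (by norm_num)
  have h4 : (0 : ℤ) < 2 ^ b := by positivity
  rw [pow_add]
  nlinarith

theorem mul_lt_two_pow {a b : ℕ} {x y : ℤ} (hx : 0 ≤ x ∧ x < 2 ^ a) (hy : 0 ≤ y ∧ y < 2 ^ b) :
    0 ≤ x * y ∧ x * y < 2 ^ (a + b) :=
  ⟨mul_nonneg hx.1 hy.1, by rw [pow_add]; exact mul_lt_mul'' hx.2 hy.2 hx.1 hy.1⟩

theorem lt_two_pow_mono {a b : ℕ} {x : ℤ} (hx : 0 ≤ x ∧ x < 2 ^ a) (h : a ≤ b) :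
    0 ≤ x ∧ x < 2 ^ b :=
  ⟨hx.1, hx.2.trans_le (pow_le_pow_right₀ (by norm_num) h)⟩

theorem bits_le {a β : ℕ} {x : ℤ} (hx : 0 ≤ x ∧ x < 2 ^ a) (h : a + 1 ≤ β) : bits x ≤ β :=
  (bits_le_of_lt hx.1 hx.2).trans h

/-- Exponents bounding the values after one step of folding. -/
def foldExp (par : ℕ → ℕ) (h q : ℕ) (e : ℕ → ℕ) : ℕ → ℕ :=
  Function.update e (par q) (e (par q) + (e q + h))

theorem sum_foldExp {par : ℕ → ℕ} {h q : ℕ} (e : ℕ → ℕ) (hq : par (q + 1) < q + 1) :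
    ∑ p ∈ Finset.range (q + 1), foldExp par h (q + 1) e p =
      ∑ p ∈ Finset.range (q + 2), e p + h := by
  have hm : par (q + 1) ∈ Finset.range (q + 1) := Finset.mem_range.2 hq
  rw [foldExp, Finset.sum_update_of_mem hm, Finset.sum_range_succ _ (q + 1),
    ← Finset.add_sum_erase _ _ hm, Finset.sdiff_singleton_eq_erase]
  ring

theorem foldAt_bounds {n b ee : ℕ} {par : ℕ → ℕ} {E : ℕ → ℕ → ℤ} (hn : n ≤ 2 ^ b)
    (hE : ∀ v < n, ∀ u < n, 0 ≤ E v u ∧ E v u < 2 ^ ee) {q : ℕ} {g : ℕ → ℕ → ℤ} {e : ℕ → ℕ}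
    (hg : ∀ p ≤ q + 1, ∀ v < n, 0 ≤ g p v ∧ g p v < 2 ^ e p) :
    ∀ p ≤ q, ∀ v < n, 0 ≤ foldAt n par E (q + 1) g p v ∧
      foldAt n par E (q + 1) g p v < 2 ^ foldExp par (b + ee) (q + 1) e p := by
  intro p hp v hv
  unfold foldAt foldExp
  split_ifs with h
  · rw [← h, Function.update_self]
    refine mul_lt_two_pow (hg p (by omega) v hv) ?_
    have := sum_lt_two_pow hn (f := fun u => E v u * g (q + 1) u) (a := ee + e (q + 1))
      fun u hu => mul_lt_two_pow (hE v hv u hu) (hg _ le_rfl u hu)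
    exact lt_two_pow_mono this (by omega)
  · rw [Function.update_of_ne h]
    exact hg p (by omega) v hv

theorem homSum_bounds {n b ee : ℕ} {par : ℕ → ℕ} {E : ℕ → ℕ → ℤ} (hn : n ≤ 2 ^ b)
    (hE : ∀ v < n, ∀ u < n, 0 ≤ E v u ∧ E v u < 2 ^ ee) :
    ∀ (q : ℕ) {g : ℕ → ℕ → ℤ} {e : ℕ → ℕ}, (∀ p, 0 < p → p ≤ q → par p < p) →
      (∀ p ≤ q, ∀ v < n, 0 ≤ g p v ∧ g p v < 2 ^ e p) →
      0 ≤ homSum n par E q g ∧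
        homSum n par E q g < 2 ^ (∑ p ∈ Finset.range (q + 1), e p + q * (b + ee) + b)
  | 0, g, e, _, hg => by
    have := sum_lt_two_pow hn fun u hu => hg 0 le_rfl u hu
    simpa [homSum] using this
  | q + 1, g, e, hp, hg => by
    have := homSum_bounds hn hE q (fun p h1 h2 => hp p h1 (by omega))
      (foldAt_bounds (par := par) hn hE hg)
    rw [sum_foldExp e (hp (q + 1) (by omega) le_rfl)] at this
    rw [homSum]
    refine lt_two_pow_mono this (le_of_eq ?_)
    ring

theorem initVal_bounds {n k ex X m : ℕ} {x : ℕ → ℤ} {fix : ℕ → ℕ} (hm : m < k * n)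
    (hx : ∀ m < 2 * k * n, 0 ≤ x m ∧ x m < 2 ^ ex) :
    0 ≤ initVal n k x fix X m ∧ initVal n k x fix X m < 2 ^ (2 * ex + k) := by
  unfold initVal
  split_ifs
  · have h1 := sum_lt_two_pow (j := k) (b := k) (a := ex) Nat.lt_two_pow_self.le
      (f := fun l => ((X / 2 ^ l % 2 : ℕ) : ℤ) * x (k * n + (m % n) * k + l)) ?_
    · exact lt_two_pow_mono (mul_lt_two_pow (hx m (by nlinarith)) h1) (by omega)
    · intro l hl
      have hn : 0 < n := Nat.pos_of_ne_zero (by rintro rfl; simp at hm)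
      have h2 := Nat.mod_lt m hn
      obtain ⟨h3, h4⟩ := hx (k * n + (m % n) * k + l) (by nlinarith)
      rcases Nat.mod_two_eq_zero_or_one (X / 2 ^ l) with h | h <;> simp [h, h3, h4]
  · exact ⟨le_rfl, by positivity⟩

theorem cell_div {n p v : ℕ} (hv : v < n) : (p * n + v) / n = p := by
  rw [mul_comm, Nat.mul_add_div (by omega), Nat.div_eq_of_lt hv, add_zero]

theorem cell_mod {n p v : ℕ} (hv : v < n) : (p * n + v) % n = v := by
  rw [mul_comm, Nat.mul_add_mod, Nat.mod_eq_of_lt hv]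

theorem cell_lt {n k p v : ℕ} (hp : p < k) (hv : v < n) : p * n + v < k * n := by
  have := Nat.mul_le_mul_right n hp
  rw [Nat.succ_eq_add_one, add_mul] at this
  omega

theorem cell_inj {n p v p' v' : ℕ} (hv : v < n) (hv' : v' < n) :
    p * n + v = p' * n + v' ↔ p = p' ∧ v = v' := by
  refine ⟨fun h => ⟨?_, ?_⟩, fun h => by rw [h.1, h.2]⟩
  · rw [← cell_div (p := p) hv, h, cell_div hv']
  · rw [← cell_mod (p := p) hv, h, cell_mod hv']

theorem sieveSum_bounds {n k b ee ex : ℕ} {par : ℕ → ℕ} {E : ℕ → ℕ → ℤ} (hn : n ≤ 2 ^ b)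
    (hk : 1 ≤ k) (hE : ∀ v < n, ∀ u < n, 0 ≤ E v u ∧ E v u < 2 ^ ee)
    (hp : ∀ p, 0 < p → p < k → par p < p) {x : ℕ → ℤ} {fix : ℕ → ℕ}
    (hx : ∀ m < 2 * k * n, 0 ≤ x m ∧ x m < 2 ^ ex) :
    0 ≤ sieveSum n k par E x fix ∧
      sieveSum n k par E x fix < 2 ^ (k * (2 * ex + k + b + ee) + b + k) := by
  refine sum_lt_two_pow le_rfl fun X _ => ?_
  have := homSum_bounds hn hE (k - 1) (e := fun _ => 2 * ex + k)
    (fun p h1 h2 => hp p h1 (by omega))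
    (g := fun p v => initVal n k x fix X (p * n + v))
    fun p h1 v hv => initVal_bounds (cell_lt (by omega) hv) hx
  refine lt_two_pow_mono this ?_
  obtain ⟨j, rfl⟩ : ∃ j, k = j + 1 := ⟨k - 1, by omega⟩
  simp only [Finset.sum_const, Finset.card_range, smul_eq_mul, Nat.add_sub_cancel]
  nlinarith

/-! ### Evaluation of the sieve -/

/-- Compute the initial values for the label set given by the bits of `iX`. -/
def initProg : Program :=
  .forTo iM (.read 0 1 * .read 0 0) (.assign vY 0 ;;
    .forTo iL (.read 0 1) (.assign vY (.var vY +
      .var iX / .twoPow (.var iL) % 2 * .read aXZ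
        (.read 0 1 * .read 0 0 + .var iM % .read 0 0 * .read 0 1 + .var iL))) ;;
    .cond (.intEq (.read aFIX (.var iM / .read 0 0) *
        (.read aFIX (.var iM / .read 0 0) - (.var iM % .read 0 0 + 1))) 0)
      (.setInt aG (.var iM) (.read aXZ (.var iM) * .var vY))
      (.setInt aG (.var iM) 0))

/-- Each cell is a label times a sum of at most `k` labels. As labels have at most `ex` bits, the
bound `2 * ex + k` suffices for the lengths. -/
theorem ok_initProg {β : ℕ} {s : State} {n k ex X : ℕ} {fix : ℕ → ℕ} {x : ℕ → ℤ}
    (hn : s.int 0 0 = n) (hk : s.int 0 1 = k)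
    (hX : s.int iX 0 = X) (hfix : ∀ p < k, s.int aFIX p = fix p)
    (hx : ∀ m < 2 * k * n, s.int aXZ m = x m ∧ 0 ≤ x m ∧ x m < 2 ^ ex)
    (hβ : 2 * ex + k + 2 ≤ β) (hβ' : bits (k * n : ℕ) ≤ β) :
    Ok β initProg s (k * n * (3 * k + 10) + 2) fun s' => ∀ m < k * n,
      s'.int aG m = initVal n k x fix X m := by
  refine (ok_fill (k * n) (3 * k + 6) (fun m => initVal n k x fix X m) ?_ hβ'
    (by decide) (by decide) ?_ ?_).mono le_rfl fun s' _ h => h.1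
  · ring_nf; omega
  · intro s' _ hf
    have h0 := hf.int 0 (by decide)
    simp [h0, hn, hk]
  intro m hm s' hb hf hm' _
  have h0 := hf.int 0 (by decide)
  have hX' := hf.int iX (by decide)
  have hF' := hf.int aFIX (by decide)
  have hx' := hf.int aXZ (by decide)
  have hn0 : 0 < n := Nat.pos_of_ne_zero (by rintro rfl; simp at hm)
  have hmn := Nat.mod_lt m hn0
  have hmk : m / n < k := Nat.div_lt_of_lt_mul (by rwa [mul_comm])
  set f : ℕ → ℤ := fun l => ((X / 2 ^ l % 2 : ℕ) : ℤ) * x (k * n + (m % n) * k + l) with hfdef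
  have hf1 : ∀ l < k, 0 ≤ f l ∧ f l < 2 ^ ex := by
    intro l hl
    obtain ⟨-, h3, h4⟩ := hx (k * n + (m % n) * k + l) (by nlinarith)
    rcases Nat.mod_two_eq_zero_or_one (X / 2 ^ l) with h | h <;>
      simp only [f, h] <;> simp [h3, h4]
  refine ok_seq (R := fun t => t.int vY 0 = 0) 1 (3 * k + 4) (by omega)
    (ok_assign le_rfl (by simp) (by simp [bits]; omega) (by simp)) ?_
  intro s₁ hf₁ hy
  refine ok_seq (R := fun t => t.int vY 0 = ∑ l ∈ Finset.range k, f l) (3 * k + 2) 2 (by omega)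
    ((ok_sum k f (by omega) (bits_natCast_le (by omega)) (by decide) ?_ ?_ ?_).mono le_rfl ?_) ?_
  · intro s₂ h
    simp [h 0 (by decide) (by decide), hf₁.int 0 (by decide), h0, hk]
  · intro l hl s₂ h hl'
    have hxl := (hx (k * n + (m % n) * k + l) (by nlinarith)).1
    have e1 : s₂.int 0 = s.int 0 := by rw [h 0 (by decide) (by decide), hf₁.int 0 (by decide), h0]
    have e2 : s₂.int iX = s.int iX := by
      rw [h iX (by decide) (by decide), hf₁.int iX (by decide), hX']
    have e3 : s₂.int aXZ = s.int aXZ := by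
      rw [h aXZ (by decide) (by decide), hf₁.int aXZ (by decide), hx']
    have e4 : s₂.int iM 0 = m := by
      rw [h iM (by decide) (by decide), hf₁.int iM (by decide), hm']
    refine ⟨?_, ?_⟩
    · simp only [IntExpr.fits_mul, IntExpr.fits_mod, IntExpr.fits_div, IntExpr.fits_var,
        IntExpr.fits_twoPow, IntExpr.fits_read, IntExpr.fits_add, IntExpr.fits_two,
        IntExpr.fits_one, IntExpr.fits_zero, IntExpr.eval_var, hl', Int.toNat_natCast, true_and,
        and_true]
      exact bits_two_pow_le (by omega)
    · simp only [IntExpr.eval_mul, IntExpr.eval_mod, IntExpr.eval_div, IntExpr.eval_var,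
        IntExpr.eval_twoPow, IntExpr.eval_read, IntExpr.eval_add, IntExpr.eval_two,
        IntExpr.eval_one, IntExpr.eval_zero, e1, e2, e3, e4, hl', hn, hk, hX, f,
        Int.toNat_natCast]
      rw [← hxl]
      push_cast
      rfl
  · intro j hj
    rw [hy, zero_add]
    have := sum_lt_two_pow (b := k) (hj.trans Nat.lt_two_pow_self.le)
      fun l hl => hf1 l (lt_of_lt_of_le hl hj)
    exact bits_le this (by omega)
  · intro s₂ _ h
    rw [h, hy, zero_add]
  intro s₂ hf₂ hy₂
  have e1 : s₂.int 0 = s.int 0 := by rw [hf₂.int 0 (by decide), hf₁.int 0 (by decide), h0]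
  have e2 : s₂.int aG = s'.int aG := by rw [hf₂.int aG (by decide), hf₁.int aG (by decide)]
  have e3 : s₂.int aXZ = s.int aXZ := by
    rw [hf₂.int aXZ (by decide), hf₁.int aXZ (by decide), hx']
  have e4 : s₂.int iM 0 = m := by rw [hf₂.int iM (by decide), hf₁.int iM (by decide), hm']
  have e5 : s₂.int aFIX = s.int aFIX := by
    rw [hf₂.int aFIX (by decide), hf₁.int aFIX (by decide), hF']
  have e6 := hfix (m / n) hmk
  push_cast at e6
  have hxm := hx m (by nlinarith)
  have hcond : (fix (m / n) : ℤ) * (fix (m / n) - ((m : ℤ) % n + 1)) = 0 ↔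
      fix (m / n) = 0 ∨ fix (m / n) = m % n + 1 := by
    rw [mul_eq_zero, sub_eq_zero]
    norm_cast
  have hsum := sum_lt_two_pow (b := k) (Nat.lt_two_pow_self.le) hf1
  refine ok_cond 1 le_rfl (by simp) (fun h => ?_) (fun h => ?_)
  · simp only [Test.holds_intEq, IntExpr.eval_mul, IntExpr.eval_sub, IntExpr.eval_add,
      IntExpr.eval_mod, IntExpr.eval_div, IntExpr.eval_read, IntExpr.eval_var, IntExpr.eval_one,
      IntExpr.eval_zero, e1, e4, e5, e6, hn, hcond] at h
    have hval : initVal n k x fix X m = x m * ∑ l ∈ Finset.range k, f l := by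
      rw [initVal, if_pos h]
    refine ok_setInt le_rfl (by simp) (by simp) ?_ ?_
    · simp only [IntExpr.eval_mul, IntExpr.eval_read, IntExpr.eval_var, e3, e4, hy₂, hxm.1]
      exact bits_le (mul_lt_two_pow hxm.2 hsum) (by omega)
    · simp only [IntExpr.eval_mul, IntExpr.eval_read, IntExpr.eval_var, e3, e4, hy₂, hxm.1, hval,
        State.setInt_int_same, e2]
  · simp only [Test.holds_intEq, IntExpr.eval_mul, IntExpr.eval_sub, IntExpr.eval_add,
      IntExpr.eval_mod, IntExpr.eval_div, IntExpr.eval_read, IntExpr.eval_var, IntExpr.eval_one,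
      IntExpr.eval_zero, e1, e4, e5, e6, hn, hcond] at h
    have hval : initVal n k x fix X m = 0 := by
      rw [initVal, if_neg h]
    refine ok_setInt le_rfl (by simp) (by simp) (by simp [bits]; omega) ?_
    simp only [IntExpr.eval_zero, IntExpr.eval_var, e4, hval, State.setInt_int_same, e2]


/-- Absorb the positions `k - 1, …, 1` one after the other. -/
def foldProg : Program :=
  .forTo iP (.read 0 1 - 1) (.forTo iV (.read 0 0) (.assign vY 0 ;;
    .forTo iU (.read 0 0) (.assign vY (.var vY +
      .read aEDGE (.var iV * .read 0 0 + .var iU) *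
        .read aG ((.read 0 1 - 1 - .var iP) * .read 0 0 + .var iU))) ;;
    .setInt aG (.read aPAR (.read 0 1 - 1 - .var iP) * .read 0 0 + .var iV)
      (.read aG (.read aPAR (.read 0 1 - 1 - .var iP) * .read 0 0 + .var iV) * .var vY)))

/-- The table `p, v ↦ ` cell `p * n + v` of the array `a`. -/
def table (s : State) (a n : ℕ) : ℕ → ℕ → ℤ := fun p v => s.int a (p * n + v : ℕ)

/-- Absorbing the positions in turn preserves the sum over the homomorphisms. Each entry of position
`p` stays below `2 ^ e p`, where a fold adds the exponent of the child to that of its parent; thus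
the sum of the exponents grows by `b + ee` only in each round, and all integers stay short. -/
theorem ok_foldProg {β : ℕ} {s : State} {n k b ee e0 : ℕ} {par : ℕ → ℕ} {E : ℕ → ℕ → ℤ}
    {g : ℕ → ℕ → ℤ}
    (hn : s.int 0 0 = n) (hk : s.int 0 1 = k) (hk1 : 1 ≤ k) (hnb : n ≤ 2 ^ b)
    (hpar : ∀ q, 0 < q → q < k → par q < q ∧ s.int aPAR q = par q)
    (hE : ∀ v < n, ∀ u < n, s.int aEDGE (v * n + u : ℕ) = E v u ∧ 0 ≤ E v u ∧ E v u < 2 ^ ee)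
    (hG : ∀ p < k, ∀ v < n, s.int aG (p * n + v : ℕ) = g p v ∧ 0 ≤ g p v ∧ g p v < 2 ^ e0)
    (hβ : k * (e0 + b + ee) + 1 ≤ β) (hβn : bits (n : ℤ) ≤ β) (hβk : bits (k : ℤ) ≤ β) :
    Ok β foldProg s (k * (n * (3 * n + 6) + 4) + 2) fun s' =>
      ∑ v ∈ Finset.range n, s'.int aG v = homSum n par E (k - 1) g ∧
      ∀ v < n, 0 ≤ s'.int aG v ∧ s'.int aG v < 2 ^ (k * (e0 + b + ee)) := by
  have hE' : ∀ v < n, ∀ u < n, 0 ≤ E v u ∧ E v u < 2 ^ ee := fun v hv u hu => (hE v hv u hu).2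
  refine ok_forTo (k - 1) (n * (3 * n + 6) + 2) (fun i s' =>
    homSum n par E (k - 1 - i) (table s' aG n) = homSum n par E (k - 1) g ∧
    ∃ e : ℕ → ℕ, (∀ p ≤ k - 1 - i, ∀ v < n,
      0 ≤ table s' aG n p v ∧ table s' aG n p v < 2 ^ e p) ∧
      ∑ p ∈ Finset.range (k - i), e p ≤ k * e0 + i * (b + ee)) ?_ ?_ (by decide) ?_ ?_ ?_ ?_
  · gcongr
    omega
  · exact (bits_natCast_mono (by omega)).trans hβk
  · intro s' _ hf
    have h0 := hf.int 0 (by decide)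
    simp [h0, hk, hk1]
  · refine ⟨homSum_congr (fun _ _ _ _ => rfl) _ fun p hp v hv => ?_, fun _ => e0,
      fun p hp v hv => ?_, by simp⟩
    · simpa [table] using (hG p (by omega) v hv).1
    · have := hG p (by omega) v hv
      rw [table, State.setInt_int_ne _ _ _ (by decide), this.1]
      exact this.2
  · rintro i hi s' hb hf hi' ⟨hsum, e, he, hes⟩
    obtain ⟨q, hq⟩ : ∃ q, k - 1 - i = q + 1 := ⟨k - 2 - i, by omega⟩
    have h0 := hf.int 0 (by decide)
    have hP := hf.int aPAR (by decide)
    have hEs := hf.int aEDGE (by decide)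
    obtain ⟨hpq, hparq⟩ := hpar (q + 1) (by omega) (by omega)
    have hqi : (k : ℤ) - 1 - i = (q + 1 : ℕ) := by omega
    rw [hq] at hsum he
    have hesum : ∑ p ∈ Finset.range (q + 2), e p ≤ k * e0 + i * (b + ee) := by
      rwa [show k - i = q + 2 by omega] at hes
    set g' := table s' aG n with hg'
    have hfold := foldAt_bounds (par := par) hnb hE' he
    have hexp : ∀ p ≤ q, foldExp par (b + ee) (q + 1) e p + 1 ≤ β := by
      intro p hp
      have h1 := Finset.single_le_sum (f := foldExp par (b + ee) (q + 1) e)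
        (fun _ _ => Nat.zero_le _) (Finset.mem_range.2 (Nat.lt_succ_of_le hp))
      rw [Nat.succ_eq_add_one, sum_foldExp e hpq] at h1
      have h2 : (i + 1) * (b + ee) ≤ k * (b + ee) := Nat.mul_le_mul_right _ (by omega)
      nlinarith
    have hexp' : ee + e (q + 1) + b + 1 ≤ β := by
      have h1 := hexp (par (q + 1)) (by omega)
      rw [foldExp, Function.update_self] at h1
      omega
    -- the row of the parent is replaced from left to right; the row of the child is only read
    refine (ok_forTo n (3 * n + 4) (fun j t => ∀ p ≤ q + 1, ∀ v < n, table t aG n p v =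
        if p = par (q + 1) ∧ v < j then foldAt n par E (q + 1) g' p v else g' p v)
        (Q := fun t => ∀ p ≤ q, ∀ v < n, table t aG n p v = foldAt n par E (q + 1) g' p v)
        le_rfl hβn (by decide) ?_ ?_ ?_ ?_).mono le_rfl ?_
    · intro t _ hf'
      simp [hf'.int 0 (by decide), h0, hn]
    · intro p _ v _
      simp [table, hg']
    · intro j hj t _ hf' hj' hI
      have t0 : t.int 0 = s.int 0 := (hf'.int 0 (by decide)).trans h0
      have tP : t.int aPAR = s.int aPAR := (hf'.int aPAR (by decide)).trans hP
      have tE : t.int aEDGE = s.int aEDGE := (hf'.int aEDGE (by decide)).trans hEs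
      have ti : t.int iP 0 = i := by rw [hf'.int iP (by decide), hi']
      set f : ℕ → ℤ := fun u => E j u * g' (q + 1) u with hfdef
      have hf1 : ∀ u < n, 0 ≤ f u ∧ f u < 2 ^ (ee + e (q + 1)) := fun u hu =>
        mul_lt_two_pow (hE' j hj u hu) (he _ le_rfl u hu)
      refine ok_seq (R := fun t => t.int vY 0 = 0) 1 (3 * n + 3) (by omega)
        (ok_assign le_rfl (by simp) (by simp [bits]; omega) (by simp)) ?_
      intro t₁ hf₁ hy
      refine ok_seq (R := fun t => t.int vY 0 = ∑ u ∈ Finset.range n, f u) (3 * n + 2) 1 le_rfl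
        ((ok_sum n f (by omega) hβn (by decide) ?_ ?_ ?_).mono le_rfl ?_) ?_
      · intro t₂ h
        simp [h 0 (by decide) (by decide), hf₁.int 0 (by decide), t0, hn]
      · intro u hu t₂ h hu'
        have e1 : t₂.int 0 = s.int 0 := by
          rw [h 0 (by decide) (by decide), hf₁.int 0 (by decide), t0]
        have e2 : t₂.int aEDGE = s.int aEDGE := by
          rw [h aEDGE (by decide) (by decide), hf₁.int aEDGE (by decide), tE]
        have e3 : t₂.int aG = t.int aG := by
          rw [h aG (by decide) (by decide), hf₁.int aG (by decide)]
        have e4 : t₂.int iV 0 = j := by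
          rw [h iV (by decide) (by decide), hf₁.int iV (by decide), hj']
        have e5 : t₂.int iP 0 = i := by
          rw [h iP (by decide) (by decide), hf₁.int iP (by decide), ti]
        refine ⟨by simp, ?_⟩
        have h1 := (hE j hj u hu).1
        have h2 := hI (q + 1) le_rfl u hu
        rw [if_neg (by omega), table] at h2
        push_cast at h1 h2 hqi
        simp only [IntExpr.eval_mul, IntExpr.eval_sub, IntExpr.eval_var, IntExpr.eval_read,
          IntExpr.eval_add, IntExpr.eval_one, IntExpr.eval_zero, e1, e2, e3, e4, e5, hu', hn, hk,
          hqi, h1, h2, f]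
      · intro l hl
        rw [hy, zero_add]
        exact bits_le (sum_lt_two_pow (hl.trans hnb) fun u hu => hf1 u (lt_of_lt_of_le hu hl))
          hexp'
      · intro t₂ _ h
        rw [h, hy, zero_add]
      intro t₂ hf₂ hy₂
      have e1 : t₂.int 0 = s.int 0 := by rw [hf₂.int 0 (by decide), hf₁.int 0 (by decide), t0]
      have e2 : t₂.int aPAR = s.int aPAR := by
        rw [hf₂.int aPAR (by decide), hf₁.int aPAR (by decide), tP]
      have e3 : t₂.int aG = t.int aG := by rw [hf₂.int aG (by decide), hf₁.int aG (by decide)]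
      have e4 : t₂.int iV 0 = j := by rw [hf₂.int iV (by decide), hf₁.int iV (by decide), hj']
      have e5 : t₂.int iP 0 = i := by rw [hf₂.int iP (by decide), hf₁.int iP (by decide), ti]
      have h2 := hI (par (q + 1)) hpq.le j hj
      rw [if_neg (by omega), table] at h2
      have hval : foldAt n par E (q + 1) g' (par (q + 1)) j =
          g' (par (q + 1)) j * ∑ u ∈ Finset.range n, f u := by
        rw [foldAt, if_pos rfl]
      have hcell : (IntExpr.read aPAR (.read 0 1 - 1 - .var iP) * .read 0 0 + .var iV).eval t₂ =
          (par (q + 1) * n + j : ℕ) := by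
        simp only [IntExpr.eval_mul, IntExpr.eval_sub, IntExpr.eval_var, IntExpr.eval_read,
          IntExpr.eval_add, IntExpr.eval_one, IntExpr.eval_zero, e1, e2, e4, e5, hn, hk,
          hqi, hparq]
        push_cast
        rfl
      have hv2 : (IntExpr.read aG (.read aPAR (.read 0 1 - 1 - .var iP) * .read 0 0 + .var iV) *
          .var vY).eval t₂ = foldAt n par E (q + 1) g' (par (q + 1)) j := by
        rw [IntExpr.eval_mul, IntExpr.eval_read, hcell, e3, h2, IntExpr.eval_var, hy₂, hval]
      refine ok_setInt le_rfl (by simp) (by simp) ?_ ?_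
      · rw [hv2]
        exact bits_le (hfold _ (by omega) j hj) (hexp _ (by omega))
      · rw [hcell, hv2]
        intro p hp v hv
        rw [table, State.setInt_int_ne _ _ _ (by decide)]
        simp only [State.setInt_int_same, Function.update_apply, Nat.cast_inj, cell_inj hv hj]
        have h3 := hI p hp v hv
        rw [table] at h3
        by_cases hc : p = par (q + 1) ∧ v = j
        · rw [if_pos hc, if_pos ⟨hc.1, by omega⟩, hc.1, hc.2]
        · rw [if_neg hc, e3, h3]
          by_cases hc' : p = par (q + 1) ∧ v < j
          · rw [if_pos hc', if_pos ⟨hc'.1, by omega⟩]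
          · rw [if_neg hc', if_neg (by omega)]
    · intro t _ hI p hp v hv
      rw [hI p (by omega) v hv]
      by_cases hc : p = par (q + 1)
      · rw [if_pos ⟨hc, hv⟩]
      · rw [if_neg (by omega), foldAt, if_neg hc]
    · intro t _ ht
      have htab : table (t.setInt iP 0 (i + 1)) aG n = table t aG n := by
        funext p v
        simp [table]
      rw [htab, show k - 1 - (i + 1) = q by omega, show k - (i + 1) = q + 1 by omega]
      refine ⟨?_, foldExp par (b + ee) (q + 1) e, fun p hp v hv => ?_, ?_⟩
      · rw [← hsum, homSum]
        exact homSum_congr (fun _ _ _ _ => rfl) _ ht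
      · rw [ht p hp v hv]
        exact hfold p hp v hv
      · rw [sum_foldExp e hpq]
        linarith
  · rintro s' - ⟨h1, e, h2, h3⟩
    rw [Nat.sub_self] at h1 h2
    refine ⟨?_, fun v hv => ?_⟩
    · rw [← h1]
      simp [homSum, table]
    · have h4 := h2 0 le_rfl v hv
      rw [show k - (k - 1) = 1 by omega, Finset.sum_range_one] at h3
      have h5 : (k - 1) * (b + ee) ≤ k * (b + ee) := Nat.mul_le_mul_right _ (by omega)
      simp only [table, zero_mul, zero_add] at h4
      exact lt_two_pow_mono h4 (by nlinarith)

/-- Evaluate the sieve: sum the tree sums over all label sets. -/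
def evalProg : Program :=
  .assign vH 0 ;;
  .forTo iX (.twoPow (.read 0 1)) (initProg ;; foldProg ;;
    .forTo iV (.read 0 0) (.assign vH (.var vH + .read aG (.var iV))))

/-- A bound for the number of steps of `evalProg`. -/
def evalSteps (n k : ℕ) : ℕ :=
  2 ^ k * (k * n * (3 * k + 10) + (k * (n * (3 * n + 6) + 4) + 3 * n + 8)) + 3

/-- The memory contents from which `evalProg` computes `sieveSum n k par E x fix`. -/
structure SieveData (s : State) (n k b ee ex : ℕ) (par : ℕ → ℕ) (E : ℕ → ℕ → ℤ) (x : ℕ → ℤ) :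
    Prop where
  n_eq : s.int 0 0 = n
  k_eq : s.int 0 1 = k
  k_pos : 1 ≤ k
  n_le : n ≤ 2 ^ b
  par_eq : ∀ q, 0 < q → q < k → par q < q ∧ s.int aPAR q = par q
  edge_eq : ∀ v < n, ∀ u < n, s.int aEDGE (v * n + u : ℕ) = E v u ∧ 0 ≤ E v u ∧ E v u < 2 ^ ee
  label_eq : ∀ m < 2 * k * n, s.int aXZ m = x m ∧ 0 ≤ x m ∧ x m < 2 ^ ex

theorem SieveData.congr {s s' : State} {n k b ee ex : ℕ} {par : ℕ → ℕ} {E : ℕ → ℕ → ℤ}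
    {x : ℕ → ℤ} (h : SieveData s n k b ee ex par E x) (h0 : s'.int 0 = s.int 0)
    (hP : s'.int aPAR = s.int aPAR) (hE : s'.int aEDGE = s.int aEDGE)
    (hX : s'.int aXZ = s.int aXZ) : SieveData s' n k b ee ex par E x := by
  refine ⟨?_, ?_, h.k_pos, h.n_le, ?_, ?_, ?_⟩
  · rw [h0, h.n_eq]
  · rw [h0, h.k_eq]
  · rw [hP]; exact h.par_eq
  · rw [hE]; exact h.edge_eq
  · rw [hX]; exact h.label_eq

/-- After `X` rounds, `vH` is the sum over the first `X` label sets, which are encoded by the bits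
of their numbers. -/
theorem ok_evalProg {β : ℕ} {s : State} {n k b ee ex : ℕ} {par fix : ℕ → ℕ} {E : ℕ → ℕ → ℤ}
    {x : ℕ → ℤ} (hs : SieveData s n k b ee ex par E x) (hfix : ∀ p < k, s.int aFIX p = fix p)
    (hβ : k * (2 * ex + k + b + ee) + b + k + 2 ≤ β) :
    Ok β evalProg s (evalSteps n k) fun s' => s'.int vH 0 = sieveSum n k par E x fix := by
  have hk1 := hs.k_pos
  have hex : 2 * ex + k + b + ee ≤ k * (2 * ex + k + b + ee) := Nat.le_mul_of_pos_left _ hk1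
  have hn2 : (0 : ℤ) ≤ n ∧ (n : ℤ) < 2 ^ (b + 1) := ⟨by positivity, by
    have := hs.n_le
    rw [pow_succ]
    have : (n : ℤ) ≤ 2 ^ b := by exact_mod_cast this
    have : (0 : ℤ) < 2 ^ b := by positivity
    linarith⟩
  have hβn : bits (n : ℤ) ≤ β := bits_le hn2 (by omega)
  have hβk : bits (k : ℤ) ≤ β := bits_natCast_le (by omega)
  have hβkn : bits (k * n : ℕ) ≤ β := by
    have hk2 : (0 : ℤ) ≤ k ∧ (k : ℤ) < 2 ^ k :=
      ⟨by positivity, by exact_mod_cast Nat.lt_two_pow_self⟩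
    push_cast
    exact bits_le (mul_lt_two_pow hk2 hn2) (by omega)
  set Lg := k * (2 * ex + k + b + ee) with hLg
  set F : ℕ → ℤ := fun X => homSum n par E (k - 1) fun p v => initVal n k x fix X (p * n + v)
    with hF
  have hFb : ∀ X, 0 ≤ F X ∧ F X < 2 ^ (Lg + b) := by
    intro X
    have := homSum_bounds hs.n_le (fun v hv u hu => (hs.edge_eq v hv u hu).2) (k - 1)
      (par := par) (e := fun _ => 2 * ex + k)
      (fun p h1 h2 => (hs.par_eq p h1 (by omega)).1)
      (g := fun p v => initVal n k x fix X (p * n + v))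
      fun p h1 v hv => initVal_bounds (cell_lt (by omega) hv) fun m hm => (hs.label_eq m hm).2
    refine lt_two_pow_mono this ?_
    obtain ⟨j, rfl⟩ : ∃ j, k = j + 1 := ⟨k - 1, by omega⟩
    simp only [Finset.sum_const, Finset.card_range, smul_eq_mul, Nat.add_sub_cancel, hLg]
    nlinarith
  refine ok_seq (R := fun t => t.int vH 0 = 0) 1 (evalSteps n k - 1)
    (by unfold evalSteps; omega) (ok_assign le_rfl (by simp) (by simp [bits]; omega) (by simp)) ?_
  intro s₁ hf₁ hH₁
  have hs₁ := hs.congr (hf₁.int 0 (by decide)) (hf₁.int aPAR (by decide))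
    (hf₁.int aEDGE (by decide)) (hf₁.int aXZ (by decide))
  have hfix₁ : ∀ p < k, s₁.int aFIX p = fix p := by rwa [hf₁.int aFIX (by decide)]
  refine ok_forTo (2 ^ k) (k * n * (3 * k + 10) + 2 + (k * (n * (3 * n + 6) + 4) + 2 + (3 * n + 2)))
    (fun X t => t.int vH 0 = ∑ Y ∈ Finset.range X, F Y) ?_ ?_ (by decide) ?_ (by simp [hH₁]) ?_
    (fun _ _ h => h)
  · unfold evalSteps
    ring_nf
    omega
  · push_cast
    exact bits_two_pow_le (by omega)
  · intro t _ hf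
    have : t.int 0 1 = k := by rw [hf.int 0 (by decide), hs₁.k_eq]
    simp only [IntExpr.fits_twoPow, IntExpr.fits_read, IntExpr.fits_one, IntExpr.eval_read,
      IntExpr.eval_one, this, Int.toNat_natCast, true_and, IntExpr.eval_twoPow]
    exact ⟨bits_two_pow_le (by omega), by push_cast; rfl⟩
  intro X hX t hb hf hXt hHt
  have ht := hs₁.congr (hf.int 0 (by decide)) (hf.int aPAR (by decide))
    (hf.int aEDGE (by decide)) (hf.int aXZ (by decide))
  have hfixt : ∀ p < k, t.int aFIX p = fix p := by rwa [hf.int aFIX (by decide)]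
  refine ok_seq _ _ le_rfl (ok_initProg ht.n_eq ht.k_eq hXt hfixt ht.label_eq
    (by omega) hβkn) ?_
  intro t₁ hf₁ hG
  have ht₁ := ht.congr (hf₁.int 0 (by decide)) (hf₁.int aPAR (by decide))
    (hf₁.int aEDGE (by decide)) (hf₁.int aXZ (by decide))
  refine ok_seq _ _ le_rfl (ok_foldProg (e0 := 2 * ex + k)
    (g := fun p v => initVal n k x fix X (p * n + v)) ht₁.n_eq ht₁.k_eq hk1
    ht₁.n_le ht₁.par_eq ht₁.edge_eq ?_ (by omega) hβn hβk) ?_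
  · intro p hp v hv
    exact ⟨hG _ (cell_lt hp hv), initVal_bounds (cell_lt hp hv) fun m hm => (ht.label_eq m hm).2⟩
  rintro t₂ hf₂ ⟨hsum, hbd⟩
  have hH₂ : t₂.int vH 0 = ∑ Y ∈ Finset.range X, F Y := by
    rw [hf₂.int vH (by decide), hf₁.int vH (by decide), hHt]
  refine (ok_sum n (fun v => t₂.int aG v) (by omega) hβn (by decide) ?_ ?_ ?_).mono le_rfl ?_
  · intro t₃ h
    simp [h 0 (by decide) (by decide), hf₂.int 0 (by decide), ht₁.n_eq]
  · intro v hv t₃ h hv'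
    simp [h aG (by decide) (by decide), hv']
  · intro j hj
    rw [hH₂]
    have h1 := sum_lt_two_pow (f := F) (a := Lg + b) (b := k) hX.le fun Y _ => hFb Y
    have h2 := sum_lt_two_pow (f := fun v : ℕ => t₂.int aG v) (a := Lg) (b := b)
      (hj.trans hs.n_le) fun v hv => hbd v (by omega)
    have h3 : (2 : ℤ) ^ (Lg + b) ≤ 2 ^ (Lg + b + k) :=
      pow_le_pow_right₀ (by norm_num) (by omega)
    refine bits_le (a := Lg + b + k + 1) ⟨add_nonneg h1.1 h2.1, ?_⟩ (by omega)
    rw [pow_succ]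
    linarith [h1.2, h2.2]
  · intro t₃ _ h
    rw [State.setInt_int_ne _ _ _ (by decide), h, hH₂, hsum, Finset.sum_range_succ]


/-- The lowest set bit of a positive number, isolated by a bitwise operation. -/
theorem land_neg_self {q : ℕ} (hq : q ≠ 0) : ∃ m, Int.land q (-q) = ((2 ^ m : ℕ) : ℤ) ∧
    q.testBit m = true ∧ ∀ j < m, q.testBit j = false := by
  obtain ⟨m, c, hc, rfl⟩ := Nat.exists_eq_two_pow_mul_odd hq
  obtain ⟨d, rfl⟩ := hc
  have hm1 : 1 ≤ 2 ^ m := Nat.one_le_two_pow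
  have e1 : 2 ^ m * (2 * d + 1) = 2 ^ (m + 1) * d + 2 ^ m := by ring
  have e2 : 2 ^ m * (2 * d + 1) - 1 = 2 ^ (m + 1) * d + (2 ^ m - 1) := by rw [e1]; omega
  have hlt : 2 ^ m < 2 ^ (m + 1) := Nat.pow_lt_pow_right (by norm_num) (by omega)
  refine ⟨m, ?_, ?_, ?_⟩
  · obtain ⟨t, ht⟩ : ∃ t, 2 ^ m * (2 * d + 1) = t + 1 := ⟨2 ^ m * (2 * d + 1) - 1, by omega⟩
    have h1 : -((2 ^ m * (2 * d + 1) : ℕ) : ℤ) = Int.negSucc t := by rw [ht]; rfl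
    rw [h1]
    change ((Nat.ldiff (2 ^ m * (2 * d + 1)) t : ℕ) : ℤ) = _
    congr 1
    have h2 : t = 2 ^ (m + 1) * d + (2 ^ m - 1) := by omega
    refine Nat.eq_of_testBit_eq fun j => ?_
    rw [Nat.testBit_ldiff, h2, e1, Nat.testBit_two_pow_mul_add _ hlt,
      Nat.testBit_two_pow_mul_add _ (by omega), Nat.testBit_two_pow, Nat.testBit_two_pow_sub_one]
    split_ifs with h
    · by_cases h3 : m = j <;> simp [h3]
    · have : m ≠ j := by omega
      simp [this]
  · rw [e1, Nat.testBit_two_pow_mul_add _ hlt, if_pos (by omega), Nat.testBit_two_pow_self]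
  · intro j hj
    rw [e1, Nat.testBit_two_pow_mul_add _ hlt, if_pos (by omega), Nat.testBit_two_pow]
    simp; omega

theorem land_natCast (a b : ℕ) : Int.land a b = ((a &&& b : ℕ) : ℤ) := rfl

theorem land_two_pow_eq_zero (a m : ℕ) :
    Int.land a ((2 ^ m : ℕ) : ℤ) = 0 ↔ a.testBit m = false := by
  rw [land_natCast, Nat.and_two_pow]
  cases a.testBit m <;> simp

theorem bits_natCast_le_of_lt {a m β : ℕ} (h : a < 2 ^ m) (hβ : m + 1 ≤ β) :
    bits (a : ℤ) ≤ β :=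
  bits_le ⟨by positivity, by exact_mod_cast h⟩ hβ

/-! ### Detection of trees -/

/-- Fill the table of edge factors: zero for non-edges, and a power of two that encodes the weight
for edges. -/
def edgeProg : Program :=
  .forTo iE (.read 0 0 * .read 0 0) (.setInt aEDGE (.var iE)
    (.read aADJ (.var iE) * .twoPow (.read aWT (.var iE) * .var vDEG * .var vSLOT)))

/-- The edge factors for adjacency numbers `a` and weights `r`. -/
def edgeVal (D S : ℕ) (a r : ℕ → ℕ → ℕ) (v u : ℕ) : ℤ := (a v u * 2 ^ (r v u * D * S) : ℕ)

/-- The memory holds a graph with weights at most `W`, a tree, and labels for the sieve with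
parameters `D` and `S`. -/
structure Instance (s : State) (n k b ex D S W : ℕ) (par : ℕ → ℕ) (a r : ℕ → ℕ → ℕ) (x : ℕ → ℤ) :
    Prop where
  n_eq : s.int 0 0 = n
  k_eq : s.int 0 1 = k
  k_pos : 1 ≤ k
  n_le : n ≤ 2 ^ b
  par_eq : ∀ q, 0 < q → q < k → par q < q ∧ s.int aPAR q = par q
  deg_eq : s.int vDEG 0 = D
  slot_eq : s.int vSLOT 0 = S
  adj_eq : ∀ v < n, ∀ u < n, s.int aADJ (v * n + u : ℕ) = a v u ∧ a v u ≤ 1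
  wt_eq : ∀ v < n, ∀ u < n, s.int aWT (v * n + u : ℕ) = r v u ∧ r v u ≤ W
  label_eq : ∀ m < 2 * k * n, s.int aXZ m = x m ∧ 0 ≤ x m ∧ x m < 2 ^ ex

theorem edgeVal_bounds {D S W : ℕ} {a r : ℕ → ℕ → ℕ} {v u : ℕ} (ha : a v u ≤ 1)
    (hr : r v u ≤ W) : 0 ≤ edgeVal D S a r v u ∧ edgeVal D S a r v u < 2 ^ (W * D * S + 1) := by
  unfold edgeVal
  refine ⟨by positivity, ?_⟩
  have h1 : 2 ^ (r v u * D * S) ≤ 2 ^ (W * D * S) := Nat.pow_le_pow_right (by norm_num) (by gcongr)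
  have h2 : a v u * 2 ^ (r v u * D * S) ≤ 1 * 2 ^ (W * D * S) := Nat.mul_le_mul ha h1
  have h3 : 2 ^ (W * D * S) < 2 ^ (W * D * S + 1) := Nat.pow_lt_pow_right (by norm_num) (by omega)
  exact_mod_cast (h2.trans_eq (one_mul _)).trans_lt h3

theorem ok_edgeProg {β : ℕ} {s : State} {n k b ex D S W : ℕ} {par : ℕ → ℕ} {a r : ℕ → ℕ → ℕ}
    {x : ℕ → ℤ} (hs : Instance s n k b ex D S W par a r x) (hβ : W * D * S + 2 ≤ β)
    (hβn : bits (n * n : ℕ) ≤ β) :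
    Ok β edgeProg s (n * n * 3 + 2) fun s' =>
      SieveData s' n k b (W * D * S + 1) ex par (edgeVal D S a r) x := by
  refine (ok_fill (a := aEDGE) (n * n) 1 (fun e => edgeVal D S a r (e / n) (e % n)) le_rfl hβn
    (by decide) (by decide) ?_ ?_).mono le_rfl ?_
  · intro t _ hf
    simp [hf.int 0 (by decide), hs.n_eq]
  · intro e he t _ hf het _
    have hn0 : 0 < n := Nat.pos_of_ne_zero (by rintro rfl; simp at he)
    have h1 := Nat.mod_lt e hn0
    have h2 : e / n < n := Nat.div_lt_of_lt_mul he
    obtain ⟨h3, h4⟩ := hs.adj_eq _ h2 _ h1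
    obtain ⟨h5, h6⟩ := hs.wt_eq _ h2 _ h1
    rw [Nat.div_add_mod'] at h3 h5
    have e1 := hf.int aADJ (by decide)
    have e2 := hf.int aWT (by decide)
    have e3 := hf.int vDEG (by decide)
    have e4 := hf.int vSLOT (by decide)
    have hexp : ((r (e / n) (e % n) : ℤ) * D * S).toNat = r (e / n) (e % n) * D * S := by
      exact_mod_cast Int.toNat_natCast (r (e / n) (e % n) * D * S)
    refine ok_setInt le_rfl (by simp) ?_ ?_ ?_
    · simp only [IntExpr.fits_mul, IntExpr.fits_read, IntExpr.fits_var, IntExpr.fits_twoPow,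
        IntExpr.eval_mul, IntExpr.eval_read, IntExpr.eval_var, e2, e3, e4, het, h5, hs.deg_eq,
        hs.slot_eq, hexp, true_and, and_true]
      refine bits_two_pow_le (le_trans ?_ hβ)
      gcongr
    · simp only [IntExpr.eval_mul, IntExpr.eval_read, IntExpr.eval_var, IntExpr.eval_twoPow, e1,
        e2, e3, e4, het, h3, h5, hs.deg_eq, hs.slot_eq, hexp]
      have := edgeVal_bounds (D := D) (S := S) h4 h6
      unfold edgeVal at this
      push_cast at this
      exact bits_le this (by omega)
    · simp [e1, e2, e3, e4, het, h3, h5, hs.deg_eq, hs.slot_eq, hexp, edgeVal]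
  · rintro t hf ⟨h, -⟩
    have e0 := hf.int 0 (by decide)
    refine ⟨?_, ?_, hs.k_pos, hs.n_le, ?_, ?_, ?_⟩
    · rw [e0, hs.n_eq]
    · rw [e0, hs.k_eq]
    · rw [hf.int aPAR (by decide)]; exact hs.par_eq
    · intro v hv u hu
      refine ⟨?_, edgeVal_bounds (hs.adj_eq v hv u hu).2 (hs.wt_eq v hv u hu).2⟩
      rw [h _ (cell_lt hv hu), cell_div hu, cell_mod hu]
    · rw [hf.int aXZ (by decide)]; exact hs.label_eq

/-- The number with the `J` bits `0, S, 2 * S, …` set. -/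
def maskVal (S J : ℕ) : ℕ := (2 ^ (S * J) - 1) / (2 ^ S - 1)

/-- Evaluate the sieve for the graph in memory and keep the parities of its coefficients. -/
def detectProg : Program :=
  edgeProg ;;
  .assign vMASK ((.twoPow (.var vSLOT * .var vNSLOTS) - 1) / (.twoPow (.var vSLOT) - 1)) ;;
  evalProg ;;
  .assign vQ (.op .band (.var vH) (.var vMASK))

/-- The integer computed by the sieve. -/
def sieveNat (n k D S : ℕ) (par : ℕ → ℕ) (a r : ℕ → ℕ → ℕ) (x : ℕ → ℤ) (fix : ℕ → ℕ) : ℕ :=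
  (sieveSum n k par (edgeVal D S a r) x fix).toNat

theorem Instance.sieveSum_bounds {s : State} {n k b ex D S W : ℕ} {par : ℕ → ℕ}
    {a r : ℕ → ℕ → ℕ} {x : ℕ → ℤ} (hs : Instance s n k b ex D S W par a r x) (fix : ℕ → ℕ) :
    sieveSum n k par (edgeVal D S a r) x fix = sieveNat n k D S par a r x fix ∧
      sieveNat n k D S par a r x fix < 2 ^ (k * (2 * ex + k + b + (W * D * S + 1)) + b + k) := by
  have := MinWeightTree.sieveSum_bounds (fix := fix) hs.n_le hs.k_pos
    (fun v hv u hu => edgeVal_bounds (D := D) (S := S) (hs.adj_eq v hv u hu).2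
      (hs.wt_eq v hv u hu).2) (fun p h1 h2 => (hs.par_eq p h1 h2).1)
    fun m hm => (hs.label_eq m hm).2
  have h := Int.toNat_of_nonneg this.1
  unfold sieveNat
  refine ⟨h.symm, ?_⟩
  zify
  rw [h]
  exact this.2

theorem ok_detectProg {β : ℕ} {s : State} {n k b ex D S W J : ℕ} {par : ℕ → ℕ} {a r : ℕ → ℕ → ℕ}
    {x : ℕ → ℤ} (hs : Instance s n k b ex D S W par a r x) (hJ : s.int vNSLOTS 0 = J)
    (hfix : ∀ p < k, s.int aFIX p = 0)
    (hβ : k * (2 * ex + k + b + (W * D * S + 1)) + b + k + 2 ≤ β)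
    (hβJ : S * J + 2 ≤ β) (hβS : S + 2 ≤ β) (hβn : bits (n * n : ℕ) ≤ β) :
    Ok β detectProg s (n * n * 3 + 2 + (evalSteps n k + 2)) fun s' =>
      SieveData s' n k b (W * D * S + 1) ex par (edgeVal D S a r) x ∧
      s'.int vQ 0 = ((sieveNat n k D S par a r x 0 &&& maskVal S J : ℕ) : ℤ) := by
  have hk := Nat.le_mul_of_pos_left (2 * ex + k + b + (W * D * S + 1)) hs.k_pos
  refine ok_seq _ _ le_rfl (ok_edgeProg hs (by omega) hβn) ?_
  intro s₁ hf₁ hd₁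
  have e1 : s₁.int vSLOT 0 = S := by rw [hf₁.int vSLOT (by decide), hs.slot_eq]
  have e2 : s₁.int vNSLOTS 0 = J := by rw [hf₁.int vNSLOTS (by decide), hJ]
  have e3 : ((S : ℤ) * J).toNat = S * J := by exact_mod_cast Int.toNat_natCast (S * J)
  have hev : ((IntExpr.twoPow (.var vSLOT * .var vNSLOTS) - 1) /
      (.twoPow (.var vSLOT) - 1)).eval s₁ = (maskVal S J : ℤ) := by
    simp only [IntExpr.eval_div, IntExpr.eval_sub, IntExpr.eval_twoPow, IntExpr.eval_mul,
      IntExpr.eval_var, IntExpr.eval_one, e1, e2, e3, Int.toNat_natCast, maskVal]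
    push_cast [Nat.one_le_two_pow]
    rfl
  have hmask : maskVal S J < 2 ^ (S * J) := by
    unfold maskVal
    have := Nat.div_le_self (2 ^ (S * J) - 1) (2 ^ S - 1)
    have := Nat.one_le_two_pow (n := S * J)
    omega
  refine ok_seq (R := fun t => t.int vMASK 0 = maskVal S J) 1 (evalSteps n k + 1) (by omega)
    (ok_assign le_rfl ?_ ?_ ?_) ?_
  · simp only [IntExpr.fits_div, IntExpr.fits_sub, IntExpr.fits_twoPow, IntExpr.fits_mul,
      IntExpr.fits_var, IntExpr.eval_mul, IntExpr.eval_var, IntExpr.fits_one, e1, e2, e3,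
      Int.toNat_natCast, true_and, and_true]
    exact ⟨bits_two_pow_le hβJ, bits_two_pow_le hβS⟩
  · rw [hev]
    exact bits_natCast_le_of_lt hmask (by omega)
  · rw [hev]; simp
  intro s₂ hf₂ hm₂
  have hd₂ := hd₁.congr (hf₂.int 0 (by decide)) (hf₂.int aPAR (by decide))
    (hf₂.int aEDGE (by decide)) (hf₂.int aXZ (by decide))
  have hfix₂ : ∀ p < k, s₂.int aFIX p = (0 : ℕ → ℕ) p := by
    rw [hf₂.int aFIX (by decide), hf₁.int aFIX (by decide)]
    simpa using hfix
  refine ok_seq _ _ le_rfl (ok_evalProg hd₂ hfix₂ (by omega)) ?_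
  intro s₃ hf₃ hH
  have hd₃ := hd₂.congr (hf₃.int 0 (by decide)) (hf₃.int aPAR (by decide))
    (hf₃.int aEDGE (by decide)) (hf₃.int aXZ (by decide))
  obtain ⟨hN, hlt⟩ := hs.sieveSum_bounds 0
  have hm₃ : s₃.int vMASK 0 = maskVal S J := by rw [hf₃.int vMASK (by decide), hm₂]
  have hle : sieveNat n k D S par a r x 0 &&& maskVal S J < 2 ^ (S * J) :=
    Nat.and_le_right.trans_lt hmask
  refine ok_assign le_rfl ?_ ?_ ?_
  · simp only [IntExpr.fits_band, IntExpr.fits_var, IntExpr.eval_var, hH, hN, hm₃, land_natCast,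
      true_and]
    exact bits_natCast_le_of_lt hle (by omega)
  · simp only [IntExpr.eval_band, IntExpr.eval_var, hH, hN, hm₃, land_natCast]
    exact bits_natCast_le_of_lt hle (by omega)
  · simp only [IntExpr.eval_band, IntExpr.eval_var, hH, hN, hm₃, land_natCast]
    exact ⟨hd₃.congr (by simp) (by simp) (by simp) (by simp), by simp⟩

/-! ### Reconstruction of a tree -/

/-- Fix the images of the positions `0, 1, …` one after the other, keeping the coefficient selected
by the bit `vU` odd, and write the images to the output. -/
def fixProg : Program :=
  .forTo iFP (.read 0 1) (
    .forTo iFV (.read 0 0) (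
      .setInt aFIX (.var iFP) (.var iFV + 1) ;;
      evalProg ;;
      .cond (.intEq (.op .band (.var vH) (.var vU)) 0) .skip (.assign vCH (.var iFV))) ;;
    .setInt aFIX (.var iFP) (.var vCH + 1) ;;
    .setInt 4 (.read aORD (.var iFP) + 1) (.var vCH))

/-- A bound for the number of steps of `fixProg`. -/
def fixSteps (n k : ℕ) : ℕ := k * (n * (evalSteps n k + 5) + 6) + 2

/-- If for every partial assignment that keeps bit `m` of the sieve there is a next image that keeps
it too, then `fixProg` finds a full assignment that keeps it. -/
theorem ok_fixProg {β : ℕ} {s : State} {n k b ee ex m : ℕ} {par ord : ℕ → ℕ} {E : ℕ → ℕ → ℤ}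
    {x : ℕ → ℤ} {H : (ℕ → ℕ) → ℕ} (hs : SieveData s n k b ee ex par E x)
    (hH : ∀ fix, sieveSum n k par E x fix = H fix ∧
      H fix < 2 ^ (k * (2 * ex + k + b + ee) + b + k))
    (hord : ∀ p < k, s.int aORD p = ord p)
    (hinj : ∀ p < k, ∀ q < k, ord p = ord q → p = q)
    (hU : s.int vU 0 = (2 ^ m : ℕ))
    (hfix : ∀ p < k, s.int aFIX p = 0) (h0 : (H 0).testBit m = true)
    (hlin : ∀ fix p, p < k → fix p = 0 → (H fix).testBit m = true →
      ∃ v < n, (H (Function.update fix p (v + 1))).testBit m = true)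
    (hβ : k * (2 * ex + k + b + ee) + b + k + 2 ≤ β) :
    Ok β fixProg s (fixSteps n k) fun s' => ∃ φ : ℕ → ℕ, (∀ p < k, φ p < n) ∧
      (∃ fix : ℕ → ℕ, (∀ p < k, fix p = φ p + 1) ∧ (H fix).testBit m = true) ∧
      (∀ p < k, s'.int 4 (ord p + 1 : ℕ) = φ p) := by
  have hk1 := hs.k_pos
  have hex : 2 * ex + k + b + ee ≤ k * (2 * ex + k + b + ee) := Nat.le_mul_of_pos_left _ hk1
  have hn2 : n < 2 ^ (b + 1) :=
    hs.n_le.trans_lt (Nat.pow_lt_pow_right (by norm_num) (by omega))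
  have hβn : bits (n : ℤ) ≤ β := bits_natCast_le_of_lt hn2 (by omega)
  have hβk : bits (k : ℤ) ≤ β := bits_natCast_le (by omega)
  refine ok_forTo k (n * (evalSteps n k + 5) + 4) (fun P t => ∃ fix : ℕ → ℕ,
    (∀ p < k, t.int aFIX p = fix p) ∧ (H fix).testBit m = true ∧
    (∀ p < P, 1 ≤ fix p ∧ fix p ≤ n ∧ t.int 4 (ord p + 1 : ℕ) = (fix p : ℤ) - 1) ∧
    ∀ p, P ≤ p → fix p = 0) ?_ hβk (by decide) ?_ ?_ ?_ ?_
  · unfold fixSteps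
    exact le_rfl
  · intro t _ hf
    simp [hf.int 0 (by decide), hs.k_eq]
  · exact ⟨0, by simpa using hfix, h0, by simp, by simp⟩
  · rintro P hP t _ hf hPt ⟨fix, hft, hbit, hlo, hhi⟩
    have ht := hs.congr (hf.int 0 (by decide)) (hf.int aPAR (by decide))
      (hf.int aEDGE (by decide)) (hf.int aXZ (by decide))
    refine ok_seq (R := fun t' => (∀ p < k, p ≠ P → t'.int aFIX p = fix p) ∧
      ∃ v < n, t'.int vCH 0 = v ∧ (H (Function.update fix P (v + 1))).testBit m = true)
      (n * (evalSteps n k + 5) + 2) 2 le_rfl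
      -- either some image has been found to keep the bit, or none of the first `j` does
      (ok_forTo n (evalSteps n k + 3) (fun j t' => (∀ p < k, p ≠ P → t'.int aFIX p = fix p) ∧
        ((∃ v < n, t'.int vCH 0 = v ∧ (H (Function.update fix P (v + 1))).testBit m = true) ∨
          ∀ v < j, (H (Function.update fix P (v + 1))).testBit m = false))
        le_rfl hβn (by decide) ?_ ?_ ?_ ?_) ?_
    · intro t' _ hf'
      simp [hf'.int 0 (by decide), ht.n_eq]
    · exact ⟨fun p hp _ => by simpa using hft p hp, Or.inr (by simp)⟩
    · rintro j hj t' _ hf' hj' ⟨hfx, hch⟩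
      have hP' : t'.int iFP 0 = P := by rw [hf'.int iFP (by decide), hPt]
      have ht' := ht.congr (hf'.int 0 (by decide)) (hf'.int aPAR (by decide))
        (hf'.int aEDGE (by decide)) (hf'.int aXZ (by decide))
      refine ok_seq (R := fun t₁ => ∀ p < k, t₁.int aFIX p = Function.update fix P (j + 1) p)
        1 (evalSteps n k + 2) (by omega) (ok_setInt le_rfl (by simp) (by simp) ?_ ?_) ?_
      · simp only [IntExpr.eval_add, IntExpr.eval_var, IntExpr.eval_one, hj']
        exact_mod_cast (bits_natCast_mono (Nat.succ_le_of_lt hj)).trans hβn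
      · intro p hp
        simp only [IntExpr.eval_add, IntExpr.eval_var, IntExpr.eval_one, hj', hP',
          State.setInt_int_same, Function.update_apply, Nat.cast_inj]
        split_ifs with h
        · push_cast; rfl
        · exact hfx p hp h
      intro t₁ hf₁ hfx₁
      have ht₁ := ht'.congr (hf₁.int 0 (by decide)) (hf₁.int aPAR (by decide))
        (hf₁.int aEDGE (by decide)) (hf₁.int aXZ (by decide))
      refine ok_seq _ _ le_rfl (ok_evalProg ht₁ hfx₁ hβ) ?_
      intro t₂ hf₂ hH₂
      have hU₂ : t₂.int vU 0 = (2 ^ m : ℕ) := by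
        rw [hf₂.int vU (by decide), hf₁.int vU (by decide), hf'.int vU (by decide),
          hf.int vU (by decide), hU]
      have hj₂ : t₂.int iFV 0 = j := by
        rw [hf₂.int iFV (by decide), hf₁.int iFV (by decide), hj']
      have hC₂ : t₂.int vCH 0 = t'.int vCH 0 := by
        rw [hf₂.int vCH (by decide), hf₁.int vCH (by decide)]
      have hfx₂ : ∀ p < k, p ≠ P → t₂.int aFIX p = fix p := by
        intro p hp hpP
        rw [hf₂.int aFIX (by decide), hfx₁ p hp, Function.update_of_ne hpP]
      rw [(hH _).1] at hH₂
      refine ok_cond 1 le_rfl ?_ (fun h => ?_) (fun h => ?_)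
      · simp only [Test.fits_intEq, IntExpr.fits_band, IntExpr.fits_var, IntExpr.eval_var, hH₂,
          hU₂, IntExpr.fits_zero, true_and, and_true, land_natCast]
        exact bits_natCast_le_of_lt (Nat.and_le_left.trans_lt (hH _).2) (by omega)
      · simp only [Test.holds_intEq, IntExpr.eval_band, IntExpr.eval_var, IntExpr.eval_zero, hH₂,
          hU₂, land_two_pow_eq_zero] at h
        refine ok_skip le_rfl ⟨fun p hp hpP => by simpa using hfx₂ p hp hpP, ?_⟩
        rcases hch with ⟨v, hv, hv1, hv2⟩ | hch
        · exact Or.inl ⟨v, hv, by simpa [hC₂] using hv1, hv2⟩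
        · refine Or.inr fun v hv => ?_
          rcases Nat.lt_succ_iff_lt_or_eq.1 hv with hv | rfl
          · exact hch v hv
          · exact h
      · simp only [Test.holds_intEq, IntExpr.eval_band, IntExpr.eval_var, IntExpr.eval_zero, hH₂,
          hU₂, land_two_pow_eq_zero, Bool.not_eq_false] at h
        refine ok_assign le_rfl (by simp) ?_ ⟨fun p hp hpP => by simpa using hfx₂ p hp hpP, ?_⟩
        · simp only [IntExpr.eval_var, hj₂]
          exact (bits_natCast_mono hj.le).trans hβn
        · exact Or.inl ⟨j, hj, by simp [hj₂], h⟩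
    · rintro t' - ⟨h1, h2 | h2⟩
      · exact ⟨h1, h2⟩
      · obtain ⟨v, hv, hv'⟩ := hlin fix P hP (hhi P le_rfl) hbit
        rw [h2 v hv] at hv'
        exact absurd hv' (by simp)
    rintro t₁ hf₁ ⟨hfx, v, hv, hv1, hv2⟩
    have hP₁ : t₁.int iFP 0 = P := by rw [hf₁.int iFP (by decide), hPt]
    have hO₁ : t₁.int aORD = s.int aORD := by
      rw [hf₁.int aORD (by decide), hf.int aORD (by decide)]
    have h4₁ : t₁.int 4 = t.int 4 := hf₁.int 4 (by decide)
    have hb1 : bits ((v : ℤ) + 1) ≤ β := by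
      exact_mod_cast (bits_natCast_mono (Nat.succ_le_of_lt hv)).trans hβn
    refine ok_seq (R := fun t₂ => t₂.int aFIX = Function.update (t₁.int aFIX) P ((v : ℤ) + 1))
      1 1 le_rfl (ok_setInt le_rfl (by simp) (by simp) (by simpa [hv1] using hb1)
        (by simp [hv1, hP₁])) ?_
    intro t₂ hf₂ hF₂
    have hP₂ : t₂.int iFP 0 = P := by rw [hf₂.int iFP (by decide), hP₁]
    have hv₂ : t₂.int vCH 0 = v := by rw [hf₂.int vCH (by decide), hv1]
    have hO₂ : t₂.int aORD P = ord P := by rw [hf₂.int aORD (by decide), hO₁, hord P hP]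
    have h4₂ : t₂.int 4 = t.int 4 := by rw [hf₂.int 4 (by decide), h4₁]
    -- earlier outputs are not overwritten, because `ord` is injective
    refine ok_setInt le_rfl (by simp) (by simp) ?_ ⟨Function.update fix P (v + 1), ?_, hv2, ?_, ?_⟩
    · simp only [IntExpr.eval_var, hv₂]
      exact (bits_natCast_mono hv.le).trans hβn
    · intro p hp
      rw [State.setInt_int_ne _ _ _ (by decide), State.setInt_int_ne _ _ _ (by decide), hF₂]
      simp only [Function.update_apply, Nat.cast_inj]
      split_ifs with h
      · push_cast; rfl
      · exact hfx p hp h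
    · intro p hp
      rw [State.setInt_int_ne _ _ _ (by decide)]
      simp only [IntExpr.eval_add, IntExpr.eval_read, IntExpr.eval_var, IntExpr.eval_one, hP₂, hO₂,
        hv₂, h4₂, State.setInt_int_same]
      by_cases h : p = P
      · subst h
        simp only [Function.update_self]
        refine ⟨by omega, by omega, ?_⟩
        push_cast
        simp
      · have hp' : p < P := by omega
        rw [Function.update_of_ne h]
        refine ⟨(hlo p hp').1, (hlo p hp').2.1, ?_⟩
        rw [Function.update_of_ne, (hlo p hp').2.2]
        intro hc
        have : ord p = ord P := by exact_mod_cast (add_right_cancel (by exact_mod_cast hc))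
        exact h (hinj p (by omega) P hP this)
    · intro p hp
      rw [Function.update_of_ne (by omega)]
      exact hhi p (by omega)
  · rintro t - ⟨fix, -, hbit, hlo, -⟩
    refine ⟨fun p => fix p - 1, fun p hp => ?_, ⟨fix, fun p hp => ?_, hbit⟩, fun p hp => ?_⟩
    · have := hlo p hp
      change fix p - 1 < n
      omega
    · have := hlo p hp
      change fix p = fix p - 1 + 1
      omega
    · obtain ⟨h1, h2, h3⟩ := hlo p hp
      rw [h3]
      push_cast [h1]
      rfl

/-- Detect the trees of minimum weight and, if there are any, write one to the output. -/
def coreProg : Program :=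
  detectProg ;;
  .cond (.intEq (.var vQ) 0) .skip
    (.assign vU (.op .band (.var vQ) (0 - .var vQ)) ;; fixProg ;; .setInt 4 0 1)

/-- A bound for the number of steps of `coreProg`. -/
def coreSteps (n k : ℕ) : ℕ := n * n * 3 + evalSteps n k + fixSteps n k + 10

theorem ok_coreProg {β : ℕ} {s : State} {n k b ex D S W J : ℕ} {par ord : ℕ → ℕ}
    {a r : ℕ → ℕ → ℕ} {x : ℕ → ℤ} (hs : Instance s n k b ex D S W par a r x)
    (hJ : s.int vNSLOTS 0 = J) (hfix : ∀ p < k, s.int aFIX p = 0)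
    (hord : ∀ p < k, s.int aORD p = ord p) (hinj : ∀ p < k, ∀ q < k, ord p = ord q → p = q)
    (hlin : ∀ m fix p, (maskVal S J).testBit m = true → p < k → fix p = 0 →
      (sieveNat n k D S par a r x fix).testBit m = true →
      ∃ v < n, (sieveNat n k D S par a r x (Function.update fix p (v + 1))).testBit m = true)
    (hβ : k * (2 * ex + k + b + (W * D * S + 1)) + b + k + 2 ≤ β)
    (hβJ : S * J + 2 ≤ β) (hβS : S + 2 ≤ β) (hβn : bits (n * n : ℕ) ≤ β) :
    Ok β coreProg s (coreSteps n k) fun s' =>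
      (sieveNat n k D S par a r x 0 &&& maskVal S J = 0 ∧ s'.int 4 = s.int 4) ∨
      ∃ m, (sieveNat n k D S par a r x 0 &&& maskVal S J).testBit m = true ∧
        (∀ j < m, (sieveNat n k D S par a r x 0 &&& maskVal S J).testBit j = false) ∧
        ∃ φ : ℕ → ℕ, (∀ p < k, φ p < n) ∧
          (∃ fix : ℕ → ℕ, (∀ p < k, fix p = φ p + 1) ∧
            (sieveNat n k D S par a r x fix).testBit m = true) ∧
          s'.int 4 0 = 1 ∧ ∀ p < k, s'.int 4 (ord p + 1 : ℕ) = φ p := by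
  refine ok_seq _ (fixSteps n k + 5) (by unfold coreSteps; omega)
    (ok_detectProg hs hJ hfix hβ hβJ hβS hβn) ?_
  rintro s₁ hf₁ ⟨hd₁, hQ₁⟩
  set q := sieveNat n k D S par a r x 0 &&& maskVal S J with hq
  refine ok_cond (fixSteps n k + 4) le_rfl (by simp) (fun h => ?_) (fun h => ?_)
  · refine ok_skip (by omega) (Or.inl ⟨?_, hf₁.int 4 (by decide)⟩)
    simpa [hQ₁] using h
  · have hq0 : q ≠ 0 := by
      rintro h0
      apply h
      simp [hQ₁, h0]
    obtain ⟨m, hm1, hm2, hm3⟩ := land_neg_self hq0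
    have hm4 := hm2
    rw [hq, Nat.testBit_and, Bool.and_eq_true] at hm4
    have hqlt : q < 2 ^ (k * (2 * ex + k + b + (W * D * S + 1)) + b + k) :=
      Nat.and_le_left.trans_lt (hs.sieveSum_bounds 0).2
    have hUb : bits ((2 ^ m : ℕ) : ℤ) ≤ β := by
      refine bits_natCast_le_of_lt (lt_of_le_of_lt ?_ hqlt) (by omega)
      exact Nat.ge_two_pow_of_testBit hm2
    have hev : (IntExpr.op .band (.var vQ) (0 - .var vQ)).eval s₁ = (2 ^ m : ℕ) := by
      rw [← hm1]
      simp [hQ₁]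
    refine ok_seq (R := fun t => t.int vU 0 = (2 ^ m : ℕ)) 1 (fixSteps n k + 1) (by omega)
      (ok_assign le_rfl ?_ (by rwa [hev]) (by rw [hev]; simp)) ?_
    · simp only [IntExpr.fits_band, IntExpr.fits_var, IntExpr.fits_sub, IntExpr.fits_zero,
        true_and, and_true]
      rw [IntExpr.eval_band] at hev
      rwa [hev]
    intro s₂ hf₂ hU₂
    have hd₂ := hd₁.congr (hf₂.int 0 (by decide)) (hf₂.int aPAR (by decide))
      (hf₂.int aEDGE (by decide)) (hf₂.int aXZ (by decide))
    refine ok_seq _ 1 le_rfl (ok_fixProg (m := m) (ord := ord)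
      (H := sieveNat n k D S par a r x) hd₂ (fun fix => hs.sieveSum_bounds fix) ?_ hinj hU₂ ?_
      hm4.1 (fun fix p => hlin m fix p hm4.2) hβ) ?_
    · rwa [hf₂.int aORD (by decide), hf₁.int aORD (by decide)]
    · rwa [hf₂.int aFIX (by decide), hf₁.int aFIX (by decide)]
    rintro s₃ hf₃ ⟨φ, h1, h2, h3⟩
    refine ok_setInt le_rfl (by simp) (by simp) (by simp [bits]; omega)
      (Or.inr ⟨m, hm2, hm3, φ, h1, h2, by simp, fun p hp => ?_⟩)
    rw [IntExpr.eval_zero, State.setInt_int_same, Function.update_of_ne, h3 p hp]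
    exact Nat.cast_ne_zero.2 (Nat.succ_ne_zero (ord p))


/-! ### Preparations -/

/-- Compute the least `v` with `e ≤ 2 ^ v`. -/
def logProg (v : ℕ) (e : IntExpr) : Program :=
  .assign v 0 ;; .loop (.intLt (.twoPow (.var v)) e) (.assign v (.var v + 1))

theorem ok_logProg {β : ℕ} {s : State} {v N : ℕ} {e : IntExpr}
    (he : ∀ s' : State, (∀ a, a ≠ v → s'.int a = s.int a) → e.Fits β s' ∧ e.eval s' = N)
    (hβ : Nat.clog 2 N + 2 ≤ β) :
    Ok β (logProg v e) s (Nat.clog 2 N * 2 + 2) fun s' => s'.int v 0 = Nat.clog 2 N := by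
  refine ok_seq (R := fun t => (∀ a, a ≠ v → t.int a = s.int a) ∧ t.int v 0 = 0) 1
    (Nat.clog 2 N * 2 + 1) (by omega)
    (ok_assign le_rfl (by simp) (by simp [bits]; omega)
      ⟨fun a ha => State.setInt_int_ne _ _ _ ha, by simp⟩) ?_
  rintro s₁ - ⟨hs₁, hv₁⟩
  refine ok_loop (Nat.clog 2 N) 1 (fun j t => (∀ a, a ≠ v → t.int a = s.int a) ∧ t.int v 0 = j)
    le_rfl ⟨hs₁, by simpa using hv₁⟩ ?_ ?_
  · rintro j hj t _ - ⟨ht, hv⟩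
    obtain ⟨h1, h2⟩ := he t ht
    refine ⟨?_, ?_, ok_assign le_rfl (by simp) ?_ ⟨fun a ha => ?_, ?_⟩⟩
    · simp only [Test.fits_intLt, IntExpr.fits_twoPow, IntExpr.fits_var, IntExpr.eval_var, hv, h1,
        Int.toNat_natCast, true_and, and_true]
      exact bits_two_pow_le (by omega)
    · simp only [Test.holds_intLt, IntExpr.eval_twoPow, IntExpr.eval_var, hv, h2,
        Int.toNat_natCast]
      exact_mod_cast (Nat.lt_clog_iff_pow_lt (by norm_num)).1 hj
    · simp only [IntExpr.eval_add, IntExpr.eval_var, IntExpr.eval_one, hv]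
      exact_mod_cast bits_natCast_le (m := j + 1) (by omega)
    · rw [State.setInt_int_ne _ _ _ ha, ht a ha]
    · simp [hv]
  · rintro t _ - ⟨ht, hv⟩
    obtain ⟨h1, h2⟩ := he t ht
    refine ⟨?_, ?_, hv⟩
    · simp only [Test.fits_intLt, IntExpr.fits_twoPow, IntExpr.fits_var, IntExpr.eval_var, hv, h1,
        Int.toNat_natCast, true_and, and_true]
      exact bits_two_pow_le (by omega)
    · simp only [Test.holds_intLt, IntExpr.eval_twoPow, IntExpr.eval_var, hv, h2,
        Int.toNat_natCast, not_lt]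
      exact_mod_cast Nat.le_pow_clog (by norm_num) N

/-- Order the vertices of the tree such that each one but the first is adjacent to an earlier one,
its parent. -/
def ordProg : Program :=
  .setInt aMARK 0 1 ;;
  .forTo iX (.read 0 1 - 1) (
    .forTo iP (.var iX + 1) (.forTo iV (.read 0 1) (
      .cond (.intEq (.read 1 (.read aORD (.var iP) * .read 0 1 + .var iV) *
          (1 - .read aMARK (.var iV))) 1)
        (.assign vNA (.var iP) ;; .assign vNV (.var iV)) .skip)) ;;
    .setInt aORD (.var iX + 1) (.var vNV) ;;
    .setInt aPAR (.var iX + 1) (.var vNA) ;;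
    .setInt aMARK (.var vNV) 1)

/-- The vertices `ord 0, …, ord q` are distinct vertices of the graph with the adjacency numbers
`A`, and each one but the first is adjacent to the earlier one given by `par`. -/
structure IsOrder (k : ℕ) (A : ℕ → ℕ → ℕ) (ord par : ℕ → ℕ) (q : ℕ) : Prop where
  lt : ∀ p ≤ q, ord p < k
  inj : ∀ p ≤ q, ∀ p' ≤ q, ord p = ord p' → p = p'
  par_lt : ∀ p, 0 < p → p ≤ q → par p < p ∧ A (ord (par p)) (ord p) = 1

theorem IsOrder.extend {k : ℕ} {A : ℕ → ℕ → ℕ} {ord par : ℕ → ℕ} {q a v : ℕ}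
    (h : IsOrder k A ord par q) (ha : a ≤ q) (hv : v < k) (hnew : ∀ p ≤ q, ord p ≠ v)
    (hA : A (ord a) v = 1) :
    IsOrder k A (Function.update ord (q + 1) v) (Function.update par (q + 1) a) (q + 1) := by
  have h1 : ∀ p ≤ q, Function.update ord (q + 1) v p = ord p := fun p hp =>
    Function.update_of_ne (by omega) _ _
  refine ⟨fun p hp => ?_, fun p hp p' hp' he => ?_, fun p hp0 hp => ?_⟩
  · rcases Nat.le_succ_iff.1 hp with hp | rfl
    · rw [h1 p hp]; exact h.lt p hp
    · rwa [Nat.succ_eq_add_one, Function.update_self]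
  · rcases Nat.le_succ_iff.1 hp with hp | rfl <;> rcases Nat.le_succ_iff.1 hp' with hp' | rfl
    · rw [h1 p hp, h1 p' hp'] at he
      exact h.inj p hp p' hp' he
    · rw [h1 p hp, Nat.succ_eq_add_one, Function.update_self] at he
      exact absurd he (hnew p hp)
    · rw [h1 p' hp', Nat.succ_eq_add_one, Function.update_self] at he
      exact absurd he.symm (hnew p' hp')
    · rfl
  · rcases Nat.le_succ_iff.1 hp with hp | rfl
    · obtain ⟨h2, h3⟩ := h.par_lt p hp0 hp
      rw [Function.update_of_ne (by omega : p ≠ q + 1), h1 p hp, h1 _ (by omega)]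
      exact ⟨h2, h3⟩
    · rw [Nat.succ_eq_add_one, Function.update_self, Function.update_self, h1 a ha]
      exact ⟨by omega, hA⟩

/-- As long as vertices are missing, connectedness provides an edge that leaves the set of the
marked ones; `hconn` states connectedness for the adjacency numbers. -/
theorem ok_ordProg {β : ℕ} {s : State} {k : ℕ} {A : ℕ → ℕ → ℕ} (hk : s.int 0 1 = k) (hk1 : 1 ≤ k)
    (hA : ∀ u < k, ∀ v < k, s.int 1 (u * k + v : ℕ) = A u v ∧ A u v ≤ 1)
    (hconn : ∀ P : ℕ → Prop, P 0 → (∃ v < k, ¬ P v) →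
      ∃ u < k, ∃ v < k, P u ∧ ¬ P v ∧ A u v = 1)
    (hM : ∀ v < k, s.int aMARK v = 0) (hO : s.int aORD 0 = 0) (hβ : k + 2 ≤ β) :
    Ok β ordProg s (k * (k * (k * 6 + 4) + 10) + 10) fun s' => ∃ ord par : ℕ → ℕ,
      IsOrder k A ord par (k - 1) ∧ (∀ p < k, s'.int aORD p = ord p) ∧
      ∀ p, 0 < p → p < k → s'.int aPAR p = par p := by
  have hβk : bits (k : ℤ) ≤ β := bits_natCast_le (by omega)
  have hbit1 : bits (1 : ℤ) ≤ β := by simp [bits]; omega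
  refine ok_seq (R := fun t => t.int aMARK = Function.update (s.int aMARK) 0 1) 1
    (k * (k * (k * 6 + 4) + 10) + 2) (by omega)
    (ok_setInt le_rfl (by simp) (by simp) (by simpa using hbit1) (by simp)) ?_
  intro s₁ hf₁ hM₁
  have hk₁ : s₁.int 0 1 = k := by rw [hf₁.int 0 (by decide), hk]
  refine ok_forTo (k - 1) (k * (k * 6 + 4) + 5) (fun q t => ∃ ord par : ℕ → ℕ,
    IsOrder k A ord par q ∧ (∀ p ≤ q, t.int aORD p = ord p) ∧ ord 0 = 0 ∧
      (∀ p, 0 < p → p ≤ q → t.int aPAR p = par p) ∧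
      ∀ v < k, (t.int aMARK v = 1 ∧ ∃ p ≤ q, ord p = v) ∨
        (t.int aMARK v = 0 ∧ ∀ p ≤ q, ord p ≠ v)) ?_ ?_ (by decide) ?_ ?_ ?_ ?_
  · have : (k - 1) * (k * (k * 6 + 4) + 5 + 2) ≤ k * (k * (k * 6 + 4) + 10) :=
      Nat.mul_le_mul (by omega) (by omega)
    omega
  · exact (bits_natCast_mono (by omega)).trans hβk
  · intro t _ hf
    simp [hf.int 0 (by decide), hk₁, hk1]
  · refine ⟨fun _ => 0, fun _ => 0, ⟨fun p _ => by omega, fun p hp p' hp' _ => by omega,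
      fun p h1 h2 => by omega⟩, fun p hp => ?_, rfl, fun p h1 h2 => by omega, fun v hv => ?_⟩
    · obtain rfl : p = 0 := by omega
      simpa [hf₁.int aORD (by decide)] using hO
    · rw [State.setInt_int_ne _ _ _ (by decide), hM₁]
      by_cases h : v = 0
      · exact Or.inl ⟨by simp [h], 0, le_rfl, h.symm⟩
      · exact Or.inr ⟨by simp [h, hM v hv], fun p _ => Ne.symm h⟩
  · rintro q hq t _ hf hqt ⟨ord, par, hord, hO', h00, hP', hM'⟩
    have hkt : t.int 0 1 = k := by rw [hf.int 0 (by decide), hk₁]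
    have hAt : t.int 1 = s.int 1 := by rw [hf.int 1 (by decide), hf₁.int 1 (by decide)]
    have hqk : q + 1 < k := by omega
    -- the vertices that may be appended, with their parents
    set Cand : ℕ → ℕ → Prop := fun a v => A (ord a) v = 1 ∧ ∀ p ≤ q, ord p ≠ v with hCand
    have hex : ∃ a ≤ q, ∃ v < k, Cand a v := by
      obtain ⟨u, hu, v, hv, ⟨p, hp, rfl⟩, h2, h3⟩ := hconn (fun v => ∃ p ≤ q, ord p = v)
        ⟨0, by omega, h00⟩ (by
          by_contra! h
          have h1 : Finset.range k ⊆ (Finset.range (q + 1)).image ord := by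
            intro v hv
            obtain ⟨p, hp, hpv⟩ := h v (Finset.mem_range.1 hv)
            exact Finset.mem_image.2 ⟨p, Finset.mem_range.2 (by omega), hpv⟩
          have h2 := (Finset.card_le_card h1).trans Finset.card_image_le
          rw [Finset.card_range, Finset.card_range] at h2
          omega)
      exact ⟨p, hp, v, hv, h3, fun p' hp' h => h2 ⟨p', hp', h⟩⟩
    set Found : State → Prop := fun t' => ∃ a ≤ q, ∃ v < k, t'.int vNA 0 = a ∧ t'.int vNV 0 = v ∧
      Cand a v with hFound
    refine ok_seq (R := Found) ((q + 1) * (k * 6 + 4) + 2) 3 ?_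
      (ok_forTo (q + 1) (k * 6 + 2) (fun i t' => Found t' ∨ ∀ a < i, ∀ v < k, ¬ Cand a v) le_rfl
        ((bits_natCast_mono hqk.le).trans hβk) (by decide) ?_ (Or.inr (by simp)) ?_ ?_) ?_
    · have : (q + 1) * (k * 6 + 4) ≤ k * (k * 6 + 4) := Nat.mul_le_mul_right _ hqk.le
      omega
    · intro t' _ hf'
      simp [hf'.int iX (by decide), hqt]
    · rintro i hi t' _ hf' hi' hI
      refine (ok_forTo k 4 (fun j t' => Found t' ∨ ((∀ a < i, ∀ v < k, ¬ Cand a v) ∧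
        ∀ v < j, ¬ Cand i v)) (Q := fun t' => Found t' ∨ ((∀ a < i, ∀ v < k, ¬ Cand a v) ∧
        ∀ v < k, ¬ Cand i v)) le_rfl hβk (by decide) ?_ ?_ ?_ (fun _ _ h => h)).mono le_rfl ?_
      · intro t₁ _ hf₁'
        simp [hf₁'.int 0 (by decide), hf'.int 0 (by decide), hkt]
      · rcases hI with h | h
        · exact Or.inl (by simpa [hFound] using h)
        · exact Or.inr ⟨h, by simp⟩
      · intro j hj t₁ _ hf₂ hj' hI₁
        have e0 : t₁.int 0 1 = k := by rw [hf₂.int 0 (by decide), hf'.int 0 (by decide), hkt]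
        have e1 : t₁.int 1 = s.int 1 := by rw [hf₂.int 1 (by decide), hf'.int 1 (by decide), hAt]
        have e2 : t₁.int aORD i = ord i := by
          rw [hf₂.int aORD (by decide), hf'.int aORD (by decide), hO' i (by omega)]
        have e3 : t₁.int aMARK = t.int aMARK := by
          rw [hf₂.int aMARK (by decide), hf'.int aMARK (by decide)]
        have e4 : t₁.int iP 0 = i := by rw [hf₂.int iP (by decide), hi']
        obtain ⟨hA1, hA2⟩ := hA _ (hord.lt i (by omega)) j hj
        push_cast at hA1
        have hc : (Test.intEq (.read 1 (.read aORD (.var iP) * .read 0 1 + .var iV) *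
            (1 - .read aMARK (.var iV))) 1).Holds t₁ ↔ Cand i j := by
          simp only [Test.holds_intEq, IntExpr.eval_mul, IntExpr.eval_read, IntExpr.eval_add,
            IntExpr.eval_var, IntExpr.eval_sub, IntExpr.eval_one, e0, e1, e2,
            e3, e4, hj', hA1, hCand]
          rcases hM' j hj with ⟨h1, p, hp, h2⟩ | ⟨h1, h2⟩
          · rw [h1]
            simp only [sub_self, mul_zero, zero_ne_one, false_iff]
            exact fun h => h.2 p hp h2
          · rw [h1]
            simp only [sub_zero, mul_one]
            exact ⟨fun h => ⟨by exact_mod_cast h, h2⟩, fun h => by exact_mod_cast h.1⟩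
        refine ok_cond 3 le_rfl (by simp) (fun h => ?_) (fun h => ?_)
        · rw [hc] at h
          refine ok_seq (R := fun t₂ => t₂.int vNA 0 = i) 1 1 (by omega)
            (ok_assign le_rfl (by simp) (by simpa [e4] using (bits_natCast_mono (by omega)).trans hβk)
              (by simp [e4])) ?_
          intro t₂ hf₃ hNA
          have hj₂ : t₂.int iV 0 = j := by rw [hf₃.int iV (by decide), hj']
          refine ok_assign le_rfl (by simp) ?_ (Or.inl ⟨i, by omega, j, hj, ?_, ?_, h⟩)
          · simpa [hj₂] using (bits_natCast_mono hj.le).trans hβk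
          · simp [hNA]
          · simp [hj₂]
        · rw [hc] at h
          refine ok_skip (by omega) ?_
          rcases hI₁ with h1 | ⟨h1, h2⟩
          · exact Or.inl (by simpa [hFound] using h1)
          · refine Or.inr ⟨h1, fun v hv => ?_⟩
            rcases Nat.lt_succ_iff_lt_or_eq.1 hv with hv | rfl
            · exact h2 v hv
            · exact h
      · rintro t₁ - h
        rcases h with h | ⟨h1, h2⟩
        · exact Or.inl (by simpa [hFound] using h)
        · refine Or.inr fun a ha => ?_
          rcases Nat.lt_succ_iff_lt_or_eq.1 ha with ha | rfl
          · exact h1 a ha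
          · exact h2
    · rintro t' - (h | h)
      · exact h
      · obtain ⟨a, ha, v, hv, hc⟩ := hex
        exact absurd hc (h a (by omega) v hv)
    rintro t₁ hf₁' ⟨a, ha, v, hv, hNA, hNV, hc⟩
    have hq₁ : t₁.int iX 0 = q := by rw [hf₁'.int iX (by decide), hqt]
    have hO₁ : t₁.int aORD = t.int aORD := hf₁'.int aORD (by decide)
    have hP₁ : t₁.int aPAR = t.int aPAR := hf₁'.int aPAR (by decide)
    have hM₁' : t₁.int aMARK = t.int aMARK := hf₁'.int aMARK (by decide)
    have hbv : bits (v : ℤ) ≤ β := (bits_natCast_mono hv.le).trans hβk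
    have hba : bits (a : ℤ) ≤ β := (bits_natCast_mono (by omega)).trans hβk
    refine ok_seq (R := fun t₂ => t₂.int aORD = Function.update (t.int aORD) (q + 1 : ℕ) v) 1 2
      le_rfl (ok_setInt le_rfl (by simp) (by simp) (by simpa [hNV] using hbv)
        (by simp [hq₁, hNV, hO₁])) ?_
    intro t₂ hf₂ hO₂
    have hq₂ : t₂.int iX 0 = q := by rw [hf₂.int iX (by decide), hq₁]
    have hNA₂ : t₂.int vNA 0 = a := by rw [hf₂.int vNA (by decide), hNA]
    have hNV₂ : t₂.int vNV 0 = v := by rw [hf₂.int vNV (by decide), hNV]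
    have hP₂ : t₂.int aPAR = t.int aPAR := by rw [hf₂.int aPAR (by decide), hP₁]
    have hM₂ : t₂.int aMARK = t.int aMARK := by rw [hf₂.int aMARK (by decide), hM₁']
    refine ok_seq (R := fun t₃ => t₃.int aPAR = Function.update (t.int aPAR) (q + 1 : ℕ) a) 1 1
      le_rfl (ok_setInt le_rfl (by simp) (by simp) (by simpa [hNA₂] using hba)
        (by simp [hq₂, hNA₂, hP₂])) ?_
    intro t₃ hf₃ hP₃
    have hNV₃ : t₃.int vNV 0 = v := by rw [hf₃.int vNV (by decide), hNV₂]
    have hM₃ : t₃.int aMARK = t.int aMARK := by rw [hf₃.int aMARK (by decide), hM₂]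
    have hO₃ : t₃.int aORD = Function.update (t.int aORD) (q + 1 : ℕ) v := by
      rw [hf₃.int aORD (by decide), hO₂]
    refine ok_setInt le_rfl (by simp) (by simp) (by simpa using hbit1)
      ⟨Function.update ord (q + 1) v, Function.update par (q + 1) a,
        hord.extend ha hv hc.2 hc.1, fun p hp => ?_, ?_, fun p hp0 hp => ?_, fun u hu => ?_⟩
    · rw [State.setInt_int_ne _ _ _ (by decide), State.setInt_int_ne _ _ _ (by decide), hO₃]
      simp only [Function.update_apply, Nat.cast_inj]
      split_ifs with h
      · rfl
      · exact hO' p (by omega)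
    · rw [Function.update_of_ne (by omega), h00]
    · rw [State.setInt_int_ne _ _ _ (by decide), State.setInt_int_ne _ _ _ (by decide), hP₃]
      simp only [Function.update_apply, Nat.cast_inj]
      split_ifs with h
      · rfl
      · exact hP' p hp0 (by omega)
    · rw [State.setInt_int_ne _ _ _ (by decide)]
      simp only [IntExpr.eval_var, IntExpr.eval_one, hNV₃, hM₃, State.setInt_int_same,
        Function.update_apply, Nat.cast_inj]
      by_cases h : u = v
      · exact Or.inl ⟨by simp [h], q + 1, le_rfl, by simp [h]⟩
      · simp only [h, if_false]
        rcases hM' u hu with ⟨h1, p, hp, h2⟩ | ⟨h1, h2⟩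
        · exact Or.inl ⟨h1, p, by omega, by rwa [if_neg (by omega)]⟩
        · refine Or.inr ⟨h1, fun p hp => ?_⟩
          split_ifs with h3
          · exact Ne.symm h
          · exact h2 p (by omega)
  · rintro t - ⟨ord, par, h1, h2, -, h3, -⟩
    exact ⟨ord, par, h1, fun p hp => h2 p (by omega), fun p h0 hp => h3 p h0 (by omega)⟩

/-- Evaluation at `B`, by Horner's rule, of the polynomial of degree less than `j` with the
coefficients `c 0, …, c (j - 1)`, the leading one first. -/
def horner {R : Type*} [Semiring R] (B : R) (c : ℕ → R) : ℕ → R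
  | 0 => 0
  | j + 1 => horner B c j * B + c j

theorem horner_map {R S : Type*} [Semiring R] [Semiring S] (f : R →+* S) (B : R) (c : ℕ → R) :
    ∀ j, f (horner B c j) = horner (f B) (fun i => f (c i)) j
  | 0 => by simp [horner]
  | j + 1 => by simp [horner, horner_map f B c j]

/-- A coin as a number. -/
def coinVal (R : Type*) [Semiring R] (c : Bool) : R := if c then 1 else 0

theorem coinVal_map {R S : Type*} [Semiring R] [Semiring S] (f : R →+* S) (c : Bool) :
    f (coinVal R c) = coinVal S c := by
  unfold coinVal
  split_ifs <;> simp

/-- The label `m`: a random polynomial of degree less than `d`, evaluated at `B`. -/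
def label {R : Type*} [Semiring R] (B : R) (d : ℕ) (ω : ℕ → Bool) (m : ℕ) : R :=
  horner B (fun j => coinVal R (ω (m * d + j))) d

theorem label_map {R S : Type*} [Semiring R] [Semiring S] (f : R →+* S) (B : R) (d : ℕ)
    (ω : ℕ → Bool) (m : ℕ) : f (label B d ω m) = label (f B) d ω m := by
  unfold label
  rw [horner_map]
  simp only [coinVal_map]

theorem horner_coin_bounds {S : ℕ} (hS : 1 ≤ S) (c : ℕ → Bool) :
    ∀ j, 0 ≤ horner (2 ^ S : ℤ) (fun i => coinVal ℤ (c i)) j ∧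
      horner (2 ^ S : ℤ) (fun i => coinVal ℤ (c i)) j < 2 ^ (S * j)
  | 0 => by simp [horner]
  | j + 1 => by
    obtain ⟨h1, h2⟩ := horner_coin_bounds hS c j
    have h3 : 0 ≤ coinVal ℤ (c j) ∧ coinVal ℤ (c j) ≤ 1 := by unfold coinVal; split_ifs <;> simp
    have h4 : (2 : ℤ) ≤ 2 ^ S := le_self_pow₀ (by norm_num) (by omega)
    rw [horner, mul_add, mul_one, pow_add]
    constructor
    · nlinarith [h3.1]
    · nlinarith [h3.2]

/-- Toss the coins for the labels. -/
def tossProg : Program :=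
  .forTo iM (2 * .read 0 1 * .read 0 0) (
    .assign vY 0 ;;
    .forTo iT (.var vD) (.toss vCOIN 0 ;;
      .assign vY (.var vY * .twoPow (.var vSLOT) + .var vCOIN)) ;;
    .setInt aXZ (.var iM) (.var vY))

theorem ok_tossProg {β : ℕ} {s : State} {n k d S : ℕ} (hn : s.int 0 0 = n) (hk : s.int 0 1 = k)
    (hd : s.int vD 0 = d) (hSl : s.int vSLOT 0 = S) (hS : 1 ≤ S) (hβ : S * d + S + 2 ≤ β)
    (hβd : d + 1 ≤ β) (hβkn : bits (2 * k * n : ℕ) ≤ β) :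
    Ok β tossProg s (2 * k * n * (d * 4 + 6) + 2) fun s' => ∀ m < 2 * k * n,
      s'.int aXZ m = label (2 ^ S : ℤ) d s.coins m := by
  refine ok_forTo (2 * k * n) (d * 4 + 4) (fun r t => (t.coins = fun i => s.coins (r * d + i)) ∧
    ∀ m < r, t.int aXZ m = label (2 ^ S : ℤ) d s.coins m) le_rfl hβkn (by decide) ?_
    ⟨by simp, by simp⟩ ?_ (fun t _ h => h.2)
  · intro t _ hf
    simp [hf.int 0 (by decide), hn, hk]
  rintro r hr t _ hf hrt ⟨hc, hx⟩
  refine ok_seq (R := fun t₁ => t₁.int vY 0 = 0) 1 (d * 4 + 3) (by omega)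
    (ok_assign le_rfl (by simp) (by simp [bits]; omega) (by simp)) ?_
  intro t₁ hf₁ hy
  have hd₁ : t₁.int vD 0 = d := by rw [hf₁.int vD (by decide), hf.int vD (by decide), hd]
  have hS₁ : t₁.int vSLOT 0 = S := by
    rw [hf₁.int vSLOT (by decide), hf.int vSLOT (by decide), hSl]
  have hc₁ : t₁.coins = fun i => s.coins (r * d + i) := by rw [hf₁.coins (by decide), hc]
  refine ok_seq (R := fun t₂ => t₂.int vY 0 = label (2 ^ S : ℤ) d s.coins r ∧
      t₂.coins = fun i => s.coins ((r + 1) * d + i)) (d * 4 + 2) 1 (by omega)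
    (ok_forTo d 2 (fun j t₂ => t₂.int vY 0 =
        horner (2 ^ S : ℤ) (fun i => coinVal ℤ (s.coins (r * d + i))) j ∧
      t₂.coins = fun i => s.coins (r * d + j + i)) le_rfl (bits_natCast_le hβd) (by decide) ?_
      ⟨by simpa [horner] using hy, by simpa using hc₁⟩ ?_ ?_) ?_
  · intro t₂ _ hf₂
    simp [hf₂.int vD (by decide), hd₁]
  · rintro j hj t₂ _ hf₂ - ⟨hy₂, hc₂⟩
    refine ok_seq (R := fun t₃ => t₃.int vCOIN 0 = coinVal ℤ (s.coins (r * d + j)) ∧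
        t₃.coins = fun i => s.coins (r * d + (j + 1) + i)) 1 1 le_rfl
      (ok_toss le_rfl (by simp) (by omega) ⟨?_, ?_⟩) ?_
    · simp [hc₂, coinVal]
    · simp only [State.toss_coins, hc₂]
      funext i
      congr 1
      ring
    rintro t₃ hf₃ ⟨hcoin, hc₃⟩
    have hy₃ := hf₃.int vY (by decide)
    have hS₃ : t₃.int vSLOT 0 = S := by
      rw [hf₃.int vSLOT (by decide), hf₂.int vSLOT (by decide), hS₁]
    have hev : (IntExpr.var vY * .twoPow (.var vSLOT) + .var vCOIN).eval t₃ =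
        horner (2 ^ S : ℤ) (fun i => coinVal ℤ (s.coins (r * d + i))) (j + 1) := by
      simp only [IntExpr.eval_add, IntExpr.eval_mul, IntExpr.eval_var, IntExpr.eval_twoPow, hy₃,
        hy₂, hS₃, hcoin, horner, Int.toNat_natCast]
    refine ok_assign le_rfl ?_ ?_ ⟨?_, by simpa using hc₃⟩
    · simp only [IntExpr.fits_add, IntExpr.fits_mul, IntExpr.fits_var, IntExpr.fits_twoPow,
        IntExpr.eval_var, hS₃, Int.toNat_natCast, true_and, and_true]
      exact bits_two_pow_le (by omega)
    · rw [hev]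
      refine bits_le (horner_coin_bounds hS _ (j + 1)) ?_
      have : S * (j + 1) ≤ S * d := Nat.mul_le_mul_left _ hj
      omega
    · rw [hev]; simp
  · rintro t₂ - ⟨h1, h2⟩
    refine ⟨h1, ?_⟩
    rw [h2, add_mul, one_mul]
  rintro t₂ hf₂ ⟨hy₂, hc₂⟩
  have hr₂ : t₂.int iM 0 = r := by rw [hf₂.int iM (by decide), hf₁.int iM (by decide), hrt]
  have hx₂ : t₂.int aXZ = t.int aXZ := by rw [hf₂.int aXZ (by decide), hf₁.int aXZ (by decide)]
  refine ok_setInt le_rfl (by simp) (by simp) ?_ ⟨by simpa using hc₂, fun m hm => ?_⟩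
  · rw [IntExpr.eval_var, hy₂]
    exact bits_le (horner_coin_bounds hS _ d) (by omega)
  · rw [State.setInt_int_ne _ _ _ (by decide)]
    simp only [IntExpr.eval_var, hy₂, hr₂, hx₂, State.setInt_int_same, Function.update_apply,
      Nat.cast_inj]
    split_ifs with h
    · rw [h]
    · exact hx m (by omega)


/-! ### The sieve in characteristic two -/

/-- A map into `{0, …, n - 1}` as a map of natural numbers. -/
def ext {k n : ℕ} (φ : Fin k → Fin n) (p : ℕ) : ℕ := if h : p < k then (φ ⟨p, h⟩ : ℕ) else 0

theorem ext_apply {k n : ℕ} (φ : Fin k → Fin n) (p : Fin k) : ext φ p = φ p := by simp [ext]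

theorem ext_lt {k n : ℕ} (φ : Fin k → Fin n) {p : ℕ} (hp : p < k) : ext φ p < n := by
  simp [ext, hp]

theorem ext_snoc_of_lt {q n : ℕ} (φ : Fin q → Fin n) (u : Fin n) {p : ℕ} (hp : p < q) :
    ext (Fin.snoc φ u : Fin (q + 1) → Fin n) p = ext φ p := by
  rw [ext, ext, dif_pos hp, dif_pos (by omega)]
  congr 1
  exact Fin.snoc_castSucc (α := fun _ => Fin n) u φ ⟨p, hp⟩

theorem ext_snoc_last {q n : ℕ} (φ : Fin q → Fin n) (u : Fin n) :
    ext (Fin.snoc φ u : Fin (q + 1) → Fin n) q = u := by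
  rw [ext, dif_pos (by omega)]
  congr 1
  exact Fin.snoc_last (α := fun _ => Fin n) u φ

/-- The folds evaluate the sum over all maps, by distributivity: a map on the positions up to
`q + 1` is a map on those up to `q` together with the image of `q + 1`. -/
theorem homSum_eq_sum {R : Type*} [CommSemiring R] {n : ℕ} {par : ℕ → ℕ} {E : ℕ → ℕ → R} :
    ∀ (q : ℕ) (g : ℕ → ℕ → R), (∀ p, 0 < p → p ≤ q → par p < p) →
      homSum n par E q g = ∑ φ : Fin (q + 1) → Fin n,
        (∏ p ∈ Finset.range (q + 1), g p (ext φ p)) *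
          ∏ p ∈ Finset.range q, E (ext φ (par (p + 1))) (ext φ (p + 1))
  | 0, g, _ => by
    rw [homSum, Finset.sum_range]
    refine Fintype.sum_equiv (Equiv.funUnique (Fin 1) (Fin n)).symm _ _ fun v => ?_
    simp [ext]
  | q + 1, g, hp => by
    have hq := hp (q + 1) (by omega) le_rfl
    rw [homSum, homSum_eq_sum q _ fun p h1 h2 => hp p h1 (by omega),
      ← (Fin.snocEquiv fun _ : Fin (q + 1 + 1) => Fin n).sum_comp, Fintype.sum_prod_type_right]
    refine Finset.sum_congr rfl fun φ _ => ?_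
    have h1 : ∏ p ∈ Finset.range (q + 1), foldAt n par E (q + 1) g p (ext φ p) =
        (∏ p ∈ Finset.range (q + 1), g p (ext φ p)) *
          ∑ u : Fin n, E (ext φ (par (q + 1))) u * g (q + 1) u := by
      have h2 : ∀ p ∈ Finset.range (q + 1), foldAt n par E (q + 1) g p (ext φ p) =
          g p (ext φ p) * if p = par (q + 1) then
            ∑ u : Fin n, E (ext φ p) u * g (q + 1) u else 1 := by
        intro p _
        unfold foldAt
        split_ifs
        · rw [Finset.sum_range]
        · rw [mul_one]
      rw [Finset.prod_congr rfl h2, Finset.prod_mul_distrib, Finset.prod_ite_eq',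
        if_pos (Finset.mem_range.2 hq)]
    rw [h1, mul_assoc, Finset.sum_mul, Finset.mul_sum]
    refine Finset.sum_congr rfl fun u _ => ?_
    set ψ : Fin (q + 1 + 1) → Fin n := Fin.snoc φ u with hψ
    change _ = (∏ p ∈ Finset.range (q + 1 + 1), g p (ext ψ p)) *
      ∏ p ∈ Finset.range (q + 1), E (ext ψ (par (p + 1))) (ext ψ (p + 1))
    have h3 : ∀ p ∈ Finset.range (q + 1), g p (ext ψ p) = g p (ext φ p) := fun p h => by
      rw [hψ, ext_snoc_of_lt φ u (Finset.mem_range.1 h)]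
    have h4 : ∀ p ∈ Finset.range q, E (ext ψ (par (p + 1))) (ext ψ (p + 1)) =
        E (ext φ (par (p + 1))) (ext φ (p + 1)) := fun p h => by
      have h5 := Finset.mem_range.1 h
      have h6 := hp (p + 1) (by omega) (by omega)
      rw [hψ, ext_snoc_of_lt φ u (by omega), ext_snoc_of_lt φ u (by omega)]
    rw [Finset.prod_range_succ (fun p => g p (ext ψ p)) (q + 1),
      Finset.prod_range_succ (fun p => E (ext ψ (par (p + 1))) (ext ψ (p + 1))) q,
      Finset.prod_congr rfl h3, Finset.prod_congr rfl h4, hψ, ext_snoc_last,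
      ext_snoc_of_lt φ u hq]
    ring

section charTwo
variable {R : Type*} [CommRing R] [CharP R 2]

theorem det_eq_sum_perm {k : ℕ} (A : Matrix (Fin k) (Fin k) R) :
    A.det = ∑ σ : Equiv.Perm (Fin k), ∏ p, A (σ p) p := by
  rw [Matrix.det_apply]
  refine Finset.sum_congr rfl fun σ _ => ?_
  rcases Int.units_eq_one_or (Equiv.Perm.sign σ) with h | h
  · rw [h, one_smul]
  · rw [h, Units.neg_smul, one_smul, CharTwo.neg_eq]

/-- The number of label sets that contain the image of `f` is odd only if `f` is surjective. -/
theorem sum_prod_testBit {k : ℕ} (f : Fin k → Fin k) :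
    ∑ X ∈ Finset.range (2 ^ k), ∏ p : Fin k, ((X / 2 ^ (f p : ℕ) % 2 : ℕ) : R) =
      if Function.Bijective f then 1 else 0 := by
  have hbit : ∀ X l : ℕ, ((X / 2 ^ l % 2 : ℕ) : R) = if X.testBit l then 1 else 0 := by
    intro X l
    rw [← Nat.toNat_testBit]
    cases X.testBit l <;> simp
  simp only [hbit]
  split_ifs with h
  · rw [Finset.sum_eq_single (2 ^ k - 1)]
    · refine Finset.prod_eq_one fun p _ => ?_
      rw [Nat.testBit_two_pow_sub_one]
      simp
    · intro X hX hne
      have hX' := Finset.mem_range.1 hX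
      obtain ⟨l, hl, hl'⟩ : ∃ l < k, X.testBit l = false := by
        by_contra! hc
        apply hne
        refine Nat.eq_of_testBit_eq fun l => ?_
        rw [Nat.testBit_two_pow_sub_one]
        by_cases hl : l < k
        · simpa [hl] using hc l hl
        · simp only [hl, decide_false]
          exact Nat.testBit_lt_two_pow
            (hX'.trans_le (Nat.pow_le_pow_right (by norm_num) (by omega)))
      obtain ⟨p, hp⟩ := h.surjective ⟨l, hl⟩
      refine Finset.prod_eq_zero (Finset.mem_univ p) ?_
      simp [hp, hl']
    · intro hc
      exact absurd (Finset.mem_range.2 (by have := Nat.one_le_two_pow (n := k); omega)) hc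
  · obtain ⟨l, hl⟩ : ∃ l, ∀ p, f p ≠ l := by
      by_contra! hc
      exact h (Finite.injective_iff_bijective.1 (Finite.injective_iff_surjective.2 hc))
    have hlk : 2 ^ (l : ℕ) < 2 ^ k := Nat.pow_lt_pow_right (by norm_num) l.2
    refine Finset.sum_involution (fun X _ => X ^^^ 2 ^ (l : ℕ)) ?_ ?_ ?_ ?_
    · intro X _
      have : ∀ p : Fin k, (X ^^^ 2 ^ (l : ℕ)).testBit (f p) = X.testBit (f p) := by
        intro p
        rw [Nat.testBit_xor, Nat.testBit_two_pow]
        have : (l : ℕ) ≠ f p := fun h => hl p (Fin.ext h.symm)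
        simp [this]
      simp only [this]
      exact CharTwo.add_self_eq_zero _
    · intro X _ _ hc
      have h1 := congrArg (fun Y : ℕ => Y.testBit l) hc
      simp only [Nat.testBit_xor, Nat.testBit_two_pow_self] at h1
      cases h2 : X.testBit l <;> simp [h2] at h1
    · intro X hX
      exact Finset.mem_range.2 (Nat.xor_lt_two_pow (Finset.mem_range.1 hX) hlk)
    · intro X _
      rw [Nat.xor_assoc, Nat.xor_self, Nat.xor_zero]

/-- Summed over all label sets, the products of the selected parts of the row sums of a matrix give
its determinant. -/
theorem sum_prod_sum_testBit {k : ℕ} (A : Fin k → Fin k → R) :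
    ∑ X ∈ Finset.range (2 ^ k), ∏ p : Fin k, ∑ l : Fin k, ((X / 2 ^ (l : ℕ) % 2 : ℕ) : R) * A p l =
      (Matrix.of A).det := by
  simp only [Finset.prod_univ_sum, Fintype.piFinset_univ, Finset.prod_mul_distrib]
  rw [Finset.sum_comm]
  simp only [← Finset.sum_mul, sum_prod_testBit]
  rw [← Matrix.det_transpose, det_eq_sum_perm]
  simp only [ite_mul, one_mul, zero_mul]
  rw [← Finset.sum_filter]
  symm
  refine Finset.sum_bij' (fun σ _ => (σ : Fin k → Fin k))
    (fun f hf => Equiv.ofBijective f (Finset.mem_filter.1 hf).2) ?_ ?_ ?_ ?_ ?_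
  · intro σ _
    exact Finset.mem_filter.2 ⟨Finset.mem_univ _, σ.bijective⟩
  · intro f _
    exact Finset.mem_univ _
  · intro σ _
    ext p
    rfl
  · intro f _
    rfl
  · intro σ _
    rfl

end charTwo

/-- The contribution of the map `φ` to the sieve: the product of its own labels and the determinant
of the labels of its values. The determinant vanishes unless `φ` is injective. -/
def term {R : Type*} [CommRing R] {k n : ℕ} (x : ℕ → R) (φ : Fin k → Fin n) : R :=
  (∏ p : Fin k, x (p * n + φ p)) * (Matrix.of fun p l : Fin k => x (k * n + φ p * k + l)).det

theorem term_congr {R : Type*} [CommRing R] {k n : ℕ} {x y : ℕ → R}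
    (h : ∀ m < 2 * k * n, x m = y m) (φ : Fin k → Fin n) : term x φ = term y φ := by
  have h1 : ∀ p : Fin k, x (p * n + φ p) = y (p * n + φ p) := fun p =>
    h _ (by have := cell_lt p.2 (φ p).2; nlinarith)
  have h2 : ∀ p l : Fin k, x (k * n + φ p * k + l) = y (k * n + φ p * k + l) := fun p l =>
    h _ (by have := cell_lt (φ p).2 l.2; nlinarith)
  simp only [term, h1, h2]

theorem term_map {R S : Type*} [CommRing R] [CommRing S] (f : R →+* S) {k n : ℕ} (x : ℕ → R)
    (φ : Fin k → Fin n) : f (term x φ) = term (fun m => f (x m)) φ := by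
  simp only [term, map_mul, map_prod, RingHom.map_det]
  rfl

theorem term_eq_zero {R : Type*} [CommRing R] {k n : ℕ} (x : ℕ → R) {φ : Fin k → Fin n}
    (h : ¬ Function.Injective φ) : term x φ = 0 := by
  simp only [Function.Injective, not_forall] at h
  obtain ⟨p, q, h1, h2⟩ := h
  rw [term, Matrix.det_zero_of_row_eq h2, mul_zero]
  funext l
  simp [h1]

/-- The map `φ` respects the positions fixed by `fix`. -/
def Respects {k n : ℕ} (fix : ℕ → ℕ) (φ : Fin k → Fin n) : Prop :=
  ∀ p : Fin k, fix p = 0 ∨ fix p = φ p + 1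

open Classical in
/-- In characteristic two the sieve is the sum of the terms of all homomorphisms that respect the
fixed positions: summing over the label sets turns the products of label sums into determinants, and
these vanish at the maps that are not injective. -/
theorem sieveSum_eq_sum_term {R : Type*} [CommRing R] [CharP R 2] {n k : ℕ} {par : ℕ → ℕ}
    {E : ℕ → ℕ → R} {x : ℕ → R} {fix : ℕ → ℕ} (hk : 1 ≤ k)
    (hp : ∀ p, 0 < p → p < k → par p < p) :
    sieveSum n k par E x fix = ∑ φ : Fin k → Fin n, if Respects fix φ then
      (∏ p ∈ Finset.range (k - 1), E (ext φ (par (p + 1))) (ext φ (p + 1))) * term x φ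
      else 0 := by
  obtain ⟨q, rfl⟩ : ∃ q, k = q + 1 := ⟨k - 1, by omega⟩
  unfold sieveSum
  have h1 : ∀ X, homSum n par E (q + 1 - 1) (fun p v => initVal n (q + 1) x fix X (p * n + v)) =
      _ := fun X => homSum_eq_sum q _ fun p h1 h2 => hp p h1 (by omega)
  simp only [h1]
  rw [Finset.sum_comm]
  refine Finset.sum_congr rfl fun φ _ => ?_
  rw [← Finset.sum_mul, mul_comm]
  have h2 : ∀ X (p : Fin (q + 1)), initVal n (q + 1) x fix X (p * n + ext φ p) =
      (if fix p = 0 ∨ fix p = φ p + 1 then x (p * n + φ p) else 0) *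
        ∑ l : Fin (q + 1), ((X / 2 ^ (l : ℕ) % 2 : ℕ) : R) *
          x ((q + 1) * n + φ p * (q + 1) + l) := by
    intro X p
    rw [initVal, ext_apply, cell_div (φ p).2, cell_mod (φ p).2, Finset.sum_range]
    split_ifs <;> simp
  have h3 : ∀ X, ∏ p ∈ Finset.range (q + 1), initVal n (q + 1) x fix X (p * n + ext φ p) =
      (∏ p : Fin (q + 1), if fix p = 0 ∨ fix p = φ p + 1 then x (p * n + φ p) else 0) *
        ∏ p : Fin (q + 1), ∑ l : Fin (q + 1), ((X / 2 ^ (l : ℕ) % 2 : ℕ) : R) *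
          x ((q + 1) * n + φ p * (q + 1) + l) := by
    intro X
    rw [Finset.prod_range fun p => initVal n (q + 1) x fix X (p * n + ext φ p),
      ← Finset.prod_mul_distrib]
    exact Finset.prod_congr rfl fun p _ => h2 X p
  simp only [h3]
  rw [← Finset.mul_sum,
    sum_prod_sum_testBit fun p l : Fin (q + 1) => x ((q + 1) * n + φ p * (q + 1) + l)]
  split_ifs with h
  · congr 1
    rw [term]
    congr 1
    exact Finset.prod_congr rfl fun p _ => if_pos (h p)
  · simp only [Respects, not_forall] at h
    obtain ⟨p, hp'⟩ := h
    rw [Finset.prod_eq_zero (Finset.mem_univ p) (if_neg hp'), zero_mul, mul_zero]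


/-! ### Reading off the coefficients of the sieve polynomial -/

open Polynomial

/-- Kronecker substitution: if the coefficients of `P` are below `2 ^ S`, then the value of `P` at
`2 ^ S` consists of the coefficients, `S` bits each. -/
theorem testBit_eval {S : ℕ} : ∀ (j : ℕ) {r : ℕ} (P : ℕ[X]), (∀ i, P.coeff i < 2 ^ S) → r < S →
    (P.eval (2 ^ S)).testBit (S * j + r) = (P.coeff j).testBit r := by
  have key : ∀ P : ℕ[X], P.eval (2 ^ S) = 2 ^ S * P.divX.eval (2 ^ S) + P.coeff 0 := by
    intro P
    conv_lhs => rw [← P.divX_mul_X_add]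
    simp [mul_comm]
  intro j
  induction j with
  | zero =>
    intro r P hP hr
    rw [key, mul_zero, zero_add, Nat.testBit_two_pow_mul_add _ (hP 0), if_pos hr]
  | succ j ih =>
    intro r P hP hr
    rw [key, Nat.testBit_two_pow_mul_add _ (hP 0), if_neg (by rw [mul_add]; omega),
      show S * (j + 1) + r - S = S * j + r by rw [mul_add]; omega,
      ih P.divX (fun i => by rw [coeff_divX]; exact hP _) hr, coeff_divX]

theorem testBit_maskVal {S J m : ℕ} (hS : 1 ≤ S) :
    (maskVal S J).testBit m = true ↔ ∃ j < J, m = S * j := by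
  have h1 : maskVal S J = (∑ j ∈ Finset.range J, (X : ℕ[X]) ^ j).eval (2 ^ S) := by
    rw [maskVal, pow_mul, ← Nat.geomSum_eq (m := 2 ^ S)
      (by calc 2 = 2 ^ 1 := rfl
          _ ≤ 2 ^ S := Nat.pow_le_pow_right (by norm_num) hS)]
    simp [eval_finsetSum]
  have h2 : ∀ i, (∑ j ∈ Finset.range J, (X : ℕ[X]) ^ j).coeff i = if i < J then 1 else 0 := by
    intro i
    simp [finsetSum_coeff, coeff_X_pow]
  have h3 : m = S * (m / S) + m % S := (Nat.div_add_mod m S).symm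
  have h4 := Nat.mod_lt m hS
  rw [h1, h3, testBit_eval _ _ _ h4, h2]
  · constructor
    · intro h
      split_ifs at h with h5
      · refine ⟨m / S, h5, ?_⟩
        have : m % S = 0 := by
          by_contra hne
          rw [Nat.testBit_one_eq_true_iff_self_eq_zero] at h
          exact hne h
        rw [this, add_zero]
      · simp at h
    · rintro ⟨j, hj, h⟩
      have h5 : m / S = j := by rw [← h3] at h; rw [h, Nat.mul_div_cancel_left _ hS]
      have h6 : m % S = 0 := by rw [← h3] at h; rw [h, Nat.mul_mod_right]
      rw [if_pos (by omega), h6]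
      rfl
  · intro i
    rw [h2]
    have : 1 < 2 ^ S := Nat.one_lt_two_pow (by omega)
    split_ifs <;> omega

/-- The edge factors as polynomials: the exponent of the variable encodes the weight. -/
noncomputable def polyEdge (R : Type*) [CommSemiring R] (D : ℕ) (a r : ℕ → ℕ → ℕ) (v u : ℕ) :
    R[X] := (a v u : R[X]) * X ^ (r v u * D)

/-- The polynomial that the sieve evaluates at a power of two. -/
noncomputable def sievePoly (R : Type*) [CommSemiring R] (n k d D : ℕ) (par : ℕ → ℕ)
    (a r : ℕ → ℕ → ℕ) (ω : ℕ → Bool) (fix : ℕ → ℕ) : R[X] :=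
  sieveSum n k par (polyEdge R D a r) (label X d ω) fix

theorem sieveSum_eq_eval {n k d D S : ℕ} {par : ℕ → ℕ} {a r : ℕ → ℕ → ℕ} {ω : ℕ → Bool}
    {fix : ℕ → ℕ} : sieveSum n k par (edgeVal D S a r) (label (2 ^ S : ℤ) d ω) fix =
      ((sievePoly ℕ n k d D par a r ω fix).eval (2 ^ S) : ℕ) := by
  have h := sieveSum_map ((Nat.castRingHom ℤ).comp (evalRingHom (2 ^ S : ℕ))) (n := n) (k := k)
    (par := par) (fix := fix) (E := polyEdge ℕ D a r) (x := label X d ω)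
  rw [sievePoly]
  simp only [RingHom.comp_apply, coe_evalRingHom, Nat.coe_castRingHom] at h
  rw [h]
  congr 1
  · funext v u
    simp [polyEdge, edgeVal, pow_mul, pow_right_comm, mul_comm]
  · funext m
    have := label_map ((Nat.castRingHom ℤ).comp (evalRingHom (2 ^ S : ℕ))) X d ω m
    simp only [RingHom.comp_apply, coe_evalRingHom, Nat.coe_castRingHom, eval_X] at this
    rw [this]
    simp

theorem sieveNat_eq_eval {n k d D S : ℕ} {par : ℕ → ℕ} {a r : ℕ → ℕ → ℕ} {ω : ℕ → Bool}
    {fix : ℕ → ℕ} : sieveNat n k D S par a r (label (2 ^ S : ℤ) d ω) fix =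
      (sievePoly ℕ n k d D par a r ω fix).eval (2 ^ S) := by
  rw [sieveNat, sieveSum_eq_eval, Int.toNat_natCast]

theorem horner_one_bounds (c : ℕ → Bool) :
    ∀ j : ℕ, 0 ≤ horner (1 : ℤ) (fun i => coinVal ℤ (c i)) j ∧
      horner (1 : ℤ) (fun i => coinVal ℤ (c i)) j ≤ j
  | 0 => by simp [horner]
  | j + 1 => by
    obtain ⟨h1, h2⟩ := horner_one_bounds c j
    have h3 : 0 ≤ coinVal ℤ (c j) ∧ coinVal ℤ (c j) ≤ 1 := by unfold coinVal; split_ifs <;> simp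
    rw [horner]
    push_cast
    constructor <;> linarith [h3.1, h3.2]

/-- The number of bits that hold a coefficient of the sieve polynomial. -/
def slotBits (k b d : ℕ) : ℕ := k * (2 * d + k + b + 1) + b + k

/-- The coefficients are bounded by the value of the polynomial at `1`. -/
theorem coeff_sievePoly_lt {n k b d D : ℕ} {par : ℕ → ℕ} {a r : ℕ → ℕ → ℕ} {ω : ℕ → Bool}
    {fix : ℕ → ℕ} (hn : n ≤ 2 ^ b) (hk : 1 ≤ k) (ha : ∀ v < n, ∀ u < n, a v u ≤ 1)
    (hp : ∀ p, 0 < p → p < k → par p < p) (i : ℕ) :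
    (sievePoly ℕ n k d D par a r ω fix).coeff i < 2 ^ slotBits k b d := by
  have h := sieveSum_map ((Nat.castRingHom ℤ).comp (evalRingHom (1 : ℕ))) (n := n) (k := k)
    (par := par) (fix := fix) (E := polyEdge ℕ D a r) (x := label X d ω)
  have hb := sieveSum_bounds (n := n) (k := k) (b := b) (ee := 1) (ex := d) (par := par)
    (fix := fix)
    (E := fun v u => ((Nat.castRingHom ℤ).comp (evalRingHom (1 : ℕ))) (polyEdge ℕ D a r v u))
    (x := fun m => ((Nat.castRingHom ℤ).comp (evalRingHom (1 : ℕ))) (label X d ω m)) hn hk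
    (fun v hv u hu => by
      have : (a v u : ℤ) ≤ 1 := by exact_mod_cast ha v hv u hu
      simp only [RingHom.comp_apply, coe_evalRingHom, polyEdge, eval_mul, eval_natCast, eval_pow,
        eval_X, one_pow, mul_one, Nat.coe_castRingHom, Nat.cast_id]
      exact ⟨by positivity, by norm_num; omega⟩) hp
    (fun m _ => by
      rw [label_map]
      have h1 := horner_one_bounds (fun j => ω (m * d + j)) d
      have h2 : (d : ℤ) < 2 ^ d := by exact_mod_cast Nat.lt_two_pow_self
      simp only [RingHom.comp_apply, coe_evalRingHom, eval_X, map_one, label]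
      exact ⟨h1.1, h1.2.trans_lt h2⟩)
  rw [← h] at hb
  have h1 : (sievePoly ℕ n k d D par a r ω fix).eval 1 < 2 ^ slotBits k b d := by
    have := hb.2
    simp only [RingHom.comp_apply, coe_evalRingHom, Nat.coe_castRingHom] at this
    unfold slotBits
    exact_mod_cast this
  refine lt_of_le_of_lt ?_ h1
  rw [eval_eq_sum_range]
  simp only [one_pow, mul_one]
  by_cases hi : i ≤ (sievePoly ℕ n k d D par a r ω fix).natDegree
  · exact Finset.single_le_sum (f := fun i => (sievePoly ℕ n k d D par a r ω fix).coeff i)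
      (fun _ _ => Nat.zero_le _) (Finset.mem_range.2 (Nat.lt_succ_of_le hi))
  · rw [coeff_eq_zero_of_natDegree_lt (by omega)]
    exact Nat.zero_le _

/-- The bits of the integer computed by the sieve at the multiples of the slot length are the
coefficients of the sieve polynomial modulo two. -/
theorem testBit_sieveNat {n k b d D : ℕ} {par : ℕ → ℕ} {a r : ℕ → ℕ → ℕ} {ω : ℕ → Bool}
    {fix : ℕ → ℕ} (hn : n ≤ 2 ^ b) (hk : 1 ≤ k) (ha : ∀ v < n, ∀ u < n, a v u ≤ 1)
    (hp : ∀ p, 0 < p → p < k → par p < p) (j : ℕ) :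
    (sieveNat n k D (slotBits k b d) par a r (label (2 ^ slotBits k b d : ℤ) d ω) fix).testBit
      (slotBits k b d * j) = true ↔ (sievePoly (ZMod 2) n k d D par a r ω fix).coeff j ≠ 0 := by
  have hS : 0 < slotBits k b d := by unfold slotBits; omega
  have h := testBit_eval j (sievePoly ℕ n k d D par a r ω fix)
    (coeff_sievePoly_lt hn hk ha hp) hS
  rw [add_zero] at h
  have h2 : (sievePoly ℕ n k d D par a r ω fix).map (Nat.castRingHom (ZMod 2)) =
      sievePoly (ZMod 2) n k d D par a r ω fix := by
    have := sieveSum_map (mapRingHom (Nat.castRingHom (ZMod 2))) (n := n) (k := k)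
      (par := par) (fix := fix) (E := polyEdge ℕ D a r) (x := label X d ω)
    simp only [coe_mapRingHom] at this
    rw [sievePoly, this, sievePoly]
    congr 1
    · funext v u
      simp [polyEdge]
    · funext m
      have := label_map (mapRingHom (Nat.castRingHom (ZMod 2))) X d ω m
      simpa using this
  rw [sieveNat_eq_eval, h, ← h2, coeff_map, Nat.testBit_zero, eq_natCast, ne_eq,
    ZMod.natCast_eq_zero_iff, decide_eq_true_eq]
  omega

/-- The map `φ` is an embedding of the tree, with parents `par`, into the graph with the adjacency
numbers `a`. -/
def IsEmb {k n : ℕ} (par : ℕ → ℕ) (a : ℕ → ℕ → ℕ) (φ : Fin k → Fin n) : Prop :=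
  Function.Injective φ ∧
    ∀ p < k - 1, a (ext φ (par (p + 1))) (ext φ (p + 1)) = 1

/-- The weight of an embedding. -/
def embWeight {k n : ℕ} (par : ℕ → ℕ) (r : ℕ → ℕ → ℕ) (φ : Fin k → Fin n) : ℕ :=
  ∑ p ∈ Finset.range (k - 1), r (ext φ (par (p + 1))) (ext φ (p + 1))

section
variable {n k b d D W : ℕ} {par : ℕ → ℕ} {a r : ℕ → ℕ → ℕ} {ω : ℕ → Bool} {fix : ℕ → ℕ}

theorem embWeight_le (hr : ∀ v < n, ∀ u < n, r v u ≤ W) (hp : ∀ p, 0 < p → p < k → par p < p)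
    (φ : Fin k → Fin n) : embWeight par r φ ≤ k * W := by
  have h1 : embWeight par r φ ≤ ∑ _p ∈ Finset.range (k - 1), W := by
    refine Finset.sum_le_sum fun p hp' => ?_
    have h2 := Finset.mem_range.1 hp'
    have h3 := hp (p + 1) (by omega) (by omega)
    exact hr _ (ext_lt φ (by omega)) _ (ext_lt φ (by omega))
  rw [Finset.sum_const, Finset.card_range, smul_eq_mul] at h1
  exact h1.trans (Nat.mul_le_mul_right _ (by omega))

open Classical in
/-- Modulo two, an embedding of weight `w` contributes its term, shifted by `w * D`. -/
theorem sievePoly_eq_sum (hk : 1 ≤ k) (hp : ∀ p, 0 < p → p < k → par p < p)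
    (ha : ∀ v < n, ∀ u < n, a v u ≤ 1) :
    sievePoly (ZMod 2) n k d D par a r ω fix =
      ∑ φ : Fin k → Fin n with Respects fix φ ∧ IsEmb par a φ,
        X ^ (embWeight par r φ * D) * term (label X d ω) φ := by
  rw [sievePoly, sieveSum_eq_sum_term hk hp, Finset.sum_filter]
  refine Finset.sum_congr rfl fun φ _ => ?_
  by_cases h1 : Respects fix φ
  · rw [if_pos h1]
    by_cases h2 : Function.Injective φ
    · simp only [polyEdge, Finset.prod_mul_distrib, Finset.prod_pow_eq_pow_sum, ← Finset.sum_mul]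
      split_ifs with h3
      · rw [Finset.prod_eq_one, one_mul]
        · rfl
        · intro p hp'
          rw [h3.2.2 p (Finset.mem_range.1 hp'), Nat.cast_one]
      · have h4 : ∃ p < k - 1, a (ext φ (par (p + 1))) (ext φ (p + 1)) ≠ 1 := by
          by_contra! h
          exact h3 ⟨h1, h2, h⟩
        obtain ⟨p, hp1, hp2⟩ := h4
        have h5 := hp (p + 1) (by omega) (by omega)
        have h6 := ha _ (ext_lt φ (p := par (p + 1)) (by omega)) _
          (ext_lt φ (p := p + 1) (by omega))
        rw [Finset.prod_eq_zero (Finset.mem_range.2 hp1), zero_mul, zero_mul]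
        rw [show a (ext φ (par (p + 1))) (ext φ (p + 1)) = 0 by omega, Nat.cast_zero]
    · rw [term_eq_zero _ h2, mul_zero, mul_zero, ite_self]
  · rw [if_neg h1, if_neg fun h => h1 h.1]

theorem natDegree_label_le (R : Type*) [CommRing R] [Nontrivial R] (m : ℕ) :
    (label (X : R[X]) d ω m).natDegree ≤ d - 1 := by
  unfold label
  have : ∀ (c : ℕ → Bool) (j : ℕ),
      (horner (X : R[X]) (fun i => coinVal R[X] (c i)) j).natDegree ≤ j - 1 := by
    intro c j
    induction j with
    | zero => simp [horner]
    | succ j ih =>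
      have h1 : (coinVal R[X] (c j)).natDegree = 0 := by unfold coinVal; split_ifs <;> simp
      rw [horner]
      rcases Nat.eq_zero_or_pos j with rfl | hj
      · simp [horner, h1]
      · refine (natDegree_add_le _ _).trans (max_le ?_ (by omega))
        refine natDegree_mul_le.trans ?_
        rw [natDegree_X]
        omega
  exact this _ d

theorem natDegree_term_lt (hk : 1 ≤ k) (hd : 1 ≤ d) (φ : Fin k → Fin n) :
    (term (label (X : (ZMod 2)[X]) d ω) φ).natDegree < 2 * k * d := by
  have h1 : (∏ p : Fin k, label (X : (ZMod 2)[X]) d ω (p * n + φ p)).natDegree ≤ k * (d - 1) := by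
    refine (natDegree_prod_le _ _).trans ?_
    refine (Finset.sum_le_sum fun p _ => natDegree_label_le (ZMod 2) _).trans ?_
    simp
  have h2 : (Matrix.of fun p l : Fin k =>
      label (X : (ZMod 2)[X]) d ω (k * n + φ p * k + l)).det.natDegree ≤ k * (d - 1) := by
    rw [det_eq_sum_perm]
    refine natDegree_sum_le_of_forall_le _ _ fun σ _ => ?_
    refine (natDegree_prod_le _ _).trans ?_
    refine (Finset.sum_le_sum fun p _ => natDegree_label_le (ZMod 2) _).trans ?_
    simp
  unfold term
  refine natDegree_mul_le.trans_lt ((add_le_add h1 h2).trans_lt ?_)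
  have : k * (d - 1) + k = k * d := by
    obtain ⟨e, rfl⟩ : ∃ e, d = e + 1 := ⟨d - 1, by omega⟩
    simp; ring
  nlinarith

open Classical in
/-- The coefficients with index `w * D + i`, `i < D`, belong to the embeddings of weight `w`. -/
theorem coeff_sievePoly (hk : 1 ≤ k) (hd : 1 ≤ d) (hp : ∀ p, 0 < p → p < k → par p < p)
    (ha : ∀ v < n, ∀ u < n, a v u ≤ 1) (w : ℕ) {i : ℕ} (hi : i < 2 * k * d) :
    (sievePoly (ZMod 2) n k d (2 * k * d) par a r ω fix).coeff (w * (2 * k * d) + i) =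
      (∑ φ : Fin k → Fin n with (Respects fix φ ∧ IsEmb par a φ) ∧ embWeight par r φ = w,
        term (label (X : (ZMod 2)[X]) d ω) φ).coeff i := by
  rw [sievePoly_eq_sum hk hp ha, finsetSum_coeff, finsetSum_coeff,
    ← Finset.filter_filter (fun φ => Respects fix φ ∧ IsEmb par a φ) (fun φ => embWeight par r φ = w),
    Finset.sum_filter (fun φ => embWeight par r φ = w)]
  refine Finset.sum_congr rfl fun φ _ => ?_
  rw [coeff_X_pow_mul']
  have h1 := natDegree_term_lt (ω := ω) hk hd φ
  rcases lt_trichotomy (embWeight par r φ) w with h | h | h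
  · rw [if_neg h.ne, if_pos, coeff_eq_zero_of_natDegree_lt]
    · have : (embWeight par r φ + 1) * (2 * k * d) ≤ w * (2 * k * d) :=
        Nat.mul_le_mul_right _ h
      rw [add_mul, one_mul] at this
      omega
    · have : embWeight par r φ * (2 * k * d) ≤ w * (2 * k * d) := Nat.mul_le_mul_right _ h.le
      omega
  · rw [if_pos h, h, if_pos (by omega), Nat.add_sub_cancel_left]
  · rw [if_neg h.ne', if_neg]
    have : (w + 1) * (2 * k * d) ≤ embWeight par r φ * (2 * k * d) := Nat.mul_le_mul_right _ h
    rw [add_mul, one_mul] at this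
    omega

/-- Self-reducibility: an odd coefficient stays odd for some choice of the image of a position that
is not fixed. -/
theorem exists_coeff_update_ne_zero (hk : 1 ≤ k) (hp : ∀ p, 0 < p → p < k → par p < p)
    (ha : ∀ v < n, ∀ u < n, a v u ≤ 1) {j p : ℕ} (hpk : p < k) (hfix : fix p = 0)
    (h : (sievePoly (ZMod 2) n k d D par a r ω fix).coeff j ≠ 0) :
    ∃ v < n, (sievePoly (ZMod 2) n k d D par a r ω (Function.update fix p (v + 1))).coeff j ≠ 0 := by
  classical
  have key : sievePoly (ZMod 2) n k d D par a r ω fix =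
      ∑ v : Fin n, sievePoly (ZMod 2) n k d D par a r ω (Function.update fix p (v + 1)) := by
    simp only [sievePoly_eq_sum hk hp ha, Finset.sum_filter]
    rw [Finset.sum_comm]
    refine Finset.sum_congr rfl fun φ _ => ?_
    have hR : ∀ v : Fin n, Respects (Function.update fix p (v + 1)) φ ↔
        Respects fix φ ∧ φ ⟨p, hpk⟩ = v := by
      intro v
      constructor
      · intro hv
        have h0 := hv ⟨p, hpk⟩
        simp only [Function.update_self] at h0
        refine ⟨fun q => ?_, Fin.ext (by omega)⟩
        by_cases hq : (q : ℕ) = p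
        · exact Or.inl (hq ▸ hfix)
        · have := hv q
          rwa [Function.update_of_ne hq] at this
      · rintro ⟨hv, rfl⟩ q
        by_cases hq : (q : ℕ) = p
        · right
          rw [hq, Function.update_self]
          congr 3
          exact Fin.ext hq.symm
        · rw [Function.update_of_ne hq]
          exact hv q
    simp only [hR]
    rw [Finset.sum_eq_single (φ ⟨p, hpk⟩)]
    · simp
    · intro v _ hv
      rw [if_neg]
      rintro ⟨⟨-, h⟩, -⟩
      exact hv h.symm
    · simp
  rw [key, finsetSum_coeff] at h
  obtain ⟨v, -, hv⟩ := Finset.exists_ne_zero_of_sum_ne_zero h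
  exact ⟨v, v.2, hv⟩

open Classical in
/-- The contributions of the embeddings of weight `w` do not cancel. -/
def Survives (n k d : ℕ) (par : ℕ → ℕ) (a r : ℕ → ℕ → ℕ) (ω : ℕ → Bool) (w : ℕ) : Prop :=
  ∑ φ : Fin k → Fin n with IsEmb par a φ ∧ embWeight par r φ = w,
    term (label (X : (ZMod 2)[X]) d ω) φ ≠ 0

/-- If there are embeddings, then the contributions of those of minimum weight do not cancel. -/
def Favorable (n k d : ℕ) (par : ℕ → ℕ) (a r : ℕ → ℕ → ℕ) (ω : ℕ → Bool) : Prop :=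
  ∀ φ : Fin k → Fin n, IsEmb par a φ →
    (∀ ψ : Fin k → Fin n, IsEmb par a ψ → embWeight par r φ ≤ embWeight par r ψ) →
      Survives n k d par a r ω (embWeight par r φ)

theorem exists_min_emb (h : ∃ φ : Fin k → Fin n, IsEmb par a φ) :
    ∃ φ : Fin k → Fin n, IsEmb par a φ ∧
      ∀ ψ : Fin k → Fin n, IsEmb par a ψ → embWeight par r φ ≤ embWeight par r ψ := by
  classical
  obtain ⟨φ₀, h₀⟩ := h
  obtain ⟨φ, h1, h2⟩ := Finset.exists_min_image
    (Finset.univ.filter fun φ : Fin k → Fin n => IsEmb par a φ) (embWeight par r)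
    ⟨φ₀, by simpa using h₀⟩
  exact ⟨φ, by simpa using h1, fun ψ hψ => h2 ψ (by simpa using hψ)⟩

/-- The terms have degree below `2 * k * d`, so the embeddings of minimum weight leave an odd
coefficient in the range of that weight. -/
theorem Favorable.exists_coeff (hf : Favorable n k d par a r ω) (hk : 1 ≤ k) (hd : 1 ≤ d)
    (hp : ∀ p, 0 < p → p < k → par p < p) (ha : ∀ v < n, ∀ u < n, a v u ≤ 1)
    {φ : Fin k → Fin n} (h1 : IsEmb par a φ)
    (h2 : ∀ ψ : Fin k → Fin n, IsEmb par a ψ → embWeight par r φ ≤ embWeight par r ψ) :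
    ∃ i < 2 * k * d, (sievePoly (ZMod 2) n k d (2 * k * d) par a r ω 0).coeff
      (embWeight par r φ * (2 * k * d) + i) ≠ 0 := by
  classical
  have h3 := hf φ h1 h2
  unfold Survives at h3
  set P := ∑ φ' : Fin k → Fin n with IsEmb par a φ' ∧ embWeight par r φ' = embWeight par r φ,
    term (label (X : (ZMod 2)[X]) d ω) φ' with hP
  have hdeg : P.natDegree ≤ 2 * k * d - 1 :=
    natDegree_sum_le_of_forall_le _ _ fun φ' _ => by
      have := natDegree_term_lt (ω := ω) hk hd φ'
      omega
  have hpos : 0 < 2 * k * d := by positivity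
  refine ⟨P.natDegree, by omega, ?_⟩
  rw [coeff_sievePoly hk hd hp ha _ (by omega)]
  have : (Finset.univ.filter fun φ' : Fin k → Fin n =>
      (Respects 0 φ' ∧ IsEmb par a φ') ∧ embWeight par r φ' = embWeight par r φ) =
      Finset.univ.filter fun φ' : Fin k → Fin n =>
        IsEmb par a φ' ∧ embWeight par r φ' = embWeight par r φ := by
    ext φ'
    simp [Respects]
  rw [this, ← hP]
  exact leadingCoeff_ne_zero.2 h3

theorem exists_emb_of_coeff (hk : 1 ≤ k) (hd : 1 ≤ d)
    (hp : ∀ p, 0 < p → p < k → par p < p) (ha : ∀ v < n, ∀ u < n, a v u ≤ 1) {j : ℕ}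
    (h : (sievePoly (ZMod 2) n k d (2 * k * d) par a r ω fix).coeff j ≠ 0) :
    ∃ φ : Fin k → Fin n, Respects fix φ ∧ IsEmb par a φ ∧
      embWeight par r φ = j / (2 * k * d) := by
  classical
  have hpos : 0 < 2 * k * d := by positivity
  rw [← Nat.div_add_mod' j (2 * k * d), coeff_sievePoly hk hd hp ha _ (Nat.mod_lt _ hpos),
    finsetSum_coeff] at h
  obtain ⟨φ, hφ, -⟩ := Finset.exists_ne_zero_of_sum_ne_zero h
  simp only [Finset.mem_filter, Finset.mem_univ, true_and] at hφ
  exact ⟨φ, hφ.1.1, hφ.1.2, hφ.2⟩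

/-- The parities kept by `detectProg` vanish exactly if there are no embeddings. -/
theorem detect_eq_zero_iff {J : ℕ} (hf : Favorable n k d par a r ω) (hk : 1 ≤ k) (hd : 1 ≤ d)
    (hn : n ≤ 2 ^ b) (hp : ∀ p, 0 < p → p < k → par p < p) (ha : ∀ v < n, ∀ u < n, a v u ≤ 1)
    (hr : ∀ v < n, ∀ u < n, r v u ≤ W) (hJ : (k * W + 1) * (2 * k * d) ≤ J) :
    sieveNat n k (2 * k * d) (slotBits k b d) par a r (label (2 ^ slotBits k b d : ℤ) d ω) 0 &&&
      maskVal (slotBits k b d) J = 0 ↔ ¬ ∃ φ : Fin k → Fin n, IsEmb par a φ := by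
  have hS : 1 ≤ slotBits k b d := by unfold slotBits; omega
  constructor
  · rintro h hex
    obtain ⟨φ, h1, h2⟩ := exists_min_emb (r := r) hex
    obtain ⟨i, hi, hc⟩ := hf.exists_coeff hk hd hp ha h1 h2
    rw [← testBit_sieveNat hn hk ha hp] at hc
    have h3 := congrArg (fun q => q.testBit
      (slotBits k b d * (embWeight par r φ * (2 * k * d) + i))) h
    simp only [Nat.testBit_and, hc, Bool.true_and, Nat.zero_testBit] at h3
    have h4 := (testBit_maskVal (J := J) hS).2 ⟨embWeight par r φ * (2 * k * d) + i, by
      have := Nat.mul_le_mul_right (2 * k * d) (embWeight_le hr hp φ)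
      rw [add_mul, one_mul] at hJ
      omega, rfl⟩
    rw [h4] at h3
    exact absurd h3 (by simp)
  · intro hex
    by_contra hne
    obtain ⟨m, hm⟩ := Nat.exists_testBit_of_ne_zero hne
    rw [Nat.testBit_and, Bool.and_eq_true, testBit_maskVal hS] at hm
    obtain ⟨h1, j, -, rfl⟩ := hm
    rw [testBit_sieveNat hn hk ha hp] at h1
    obtain ⟨φ, -, h2, -⟩ := exists_emb_of_coeff hk hd hp ha h1
    exact hex ⟨φ, h2⟩

end


/-! ### Correctness of the search -/

open Polynomial

section
variable {n k b d W : ℕ} {par ord : ℕ → ℕ} {a r : ℕ → ℕ → ℕ} {ω : ℕ → Bool}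

/-- If the contributions of the lightest embeddings do not cancel, then `coreProg` finds one of
them. -/
theorem ok_coreProg_favorable {β : ℕ} {s : State} {S J : ℕ} (hS : S = slotBits k b d)
    (hs : Instance s n k b (S * d) (2 * k * d) S W par a r (label (2 ^ S : ℤ) d ω))
    (hd : 1 ≤ d) (hJ : s.int vNSLOTS 0 = J) (hJW : (k * W + 1) * (2 * k * d) ≤ J)
    (hfix : ∀ p < k, s.int aFIX p = 0) (hord : ∀ p < k, s.int aORD p = ord p)
    (hinj : ∀ p < k, ∀ q < k, ord p = ord q → p = q)
    (hβ : k * (2 * (S * d) + k + b + (W * (2 * k * d) * S + 1)) + b + k + 2 ≤ β)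
    (hβJ : S * J + 2 ≤ β) (hβS : S + 2 ≤ β) (hβn : bits (n * n : ℕ) ≤ β) :
    Ok β coreProg s (coreSteps n k) fun s' => Favorable n k d par a r ω →
      ((¬ ∃ φ : Fin k → Fin n, IsEmb par a φ) ∧ s'.int 4 = s.int 4) ∨
      ∃ φ : Fin k → Fin n, IsEmb par a φ ∧
        (∀ ψ : Fin k → Fin n, IsEmb par a ψ → embWeight par r φ ≤ embWeight par r ψ) ∧
        s'.int 4 0 = 1 ∧ ∀ p : Fin k, s'.int 4 (ord p + 1 : ℕ) = (φ p : ℕ) := by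
  have hk := hs.k_pos
  have hp : ∀ p, 0 < p → p < k → par p < p := fun p h1 h2 => (hs.par_eq p h1 h2).1
  have ha : ∀ v < n, ∀ u < n, a v u ≤ 1 := fun v hv u hu => (hs.adj_eq v hv u hu).2
  have hr : ∀ v < n, ∀ u < n, r v u ≤ W := fun v hv u hu => (hs.wt_eq v hv u hu).2
  have hS1 : 1 ≤ slotBits k b d := by unfold slotBits; omega
  subst hS
  refine (ok_coreProg hs hJ hfix hord hinj ?_ hβ hβJ hβS hβn).mono le_rfl ?_
  · intro m fix p hm hpk hfp h
    obtain ⟨j, -, rfl⟩ := (testBit_maskVal hS1).1 hm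
    rw [testBit_sieveNat hs.n_le hk ha hp] at h
    obtain ⟨v, hv, h2⟩ := exists_coeff_update_ne_zero hk hp ha hpk hfp h
    exact ⟨v, hv, (testBit_sieveNat hs.n_le hk ha hp _).2 h2⟩
  · rintro s' - (⟨h1, h2⟩ | ⟨m, hm, hmin, φ, hφn, ⟨fix, hfixφ, hbit⟩, h0, hout⟩) hf
    · exact Or.inl ⟨(detect_eq_zero_iff hf hk hd hs.n_le hp ha hr hJW).1 h1, h2⟩
    · rw [Nat.testBit_and, Bool.and_eq_true, testBit_maskVal hS1] at hm
      obtain ⟨-, j, hj, rfl⟩ := hm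
      rw [testBit_sieveNat hs.n_le hk ha hp] at hbit
      obtain ⟨φ', hres, hemb, hw⟩ := exists_emb_of_coeff hk hd hp ha hbit
      have hφ' : ∀ p : Fin k, (φ' p : ℕ) = φ p := by
        intro p
        have h3 := hfixφ p p.2
        have h4 := hres p
        omega
      refine Or.inr ⟨φ', hemb, fun ψ hψ => ?_, h0, fun p => by rw [hout p p.2, hφ']⟩
      -- the set bit is the lowest one, and the lightest embeddings set a bit in their own range
      obtain ⟨φ₀, h1, h2⟩ := exists_min_emb (r := r) ⟨ψ, hψ⟩
      obtain ⟨i, hi, hc⟩ := hf.exists_coeff hk hd hp ha h1 h2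
      rw [← testBit_sieveNat hs.n_le hk ha hp] at hc
      refine le_trans ?_ (h2 ψ hψ)
      rw [hw]
      by_contra! hlt
      have h5 : (embWeight par r φ₀ + 1) * (2 * k * d) ≤ j :=
        (Nat.mul_le_mul_right _ hlt).trans (Nat.div_mul_le_self _ _)
      rw [add_mul, one_mul] at h5
      have h6 := hmin (slotBits k b d * (embWeight par r φ₀ * (2 * k * d) + i))
        ((Nat.mul_lt_mul_left hS1).2 (by omega))
      rw [Nat.testBit_and, hc, Bool.true_and] at h6
      rw [(testBit_maskVal hS1).2 ⟨_, by omega, rfl⟩] at h6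
      exact absurd h6 (by simp)

end


/-! ### The probability that contributions cancel -/

open Polynomial

theorem horner_coin_injective (c c' : ℕ → Bool) :
    ∀ j : ℕ, horner (X : (ZMod 2)[X]) (fun i => coinVal _ (c i)) j =
      horner (X : (ZMod 2)[X]) (fun i => coinVal _ (c' i)) j → ∀ i < j, c i = c' i
  | 0, _, i, hi => absurd hi (by omega)
  | j + 1, h, i, hi => by
    simp only [horner] at h
    have h0 : c j = c' j := by
      have := congrArg (fun P => coeff P 0) h
      simp only [coeff_add, mul_coeff_zero, coeff_X_zero, mul_zero, zero_add] at this
      unfold coinVal at this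
      by_contra hne
      cases hc : c j <;> cases hc' : c' j <;> simp_all
    rw [h0, add_left_inj] at h
    have h1 := horner_coin_injective c c' j (mul_right_cancel₀ X_ne_zero h)
    rcases Nat.lt_succ_iff_lt_or_eq.1 hi with h2 | rfl
    · exact h1 i h2
    · exact h0

/-- The polynomial with the given bits as coefficients. -/
noncomputable def bitsPoly {d : ℕ} (c : Fin d → Bool) : (ZMod 2)[X] :=
  horner X (fun j => coinVal _ (if h : j < d then c ⟨j, h⟩ else false)) d

theorem bitsPoly_injective (d : ℕ) : Function.Injective (bitsPoly (d := d)) := by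
  intro c c' h
  funext i
  have := horner_coin_injective _ _ d h i i.2
  simpa using this

theorem bitsPoly_coins (d : ℕ) (ω : ℕ → Bool) (m : ℕ) :
    bitsPoly (fun j : Fin d => ω (m * d + j)) = label X d ω m := by
  unfold bitsPoly label
  have : ∀ (c c' : ℕ → (ZMod 2)[X]) (j : ℕ), (∀ i < j, c i = c' i) →
      horner (X : (ZMod 2)[X]) c j = horner X c' j := by
    intro c c' j
    induction j with
    | zero => simp [horner]
    | succ j ih =>
      intro h
      rw [horner, horner, ih fun i hi => h i (by omega), h j (by omega)]
  exact this _ _ _ fun i hi => by simp [hi]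

/-- The contribution of a set of maps, as a polynomial in the labels. -/
noncomputable def mvContribution {k n : ℕ} (N : ℕ) (Φ : Finset (Fin k → Fin n)) :
    MvPolynomial (Fin N) (ZMod 2)[X] :=
  ∑ φ ∈ Φ, term (fun m => if h : m < N then MvPolynomial.X ⟨m, h⟩ else 0) φ

theorem eval_mvContribution {k n N : ℕ} (Φ : Finset (Fin k → Fin n)) (f : Fin N → (ZMod 2)[X]) :
    MvPolynomial.eval f (mvContribution N Φ) =
      ∑ φ ∈ Φ, term (fun m => if h : m < N then f ⟨m, h⟩ else 0) φ := by
  rw [mvContribution, map_sum]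
  refine Finset.sum_congr rfl fun φ _ => ?_
  rw [term_map]
  congr 1
  funext m
  split_ifs <;> simp

/-- Every term is a product of `k` labels and a determinant of order `k` in the labels. -/
theorem totalDegree_mvContribution_le {k n N : ℕ} (Φ : Finset (Fin k → Fin n)) :
    (mvContribution N Φ).totalDegree ≤ 2 * k := by
  have h0 : ∀ m, (if h : m < N then (MvPolynomial.X ⟨m, h⟩ : MvPolynomial (Fin N) (ZMod 2)[X])
      else 0).totalDegree ≤ 1 := by
    intro m
    split_ifs
    · rw [MvPolynomial.totalDegree_X]
    · simp
  have h1 : ∀ g : Fin k → ℕ, (∏ p : Fin k, (if h : g p < N then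
      (MvPolynomial.X ⟨g p, h⟩ : MvPolynomial (Fin N) (ZMod 2)[X]) else 0)).totalDegree ≤ k := by
    intro g
    refine (MvPolynomial.totalDegree_finsetProd _ _).trans ?_
    refine (Finset.sum_le_sum fun p _ => h0 (g p)).trans ?_
    simp
  refine MvPolynomial.totalDegree_finsetSum_le fun φ _ => ?_
  refine (MvPolynomial.totalDegree_mul _ _).trans ?_
  rw [two_mul]
  refine add_le_add (h1 fun p => p * n + φ p) ?_
  rw [det_eq_sum_perm]
  refine MvPolynomial.totalDegree_finsetSum_le fun σ _ => ?_
  exact h1 fun p => k * n + φ (σ p) * k + p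

/-- Under the labels that are the indicators of the values of the injective map `φ₀`, only `φ₀`
contributes. -/
theorem mvContribution_ne_zero {k n N : ℕ} (hN : 2 * k * n ≤ N) {Φ : Finset (Fin k → Fin n)}
    {φ₀ : Fin k → Fin n} (h₀ : φ₀ ∈ Φ) (hinj : Function.Injective φ₀) :
    mvContribution N Φ ≠ 0 := by
  intro h
  let x : ℕ → (ZMod 2)[X] := fun m => if m < k * n then (if ext φ₀ (m / n) = m % n then 1 else 0)
    else (if ext φ₀ ((m - k * n) % k) = (m - k * n) / k then 1 else 0)
  have h1 : ∀ φ : Fin k → Fin n, ∀ p : Fin k, x (p * n + φ p) = if φ₀ p = φ p then 1 else 0 := by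
    intro φ p
    simp only [x]
    rw [if_pos (cell_lt p.2 (φ p).2), cell_div (φ p).2, cell_mod (φ p).2, ext_apply]
    simp only [Fin.ext_iff]
  have h2 : ∀ φ : Fin k → Fin n, ∀ p l : Fin k, x (k * n + φ p * k + l) =
      if φ₀ l = φ p then 1 else 0 := by
    intro φ p l
    simp only [x]
    rw [if_neg (by omega), show k * n + (φ p : ℕ) * k + l - k * n = φ p * k + l by omega,
      cell_div l.2, cell_mod l.2, ext_apply]
    simp only [Fin.ext_iff]
  have h3 : ∀ φ ∈ Φ, φ ≠ φ₀ → term x φ = 0 := by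
    intro φ _ hne
    obtain ⟨p, hp⟩ := Function.ne_iff.1 hne
    rw [term, Finset.prod_eq_zero (Finset.mem_univ p), zero_mul]
    rw [h1, if_neg (Ne.symm hp)]
  have h4 : term x φ₀ = 1 := by
    have : (Matrix.of fun p l : Fin k => x (k * n + φ₀ p * k + l)) = 1 := by
      ext1 p l
      rw [Matrix.of_apply, h2, Matrix.one_apply]
      simp only [hinj.eq_iff, eq_comm]
    rw [term, this, Matrix.det_one, mul_one]
    exact Finset.prod_eq_one fun p _ => by rw [h1, if_pos rfl]
  have h5 := eval_mvContribution Φ (fun m : Fin N => x m)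
  rw [h, map_zero] at h5
  have h6 : ∀ φ : Fin k → Fin n, term (fun m => if _h : m < N then x m else 0) φ = term x φ :=
    fun φ => term_congr (fun m hm => by simp [show m < N by omega]) φ
  simp only [h6] at h5
  rw [Finset.sum_eq_single φ₀ h3 (fun h => absurd h₀ h), h4] at h5
  exact zero_ne_one h5

/-- The Schwartz–Zippel lemma with the `2 ^ d` polynomials of degree less than `d` as sample points:
at most a fraction `2k / 2 ^ d` of the choices of the coins are roots. -/
theorem card_bits_mvContribution {k n N d : ℕ} (hN : 2 * k * n ≤ N) {Φ : Finset (Fin k → Fin n)}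
    {φ₀ : Fin k → Fin n} (h₀ : φ₀ ∈ Φ) (hinj : Function.Injective φ₀)
    (B : Finset (Fin N → Fin d → Bool))
    (hB : ∀ g ∈ B, MvPolynomial.eval (fun m => bitsPoly (g m)) (mvContribution N Φ) = 0) :
    B.card * 2 ^ d ≤ 2 * k * 2 ^ (N * d) := by
  classical
  let S : Finset (ZMod 2)[X] := Finset.univ.image (bitsPoly (d := d))
  have hS : S.card = 2 ^ d := by
    rw [Finset.card_image_of_injective _ (bitsPoly_injective d)]
    simp
  have h1 := MvPolynomial.schwartz_zippel_totalDegree (mvContribution_ne_zero hN h₀ hinj) S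
  have h2 : B.card ≤ (Finset.filter (fun f => MvPolynomial.eval f (mvContribution N Φ) = 0)
      (Fintype.piFinset fun _ : Fin N => S)).card := by
    refine Finset.card_le_card_of_injOn (fun g m => bitsPoly (g m)) ?_ ?_
    · intro g hg
      simp only [Finset.coe_filter, Fintype.mem_piFinset, Set.mem_ofPred_eq]
      exact ⟨fun m => Finset.mem_image_of_mem _ (Finset.mem_univ _), hB g hg⟩
    · intro g _ g' _ h
      funext m
      exact bitsPoly_injective d (congrFun h m)
  rw [hS, div_le_div_iff₀ (by positivity) (by positivity)] at h1
  have h3 := totalDegree_mvContribution_le (N := N) Φ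
  have h4 : (Finset.filter (fun f => MvPolynomial.eval f (mvContribution N Φ) = 0)
      (Fintype.piFinset fun _ : Fin N => S)).card * 2 ^ d ≤
      (mvContribution N Φ).totalDegree * (2 ^ d) ^ N := by
    exact_mod_cast h1
  calc B.card * 2 ^ d ≤ _ := Nat.mul_le_mul_right _ h2
    _ ≤ _ := h4
    _ ≤ 2 * k * (2 ^ d) ^ N := Nat.mul_le_mul_right _ h3
    _ = _ := by rw [← pow_mul, mul_comm d]

/-- The probability of prescribed outcomes of the first `L` tosses. -/
theorem coinMeasure_cylinder {L : ℕ} (g : ℕ → Bool) :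
    coinMeasure {ω | ∀ i < L, ω i = g i} = (2 ^ L)⁻¹ := by
  have h : {ω : ℕ → Bool | ∀ i < L, ω i = g i} =
      Set.pi (Finset.range L : Set ℕ) fun i => {g i} := by
    ext ω
    simp [Set.mem_pi]
  rw [h, coinMeasure, Measure.infinitePi_pi _ fun _ _ => MeasurableSet.of_discrete]
  have h2 : ∀ c : Bool, (PMF.uniformOfFintype Bool).toMeasure {c} = 2⁻¹ := by
    intro c
    rw [PMF.toMeasure_uniformOfFintype_apply _ MeasurableSet.of_discrete]
    simp
  simp only [h2, Finset.prod_const, Finset.card_range]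
  rw [ENNReal.inv_pow]

/-- The contributions of a nonempty set of injective maps cancel with probability at most
`2k / 2 ^ d`, by the Schwartz–Zippel lemma over the polynomials modulo two. -/
theorem coinMeasure_sum_term_eq_zero_le {k n d : ℕ} {Φ : Finset (Fin k → Fin n)}
    {φ₀ : Fin k → Fin n} (h₀ : φ₀ ∈ Φ) (hinj : Function.Injective φ₀) :
    coinMeasure {ω | ∑ φ ∈ Φ, term (label (X : (ZMod 2)[X]) d ω) φ = 0} ≤
      ENNReal.ofReal (2 * k / 2 ^ d) := by
  classical
  set N := 2 * k * n with hN
  let B : Finset (Fin N → Fin d → Bool) := Finset.univ.filter fun g =>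
    MvPolynomial.eval (fun m => bitsPoly (g m)) (mvContribution N Φ) = 0
  have hsub : {ω | ∑ φ ∈ Φ, term (label (X : (ZMod 2)[X]) d ω) φ = 0} ⊆
      ⋃ g ∈ B, {ω | ∀ i < N * d, ω i =
        if h : i / d < N ∧ i % d < d then g ⟨i / d, h.1⟩ ⟨i % d, h.2⟩ else false} := by
    intro ω hω
    simp only [Set.mem_iUnion, Set.mem_ofPred_eq, exists_prop]
    refine ⟨fun m j => ω (m * d + j), ?_, fun i hi => ?_⟩
    · simp only [B, Finset.mem_filter, Finset.mem_univ, true_and]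
      rw [eval_mvContribution, ← (hω : _ = _)]
      refine Finset.sum_congr rfl fun φ _ => term_congr (fun m hm => ?_) φ
      rw [dif_pos hm, bitsPoly_coins]
    · have hd : 0 < d := by
        rcases Nat.eq_zero_or_pos d with rfl | h
        · omega
        · exact h
      rw [dif_pos ⟨Nat.div_lt_of_lt_mul (by rwa [mul_comm]), Nat.mod_lt _ hd⟩]
      change ω i = ω (i / d * d + i % d)
      rw [Nat.div_add_mod']
  have hcard := card_bits_mvContribution (d := d) hN.ge h₀ hinj B fun g hg => by
    simpa [B] using hg
  refine (measure_mono hsub).trans ((measure_biUnion_finset_le _ _).trans ?_)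
  simp only [coinMeasure_cylinder, Finset.sum_const, nsmul_eq_mul]
  have h1 : ((2 : ENNReal) ^ (N * d))⁻¹ = ENNReal.ofReal ((2 ^ (N * d))⁻¹) := by
    rw [ENNReal.ofReal_inv_of_pos (by positivity), ENNReal.ofReal_pow (by norm_num)]
    simp
  rw [h1, ← ENNReal.ofReal_natCast, ← ENNReal.ofReal_mul (by positivity)]
  refine ENNReal.ofReal_le_ofReal ?_
  rw [← div_eq_mul_inv, div_le_div_iff₀ (by positivity) (by positivity)]
  exact_mod_cast hcard

theorem coinMeasure_not_favorable_le {k n d : ℕ} {par : ℕ → ℕ} {a r : ℕ → ℕ → ℕ} :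
    coinMeasure {ω | ¬ Favorable n k d par a r ω} ≤ ENNReal.ofReal (2 * k / 2 ^ d) := by
  classical
  by_cases h : ∃ φ : Fin k → Fin n, IsEmb par a φ
  · obtain ⟨φ, h1, h2⟩ := exists_min_emb (r := r) h
    refine le_trans (measure_mono ?_) (coinMeasure_sum_term_eq_zero_le (n := n)
      (Φ := Finset.univ.filter fun φ' => IsEmb par a φ' ∧ embWeight par r φ' = embWeight par r φ)
      (φ₀ := φ) (by simp [h1]) h1.1)
    intro ω hω
    simp only [Favorable, Set.mem_ofPred_eq, not_forall] at hω
    obtain ⟨ψ, h3, h4, h5⟩ := hω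
    rw [(h4 φ h1).antisymm (h2 ψ h3), Survives, not_not] at h5
    simpa using h5
  · have : {ω | ¬ Favorable n k d par a r ω} = ∅ := by
      ext ω
      simp only [Set.mem_ofPred_eq, Set.mem_empty_iff_false, iff_false, not_not]
      intro φ h1
      exact absurd ⟨φ, h1⟩ h
    rw [this]
    simp

end MinWeightTree

namespace RandRAM

/-! ### Independence of the coins -/

section withCoins
variable (s : State) (ω : ℕ → Bool)

theorem IntExpr.eval_withCoins (e : IntExpr) : e.eval { s with coins := ω } = e.eval s := by
  induction e with
  | const c => rfl
  | read a i ih => simp only [IntExpr.eval, ih]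
  | op o e f ih1 ih2 => simp only [IntExpr.eval, ih1, ih2]

theorem IntExpr.cost_withCoins (e : IntExpr) : e.cost { s with coins := ω } = e.cost s := by
  induction e with
  | const c => rfl
  | read a i ih => simp only [IntExpr.cost, ih, eval_withCoins]
  | op o e f ih1 ih2 => simp only [IntExpr.cost, ih1, ih2, eval_withCoins]

theorem RealExpr.eval_withCoins (e : RealExpr) : e.eval { s with coins := ω } = e.eval s := by
  induction e with
  | ofInt e => simp only [RealExpr.eval, IntExpr.eval_withCoins]
  | read a i => simp only [RealExpr.eval, IntExpr.eval_withCoins]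
  | op o e f ih1 ih2 => simp only [RealExpr.eval, ih1, ih2]

theorem RealExpr.cost_withCoins (e : RealExpr) : e.cost { s with coins := ω } = e.cost s := by
  induction e with
  | ofInt e => simp only [RealExpr.cost, IntExpr.cost_withCoins]
  | read a i => simp only [RealExpr.cost, IntExpr.cost_withCoins]
  | op o e f ih1 ih2 => simp only [RealExpr.cost, ih1, ih2]

theorem Test.holds_withCoins (b : Test) : b.Holds { s with coins := ω } ↔ b.Holds s := by
  cases b <;> simp only [Test.Holds, IntExpr.eval_withCoins, RealExpr.eval_withCoins]

theorem Test.cost_withCoins (b : Test) : b.cost { s with coins := ω } = b.cost s := by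
  cases b <;> simp only [Test.cost, IntExpr.cost_withCoins, RealExpr.cost_withCoins]

end withCoins

/-- A program that tosses no coins computes the same for all sequences of coins. -/
theorem Runs.withCoins {p : Program} {s s' : State} {t : ℕ} (h : Runs p s t s')
    (hp : p.tosses = false) (ω : ℕ → Bool) :
    Runs p { s with coins := ω } t { s' with coins := ω } := by
  induction h with
  | skip s => exact .skip _
  | setInt a i v s =>
    have := Runs.setInt a i v { s with coins := ω }
    simp only [IntExpr.cost_withCoins, IntExpr.eval_withCoins] at this
    exact this
  | setReal a i v s =>
    have := Runs.setReal a i v { s with coins := ω }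
    simp only [IntExpr.cost_withCoins, RealExpr.cost_withCoins, IntExpr.eval_withCoins,
      RealExpr.eval_withCoins] at this
    exact this
  | toss a i s => simp [Program.tosses] at hp
  | seq _ _ ih1 ih2 =>
    simp only [Program.tosses, Bool.or_eq_false_iff] at hp
    exact .seq (ih1 hp.1) (ih2 hp.2)
  | @condTrue b _ _ s _ _ hb _ ih =>
    simp only [Program.tosses, Bool.or_eq_false_iff] at hp
    rw [← Test.cost_withCoins s ω b]
    exact .condTrue ((Test.holds_withCoins s ω b).2 hb) (ih hp.1)
  | @condFalse b _ _ s _ _ hb _ ih =>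
    simp only [Program.tosses, Bool.or_eq_false_iff] at hp
    rw [← Test.cost_withCoins s ω b]
    exact .condFalse (fun h => hb ((Test.holds_withCoins s ω b).1 h)) (ih hp.2)
  | @loopTrue b _ s _ _ _ _ hb _ _ ih1 ih2 =>
    rw [← Test.cost_withCoins s ω b]
    exact .loopTrue ((Test.holds_withCoins s ω b).2 hb) (ih1 hp) (ih2 hp)
  | @loopFalse b _ s hb =>
    rw [← Test.cost_withCoins s ω b]
    exact .loopFalse fun h => hb ((Test.holds_withCoins s ω b).1 h)

end RandRAM

namespace MinWeightTree

/-! ### Parameters and labels -/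

/-- The order found by `ordProg` does not depend on the coins. -/
theorem exists_order {β : ℕ} {s : State} {k : ℕ} {A : ℕ → ℕ → ℕ} (hs : MemBdd β s)
    (hk : s.int 0 1 = k) (hk1 : 1 ≤ k)
    (hA : ∀ u < k, ∀ v < k, s.int 1 (u * k + v : ℕ) = A u v ∧ A u v ≤ 1)
    (hconn : ∀ P : ℕ → Prop, P 0 → (∃ v < k, ¬ P v) →
      ∃ u < k, ∃ v < k, P u ∧ ¬ P v ∧ A u v = 1)
    (hM : ∀ v < k, s.int aMARK v = 0) (hO : s.int aORD 0 = 0) (hβ : k + 2 ≤ β) :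
    ∃ ord par : ℕ → ℕ, IsOrder k A ord par (k - 1) ∧
      ∀ ω, Ok β ordProg { s with coins := ω } (k * (k * (k * 6 + 4) + 10) + 10) fun s' =>
        (∀ p < k, s'.int aORD p = ord p) ∧ ∀ p, 0 < p → p < k → s'.int aPAR p = par p := by
  obtain ⟨t, s', hr, ht, hb, ord, par, h1, h2, h3⟩ := ok_ordProg hk hk1 hA hconn hM hO hβ hs
  exact ⟨ord, par, h1, fun ω _ => ⟨t, { s' with coins := ω }, hr.withCoins rfl ω, ht, hb, h2, h3⟩⟩

/-- Set the parameters and draw the labels. The degree `vD` of the labels is so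
large that contributions cancel with probability at most `1 / (n + 1) ^ c`; the variable `vBL` can
be used to increase it further. -/
def paramProg (c : ℕ) : Program :=
  logProg vB (.read 0 0 + 1) ;;
  .assign vD (.read 0 1 + .const c * .var vB + .var vBL) ;;
  .assign vSLOT (.read 0 1 * (2 * .var vD + .read 0 1 + .var vB + 1) + .var vB + .read 0 1) ;;
  .assign vDEG (2 * .read 0 1 * .var vD) ;;
  tossProg

/-- A bound for the number of steps of `paramProg`. -/
def paramSteps (n k b d : ℕ) : ℕ :=
  2 * b + 2 * k * n * (d * 4 + 6) + 7

/-- The memory contents established by `ordProg` and `paramProg`. -/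
structure Ready (s : State) (n k b d : ℕ) (A : ℕ → ℕ → ℕ) (ord par : ℕ → ℕ) (ω : ℕ → Bool) :
    Prop where
  n_eq : s.int 0 0 = n
  k_eq : s.int 0 1 = k
  isOrder : IsOrder k A ord par (k - 1)
  ord_eq : ∀ p < k, s.int aORD p = ord p
  par_eq : ∀ p, 0 < p → p < k → s.int aPAR p = par p
  deg_eq : s.int vDEG 0 = (2 * k * d : ℕ)
  slot_eq : s.int vSLOT 0 = slotBits k b d
  label_eq : ∀ m < 2 * k * n, s.int aXZ m = label (2 ^ slotBits k b d : ℤ) d ω m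

theorem Ready.congr {s s' : State} {n k b d : ℕ} {A : ℕ → ℕ → ℕ} {ord par : ℕ → ℕ}
    {ω : ℕ → Bool} (h : Ready s n k b d A ord par ω) (h0 : s'.int 0 = s.int 0)
    (h1 : s'.int aORD = s.int aORD) (h2 : s'.int aPAR = s.int aPAR)
    (h3 : s'.int vDEG = s.int vDEG) (h4 : s'.int vSLOT = s.int vSLOT)
    (h5 : s'.int aXZ = s.int aXZ) : Ready s' n k b d A ord par ω := by
  obtain ⟨e1, e2, e3, e4, e5, e6, e7, e8⟩ := h
  exact ⟨h0 ▸ e1, h0 ▸ e2, e3, h1 ▸ e4, h2 ▸ e5, h3 ▸ e6, h4 ▸ e7, h5 ▸ e8⟩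

theorem two_mul_le_two_pow {k : ℕ} (hk : 1 ≤ k) : 2 * k ≤ 2 ^ k := by
  obtain ⟨q, rfl⟩ : ∃ q, k = q + 1 := ⟨k - 1, by omega⟩
  have := Nat.lt_two_pow_self (n := q)
  rw [pow_succ]
  omega

theorem slotBits_ge {k b d : ℕ} (hk : 1 ≤ k) : 2 * k * d + 2 * k + 2 * b ≤ slotBits k b d := by
  unfold slotBits
  have h1 : k * 1 ≤ k * k := Nat.mul_le_mul_left k hk
  have h2 : 1 * b ≤ k * b := Nat.mul_le_mul_right b hk
  have : k * (2 * d + k + b + 1) = 2 * k * d + k * k + k * b + k := by ring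
  omega

theorem ok_paramProg {β : ℕ} {s : State} {n k c bL : ℕ} {A : ℕ → ℕ → ℕ} {ord par : ℕ → ℕ}
    (hn : s.int 0 0 = n) (hk : s.int 0 1 = k) (hk1 : 1 ≤ k) (hord : IsOrder k A ord par (k - 1))
    (hO : ∀ p < k, s.int aORD p = ord p) (hP : ∀ p, 0 < p → p < k → s.int aPAR p = par p)
    (hBL : s.int vBL 0 = bL) {b d : ℕ} (hb : b = Nat.clog 2 (n + 1)) (hd : d = k + c * b + bL)
    (hβ : slotBits k b d * d + slotBits k b d + 2 ≤ β) :
    Ok β (paramProg c) s (paramSteps n k b d) fun s' => Ready s' n k b d A ord par s.coins := by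
  have hS := slotBits_ge (b := b) (d := d) hk1
  have hkd : 1 * d ≤ k * d := Nat.mul_le_mul_right d hk1
  have hkd' : 2 * k * d = 2 * (k * d) := by ring
  have hnb : n + 1 ≤ 2 ^ b := by rw [hb]; exact Nat.le_pow_clog (by norm_num) _
  have hbits : bits (2 * k * n : ℕ) ≤ β := by
    refine (bits_le_of_lt (m := k + b) (by positivity) ?_).trans (by omega)
    rw [pow_add]
    have := two_mul_le_two_pow hk1
    have h2 : 2 * k * n < 2 ^ k * 2 ^ b :=
      lt_of_le_of_lt (Nat.mul_le_mul_right _ this)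
        (Nat.mul_lt_mul_of_pos_left (by omega) (by positivity))
    exact_mod_cast h2
  refine ok_seq (R := fun t => t.int vB 0 = b) (2 * b + 2) (2 * k * n * (d * 4 + 6) + 5)
    (by unfold paramSteps; omega) ((ok_logProg (N := n + 1) ?_ (by omega)).mono (by omega)
      fun t _ ht => by rw [ht, hb]) ?_
  · intro t ht
    rw [IntExpr.eval_add, IntExpr.eval_read, IntExpr.eval_zero, ht 0 (by decide), hn]
    simp
  intro s₂ hf₂ hB₂
  have e2 : s₂.int 0 = s.int 0 := hf₂.int 0 (by decide)
  have c2 : s₂.coins = s.coins := hf₂.coins (by decide)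
  have hBL₂ : s₂.int vBL 0 = bL := by
    rw [hf₂.int vBL (by decide), hBL]
  have v2 : (IntExpr.read 0 1 + .const c * .var vB + .var vBL).eval s₂ = (d : ℤ) := by
    rw [hd]
    simp [e2, hk, hB₂, hBL₂]
  refine ok_seq (R := fun t => t.int vD 0 = d) 1 (2 * k * n * (d * 4 + 6) + 4) (by omega)
    (ok_assign le_rfl (by simp) ?_ ?_) ?_
  · rw [v2]; exact bits_natCast_le (by omega)
  · rw [v2]; simp
  intro s₃ hf₃ hD₃
  have hf₃ : Frame (.assign vD 0) s₂ s₃ := ⟨hf₃.int, hf₃.real, hf₃.coins⟩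
  have e3 : s₃.int 0 = s.int 0 := (hf₃.int 0 (by decide)).trans e2
  have hB₃ : s₃.int vB 0 = b := by rw [hf₃.int vB (by decide), hB₂]
  have v3 : (IntExpr.read 0 1 * (2 * .var vD + .read 0 1 + .var vB + 1) + .var vB +
      .read 0 1).eval s₃ = (slotBits k b d : ℤ) := by
    simp [slotBits, e3, hk, hB₃, hD₃]
  refine ok_seq (R := fun t => t.int vSLOT 0 = slotBits k b d) 1 (2 * k * n * (d * 4 + 6) + 3)
    (by omega) (ok_assign le_rfl (by simp) ?_ ?_) ?_
  · rw [v3]; exact bits_natCast_le (by omega)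
  · rw [v3]; simp
  intro s₄ hf₄ hS₄
  have e4 : s₄.int 0 = s.int 0 := (hf₄.int 0 (by decide)).trans e3
  have hD₄ : s₄.int vD 0 = d := by rw [hf₄.int vD (by decide), hD₃]
  have v4 : (2 * IntExpr.read 0 1 * .var vD).eval s₄ = (2 * k * d : ℕ) := by
    simp [e4, hk, hD₄]
  refine ok_seq (R := fun t => t.int vDEG 0 = (2 * k * d : ℕ)) 1 (2 * k * n * (d * 4 + 6) + 2)
    (by omega) (ok_assign le_rfl (by simp) ?_ ?_) ?_
  · rw [v4]; exact bits_natCast_le (by omega)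
  · rw [v4]; simp
  intro s₅ hf₅ hG₅
  have e5 : s₅.int 0 = s.int 0 := (hf₅.int 0 (by decide)).trans e4
  have c5 : s₅.coins = s.coins := (hf₅.coins (by decide)).trans
    ((hf₄.coins (by decide)).trans ((hf₃.coins (by decide)).trans c2))
  have hD₅ : s₅.int vD 0 = d := by rw [hf₅.int vD (by decide), hD₄]
  have hS₅ : s₅.int vSLOT 0 = slotBits k b d := by rw [hf₅.int vSLOT (by decide), hS₄]
  refine (ok_tossProg (by rw [e5, hn]) (by rw [e5, hk]) hD₅ hS₅ (by omega) hβ (by omega)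
    hbits).mono le_rfl ?_
  intro t hf hx
  refine ⟨?_, ?_, hord, fun p hp => ?_, fun p h1 h2 => ?_, ?_, ?_, ?_⟩
  · rw [hf.int 0 (by decide), e5, hn]
  · rw [hf.int 0 (by decide), e5, hk]
  · rw [hf.int aORD (by decide), hf₅.int aORD (by decide), hf₄.int aORD (by decide),
      hf₃.int aORD (by decide), hf₂.int aORD (by decide), hO p hp]
  · rw [hf.int aPAR (by decide), hf₅.int aPAR (by decide), hf₄.int aPAR (by decide),
      hf₃.int aPAR (by decide), hf₂.int aPAR (by decide), hP p h1 h2]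
  · rw [hf.int vDEG (by decide), hG₅]
  · rw [hf.int vSLOT (by decide), hS₅]
  · rw [c5] at hx
    exact hx


/-! ### Trees, copies and embeddings -/

/-- The adjacency matrix of a graph, with natural numbers as indices. -/
noncomputable def adjNum {n : ℕ} (G : SimpleGraph (Fin n)) (v u : ℕ) : ℕ :=
  open Classical in if h : v < n ∧ u < n then (if G.Adj ⟨v, h.1⟩ ⟨u, h.2⟩ then 1 else 0) else 0

/-- The weights of the edges, with natural numbers as indices, and with `0` at the pairs that are
not edges. -/
noncomputable def weightNum {n : ℕ} {R : Type} [Zero R] (G : SimpleGraph (Fin n))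
    (w : Sym2 (Fin n) → R) (v u : ℕ) : R :=
  if h : v < n ∧ u < n then weightTable G w ⟨v, h.1⟩ ⟨u, h.2⟩ else 0

theorem adjNum_le_one {n : ℕ} (G : SimpleGraph (Fin n)) (v u : ℕ) : adjNum G v u ≤ 1 := by
  unfold adjNum
  split_ifs <;> omega

theorem adjNum_apply {n : ℕ} (G : SimpleGraph (Fin n)) (v u : Fin n) :
    adjNum G v u = 1 ↔ G.Adj v u := by
  simp [adjNum]

theorem rowMajor_apply {R : Type} [AddCommMonoid R] {n : ℕ} (A : Fin n → Fin n → R) {v u : ℕ}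
    (hv : v < n) (hu : u < n) : rowMajor n A (v * n + u : ℕ) = A ⟨v, hv⟩ ⟨u, hu⟩ := by
  unfold rowMajor
  rw [Finset.sum_eq_single ⟨v, hv⟩, Finset.sum_eq_single ⟨u, hu⟩, if_pos (by push_cast; rfl)]
  · intro j _ hj
    rw [if_neg]
    intro h
    exact hj (Fin.ext ((cell_inj hu j.2).1 (by exact_mod_cast h)).2.symm)
  · simp
  · intro i _ hi
    refine Finset.sum_eq_zero fun j _ => if_neg fun h => hi (Fin.ext ?_)
    exact ((cell_inj hu j.2).1 (by exact_mod_cast h)).1.symm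
  · simp

theorem rowMajor_eq_zero_or {R : Type} [AddCommMonoid R] {n : ℕ} (A : Fin n → Fin n → R) (c : ℤ) :
    rowMajor n A c = 0 ∨ ∃ i j, rowMajor n A c = A i j := by
  by_cases h : ∃ v u : Fin n, c = ((v * n + u : ℕ) : ℤ)
  · obtain ⟨v, u, rfl⟩ := h
    exact Or.inr ⟨v, u, rowMajor_apply A v.2 u.2⟩
  · left
    refine Finset.sum_eq_zero fun i _ => Finset.sum_eq_zero fun j _ => if_neg fun hc => h ⟨i, j, ?_⟩
    rw [hc]
    push_cast
    rfl

theorem rowMajor_adjTable {n : ℕ} (G : SimpleGraph (Fin n)) {v u : ℕ} (hv : v < n) (hu : u < n) :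
    rowMajor n (adjTable G) (v * n + u : ℕ) = adjNum G v u := by
  rw [rowMajor_apply _ hv hu]
  simp [adjTable, adjNum, hv, hu]

theorem rowMajor_weightTable {n : ℕ} {R : Type} [AddCommMonoid R] (G : SimpleGraph (Fin n))
    (w : Sym2 (Fin n) → R) {v u : ℕ} (hv : v < n) (hu : u < n) :
    rowMajor n (weightTable G w) (v * n + u : ℕ) = weightNum G w v u := by
  rw [rowMajor_apply _ hv hu]
  simp [weightNum, hv, hu]

theorem exists_adjNum_boundary {k : ℕ} {T : SimpleGraph (Fin k)} (hT : T.Connected) (P : ℕ → Prop)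
    (h0 : P 0) (h : ∃ v < k, ¬ P v) : ∃ u < k, ∃ v < k, P u ∧ ¬ P v ∧ adjNum T u v = 1 := by
  obtain ⟨v, hv, hPv⟩ := h
  obtain ⟨p⟩ := hT.preconnected ⟨0, by omega⟩ ⟨v, hv⟩
  obtain ⟨e, -, h1, h2⟩ := p.exists_boundary_dart {x | P x} h0 hPv
  exact ⟨e.fst, e.fst.2, e.snd, e.snd.2, h1, h2, (adjNum_apply T _ _).2 e.adj⟩

section
variable {k n : ℕ} {T : SimpleGraph (Fin k)} {G : SimpleGraph (Fin n)} {ord par : ℕ → ℕ}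

/-- The vertex at position `p`. -/
def IsOrder.vertex {A : ℕ → ℕ → ℕ} (h : IsOrder k A ord par (k - 1)) (p : Fin k) : Fin k :=
  ⟨ord p, h.lt p (by omega)⟩

theorem IsOrder.vertex_bijective {A : ℕ → ℕ → ℕ} (h : IsOrder k A ord par (k - 1)) :
    Function.Bijective h.vertex :=
  Finite.injective_iff_bijective.1 fun p q hpq =>
    Fin.ext (h.inj p (by omega) q (by omega) (Fin.ext_iff.1 hpq))

/-- The edge of the tree between the vertex at position `p + 1` and its parent. -/
def IsOrder.edge {A : ℕ → ℕ → ℕ} (h : IsOrder k A ord par (k - 1)) (p : Fin (k - 1)) :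
    Sym2 (Fin k) :=
  s(h.vertex ⟨par (p + 1), by have := (h.par_lt (p + 1) (by omega) (by omega)).1; omega⟩,
    h.vertex ⟨p + 1, by omega⟩)

theorem IsOrder.edge_injective {A : ℕ → ℕ → ℕ} (h : IsOrder k A ord par (k - 1)) :
    Function.Injective h.edge := by
  intro p q hpq
  have h1 := (h.par_lt (p + 1) (by omega) (by omega)).1
  have h2 := (h.par_lt (q + 1) (by omega) (by omega)).1
  simp only [IsOrder.edge, Sym2.eq_iff, h.vertex_bijective.1.eq_iff, Fin.mk.injEq] at hpq
  exact Fin.ext (by omega)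

theorem IsOrder.edge_mem (h : IsOrder k (adjNum T) ord par (k - 1)) (p : Fin (k - 1)) :
    h.edge p ∈ T.edgeSet := by
  rw [IsOrder.edge, SimpleGraph.mem_edgeSet]
  exact (adjNum_apply T _ _).1 (h.par_lt (p + 1) (by omega) (by omega)).2

open Classical in
/-- A tree has as many edges as positions with a parent, so the edges to the parents are all
edges. -/
theorem IsOrder.image_edge (h : IsOrder k (adjNum T) ord par (k - 1)) (hT : T.IsTree) :
    Finset.univ.image h.edge = T.edgeFinset := by
  refine Finset.eq_of_subset_of_card_le ?_ ?_
  · intro e he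
    obtain ⟨p, -, rfl⟩ := Finset.mem_image.1 he
    exact SimpleGraph.mem_edgeFinset.2 (h.edge_mem p)
  · rw [Finset.card_image_of_injective _ h.edge_injective]
    have := hT.card_edgeFinset
    simp only [Finset.card_univ, Fintype.card_fin] at this ⊢
    omega

/-- The embedding that belongs to a copy: positions instead of vertices of the tree. -/
def IsOrder.embOfCopy {A : ℕ → ℕ → ℕ} (h : IsOrder k A ord par (k - 1)) (φ : T.Copy G)
    (p : Fin k) : Fin n := φ (h.vertex p)

theorem IsOrder.isEmb_embOfCopy (h : IsOrder k (adjNum T) ord par (k - 1)) (φ : T.Copy G) :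
    IsEmb par (adjNum G) (h.embOfCopy φ) := by
  refine ⟨φ.injective.comp h.vertex_bijective.1, fun p hp => ?_⟩
  have h1 := (h.par_lt (p + 1) (by omega) (by omega)).1
  have h2 := h.edge_mem ⟨p, hp⟩
  rw [IsOrder.edge, SimpleGraph.mem_edgeSet] at h2
  rw [ext, ext, dif_pos (by omega : p + 1 < k), dif_pos (by omega : par (p + 1) < k),
    adjNum_apply]
  exact φ.toHom.map_adj h2

/-- Embeddings are copies, because every edge of a tree joins a position to its parent. -/
theorem IsOrder.exists_copy (h : IsOrder k (adjNum T) ord par (k - 1)) (hT : T.IsTree)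
    {ψ : Fin k → Fin n} (hψ : IsEmb par (adjNum G) ψ) :
    ∃ φ : T.Copy G, h.embOfCopy φ = ψ := by
  classical
  let σ := Equiv.ofBijective _ h.vertex_bijective
  refine ⟨⟨⟨fun v => ψ (σ.symm v), ?_⟩, hψ.1.comp σ.symm.injective⟩, ?_⟩
  · intro u v huv
    have h1 : s(u, v) ∈ T.edgeFinset := SimpleGraph.mem_edgeFinset.2 huv
    rw [← h.image_edge hT] at h1
    obtain ⟨p, -, hp⟩ := Finset.mem_image.1 h1
    have h2 := (h.par_lt (p + 1) (by omega) (by omega)).1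
    have h3 := hψ.2 p p.2
    rw [ext, ext, dif_pos (by omega : (p : ℕ) + 1 < k), dif_pos (by omega : par (p + 1) < k),
      adjNum_apply] at h3
    have h4 : ∀ q, ψ q = ψ (σ.symm (h.vertex q)) := fun q => by
      rw [show h.vertex q = σ q from rfl, σ.symm_apply_apply]
    rw [h4, h4 ⟨(p : ℕ) + 1, _⟩] at h3
    rw [IsOrder.edge, Sym2.eq_iff] at hp
    rcases hp with ⟨h5, h6⟩ | ⟨h5, h6⟩
    · rwa [h5, h6] at h3
    · rw [h5, h6] at h3
      exact h3.symm
  · funext p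
    change ψ (σ.symm (σ p)) = ψ p
    rw [σ.symm_apply_apply]

theorem IsOrder.copyWeight_eq {R : Type} [AddCommMonoid R]
    (h : IsOrder k (adjNum T) ord par (k - 1)) (hT : T.IsTree) (w : Sym2 (Fin n) → R)
    (φ : T.Copy G) : copyWeight w φ = ∑ p ∈ Finset.range (k - 1),
      weightNum G w (ext (h.embOfCopy φ) (par (p + 1))) (ext (h.embOfCopy φ) (p + 1)) := by
  classical
  have h0 : copyWeight w φ = ∑ e ∈ T.edgeFinset, w (e.map φ) := by
    unfold copyWeight
    convert rfl
  rw [h0, ← h.image_edge hT, Finset.sum_image h.edge_injective.injOn, Finset.sum_range]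
  refine Finset.sum_congr rfl fun p _ => ?_
  have h2 := (h.par_lt (p + 1) (by omega) (by omega)).1
  have h3 := (h.isEmb_embOfCopy φ).2 p p.2
  rw [ext, ext, dif_pos (by omega : (p : ℕ) + 1 < k), dif_pos (by omega : par (p + 1) < k)] at h3 ⊢
  rw [adjNum_apply] at h3
  simp only [weightNum, Fin.is_lt, and_self, dif_pos, Fin.eta, weightTable, if_pos h3]
  rfl

end


/-! ### Bounds for the length of the integers and for the number of steps -/

/-- A bound for the lengths of the integers in the computation for weights at most `W`. -/
def wordBits (k b d W : ℕ) : ℕ :=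
  k * (2 * (slotBits k b d * d) + k + b + (W * (2 * k * d) * slotBits k b d + 1)) +
    slotBits k b d * ((k * W + 1) * (2 * k * d)) + slotBits k b d * d + slotBits k b d + 2 * b +
    k + W + 4

theorem slotBits_le {k b d u : ℕ} (hk : k ≤ d) (hu : b + d + 1 ≤ u) :
    slotBits k b d ≤ 4 * u ^ 2 := by
  unfold slotBits
  have h1 : k * (2 * d + k + b + 1) ≤ u * (3 * u) := Nat.mul_le_mul (by omega) (by omega)
  nlinarith [Nat.mul_le_mul hu hu]

theorem wordBits_le {k b d W u : ℕ} (hk : k ≤ d) (hu : b + d + 1 ≤ u) :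
    wordBits k b d W + 1 ≤ 40 * u ^ 5 * (W + 1) := by
  have hS := slotBits_le hk hu
  have hu1 : 1 ≤ u := by omega
  have p1 : u ≤ u ^ 5 := Nat.le_self_pow (by norm_num) u
  have p2 : u ^ 2 ≤ u ^ 5 := Nat.pow_le_pow_right hu1 (by norm_num)
  have p3 : u ^ 3 ≤ u ^ 5 := Nat.pow_le_pow_right hu1 (by norm_num)
  have p4 : u ^ 4 ≤ u ^ 5 := Nat.pow_le_pow_right hu1 (by norm_num)
  have hkd : 2 * k * d ≤ 2 * u ^ 2 := by
    have : k * d ≤ u * u := Nat.mul_le_mul (by omega) (by omega)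
    nlinarith
  have hSd : slotBits k b d * d ≤ 4 * u ^ 3 := by
    calc slotBits k b d * d ≤ 4 * u ^ 2 * u := Nat.mul_le_mul hS (by omega)
      _ = _ := by ring
  have hDS : 2 * k * d * slotBits k b d ≤ 8 * u ^ 4 := by
    calc 2 * k * d * slotBits k b d ≤ 2 * u ^ 2 * (4 * u ^ 2) := Nat.mul_le_mul hkd hS
      _ = _ := by ring
  have h1 : k * (2 * (slotBits k b d * d) + k + b + (W * (2 * k * d) * slotBits k b d + 1)) ≤
      u * (8 * u ^ 3 + u + W * (8 * u ^ 4)) := by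
    refine Nat.mul_le_mul (by omega) ?_
    have : W * (2 * k * d) * slotBits k b d ≤ W * (8 * u ^ 4) := by
      rw [mul_assoc]
      exact Nat.mul_le_mul_left _ hDS
    omega
  have h2 : slotBits k b d * ((k * W + 1) * (2 * k * d)) ≤ (u * W + 1) * (8 * u ^ 4) := by
    calc slotBits k b d * ((k * W + 1) * (2 * k * d))
        = (k * W + 1) * (2 * k * d * slotBits k b d) := by ring
      _ ≤ _ := Nat.mul_le_mul (Nat.add_le_add_right (Nat.mul_le_mul_right _ (by omega)) _) hDS
  have h3 : u * (8 * u ^ 3 + u + W * (8 * u ^ 4)) = 8 * u ^ 4 + u ^ 2 + 8 * (u ^ 5 * W) := by ring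
  have h4 : (u * W + 1) * (8 * u ^ 4) = 8 * (u ^ 5 * W) + 8 * u ^ 4 := by ring
  have h5 : 40 * u ^ 5 * (W + 1) = 40 * (u ^ 5 * W) + 40 * u ^ 5 := by ring
  have h6 : 1 * W ≤ u ^ 5 * W := Nat.mul_le_mul_right _ (by omega)
  unfold wordBits
  omega

theorem evalSteps_le {n k u : ℕ} (hn : 1 ≤ n) (hk : 1 ≤ k) (hu : k ≤ u) :
    evalSteps n k ≤ 40 * (2 ^ k * u ^ 2 * n ^ 2) := by
  have hX := Nat.one_le_two_pow (n := k)
  have hn2 : n ≤ n ^ 2 := Nat.le_self_pow (by norm_num) n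
  have hu2 : u ≤ u ^ 2 := Nat.le_self_pow (by norm_num) u
  have hu1 : 0 < u := by omega
  have h0 : 1 ≤ u ^ 2 * n ^ 2 := Nat.one_le_iff_ne_zero.2 (by positivity)
  have a1 : k * n * (3 * k + 10) ≤ u ^ 2 * n ^ 2 * 13 := by
    calc k * n * (3 * k + 10) ≤ u * n ^ 2 * (13 * u) :=
          Nat.mul_le_mul (Nat.mul_le_mul hu hn2) (by omega)
      _ = _ := by ring
  have a2 : k * (n * (3 * n + 6) + 4) ≤ u ^ 2 * n ^ 2 * 13 := by
    calc k * (n * (3 * n + 6) + 4) ≤ u ^ 2 * (13 * n ^ 2) :=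
          Nat.mul_le_mul (hu.trans hu2) (by nlinarith)
      _ = _ := by ring
  have a3 : 3 * n + 8 ≤ u ^ 2 * n ^ 2 * 11 := by
    have : 1 * n ≤ u ^ 2 * n ^ 2 := Nat.mul_le_mul (by omega) hn2
    omega
  have a4 : k * n * (3 * k + 10) + (k * (n * (3 * n + 6) + 4) + 3 * n + 8) ≤
      u ^ 2 * n ^ 2 * 37 := by omega
  have a5 := Nat.mul_le_mul_left (2 ^ k) a4
  have a6 : 1 ≤ 2 ^ k * (u ^ 2 * n ^ 2) := Nat.one_le_iff_ne_zero.2 (by positivity)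
  unfold evalSteps
  rw [mul_assoc (2 ^ k)]
  rw [← mul_assoc] at a5
  omega

theorem coreSteps_le {n k u : ℕ} (hn : 1 ≤ n) (hk : 1 ≤ k) (hu : k ≤ u) :
    coreSteps n k ≤ 120 * (2 ^ k * u ^ 3 * n ^ 3) := by
  have h1 := evalSteps_le hn hk hu
  set P := 2 ^ k * u ^ 2 * n ^ 2 with hP
  have hu1 : 1 ≤ u := hk.trans hu
  have hP1 : n * n ≤ P := by
    rw [hP, sq n]
    exact Nat.le_mul_of_pos_left _ (by positivity)
  have hn2 : 1 * 1 ≤ n * n := Nat.mul_le_mul hn hn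
  have hR : 2 ^ k * u ^ 3 * n ^ 3 = u * n * P := by rw [hP]; ring
  have h2 : 1 * P ≤ u * n * P := Nat.mul_le_mul_right _ (Nat.mul_le_mul hu1 hn)
  have h3 : fixSteps n k ≤ u * (n * (40 * P + 5) + 6) + 2 := by
    unfold fixSteps
    gcongr
  have h4 : u * (n * (40 * P + 5) + 6) + 2 ≤ 60 * (u * n * P) := by
    have e1 : u * (n * (40 * P + 5) + 6) = 40 * (u * n * P) + 5 * (u * n) + 6 * u := by ring
    have e2 : u * n * 1 ≤ u * n * P := Nat.mul_le_mul_left _ (by omega)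
    have e3 : u * 1 ≤ u * n := Nat.mul_le_mul_left _ hn
    omega
  unfold coreSteps
  rw [hR]
  omega

theorem paramSteps_le {n k b d u : ℕ} (hn : 1 ≤ n) (hk : 1 ≤ k) (hkd : k ≤ d)
    (hu : b + d + 1 ≤ u) :
    k * (k * (k * 6 + 4) + 10) + 10 + paramSteps n k b d ≤ 60 * (2 ^ k * u ^ 3 * n ^ 3) := by
  have hku : k ≤ u := by omega
  have hu1 : 1 ≤ u := by omega
  have p1 : u ≤ u ^ 3 := Nat.le_self_pow (by norm_num) u
  have p2 : u ^ 2 ≤ u ^ 3 := Nat.pow_le_pow_right hu1 (by norm_num)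
  have hn3 : n ≤ n ^ 3 := Nat.le_self_pow (by norm_num) n
  have h1 : k * (k * (k * 6 + 4) + 10) ≤ u * (u * (u * 6 + 4) + 10) := by gcongr
  have h2 : u * (u * (u * 6 + 4) + 10) = 6 * u ^ 3 + 4 * u ^ 2 + 10 * u := by ring
  have h3 : 2 * k * n * (d * 4 + 6) ≤ 20 * (u ^ 3 * n ^ 3) := by
    calc 2 * k * n * (d * 4 + 6) ≤ 2 * u * n ^ 3 * (10 * u) := by
          refine Nat.mul_le_mul (Nat.mul_le_mul (by omega) hn3) (by omega)
      _ = 20 * (u ^ 2 * n ^ 3) := by ring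
      _ ≤ _ := by gcongr
  have h4 : u ^ 3 * 1 ≤ u ^ 3 * n ^ 3 := Nat.mul_le_mul_left _ (by omega)
  have h5 : 1 * (u ^ 3 * n ^ 3) ≤ 2 ^ k * (u ^ 3 * n ^ 3) :=
    Nat.mul_le_mul_right _ Nat.one_le_two_pow
  rw [one_mul, ← mul_assoc] at h5
  unfold paramSteps
  omega

theorem two_mul_div_two_pow_le {n k b c d j : ℕ} (hk : 1 ≤ k) (hb : n + 1 ≤ 2 ^ b)
    (hd : k + c * b + j ≤ d) : (2 * k : ℝ) / 2 ^ d ≤ (1 / 2 ^ j) * (1 / ((n : ℝ) + 1) ^ c) := by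
  rw [div_mul_div_comm, one_mul, div_le_div_iff₀ (by positivity) (by positivity), one_mul]
  have h : 2 * k * (2 ^ j * (n + 1) ^ c) ≤ 2 ^ d := by
    calc 2 * k * (2 ^ j * (n + 1) ^ c) ≤ 2 ^ k * (2 ^ j * (2 ^ b) ^ c) := by
          gcongr
          exact two_mul_le_two_pow hk
      _ = 2 ^ (k + c * b + j) := by ring
      _ ≤ _ := Nat.pow_le_pow_right (by norm_num) hd
  exact_mod_cast h


/-! ### The algorithm for integer weights -/

section
variable {k n b d W : ℕ} {T : SimpleGraph (Fin k)} {G : SimpleGraph (Fin n)} {ord par : ℕ → ℕ}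
  {a r : ℕ → ℕ → ℕ} {ω : ℕ → Bool} {s : State}

theorem Ready.toInstance {A : ℕ → ℕ → ℕ} (h : Ready s n k b d A ord par ω) (hk : 1 ≤ k)
    (hb : n ≤ 2 ^ b) (ha : ∀ v < n, ∀ u < n, s.int aADJ (v * n + u : ℕ) = a v u ∧ a v u ≤ 1)
    (hr : ∀ v < n, ∀ u < n, s.int aWT (v * n + u : ℕ) = r v u ∧ r v u ≤ W) :
    Instance s n k b (slotBits k b d * d) (2 * k * d) (slotBits k b d) W par a r
      (label (2 ^ slotBits k b d : ℤ) d ω) where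
  n_eq := h.n_eq
  k_eq := h.k_eq
  k_pos := hk
  n_le := hb
  par_eq q h1 h2 := ⟨(h.isOrder.par_lt q h1 (by omega)).1, h.par_eq q h1 h2⟩
  deg_eq := h.deg_eq
  slot_eq := h.slot_eq
  adj_eq := ha
  wt_eq := hr
  label_eq m hm := ⟨h.label_eq m hm, horner_coin_bounds (by unfold slotBits; omega) _ _⟩

theorem bits_sq_le {β : ℕ} (hb : n + 1 ≤ 2 ^ b) (hβ : 2 * b + 1 ≤ β) : bits (n * n : ℕ) ≤ β := by
  refine (bits_le_of_lt (m := 2 * b) (by positivity) ?_).trans hβ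
  have : n * n < 2 ^ b * 2 ^ b := Nat.mul_lt_mul'' (by omega) (by omega)
  rw [two_mul, pow_add]
  exact_mod_cast this

theorem Ready.ok_coreProg {β : ℕ} {A : ℕ → ℕ → ℕ} (h : Ready s n k b d A ord par ω) (hk : 1 ≤ k)
    (hd : 1 ≤ d) (hb : n + 1 ≤ 2 ^ b)
    (ha : ∀ v < n, ∀ u < n, s.int aADJ (v * n + u : ℕ) = a v u ∧ a v u ≤ 1)
    (hr : ∀ v < n, ∀ u < n, s.int aWT (v * n + u : ℕ) = r v u ∧ r v u ≤ W)
    (hJ : s.int vNSLOTS 0 = ((k * W + 1) * (2 * k * d) : ℕ)) (hfix : ∀ p < k, s.int aFIX p = 0)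
    (hβ : wordBits k b d W ≤ β) :
    Ok β coreProg s (coreSteps n k) fun s' => Favorable n k d par a r ω →
      ((¬ ∃ φ : Fin k → Fin n, IsEmb par a φ) ∧ s'.int 4 = s.int 4) ∨
      ∃ φ : Fin k → Fin n, IsEmb par a φ ∧
        (∀ ψ : Fin k → Fin n, IsEmb par a ψ → embWeight par r φ ≤ embWeight par r ψ) ∧
        s'.int 4 0 = 1 ∧ ∀ p : Fin k, s'.int 4 (ord p + 1 : ℕ) = (φ p : ℕ) := by
  unfold wordBits at hβ
  exact ok_coreProg_favorable rfl (h.toInstance hk (by omega) ha hr) hd hJ le_rfl hfix h.ord_eq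
    (fun p hp q hq => h.isOrder.inj p (by omega) q (by omega)) (by omega) (by omega) (by omega)
    (bits_sq_le hb (by omega))

theorem outputs_of_isEmb {P : T.Copy G → Prop} (h : IsOrder k (adjNum T) ord par (k - 1))
    (hT : T.IsTree) {ψ : Fin k → Fin n} (hψ : IsEmb par (adjNum G) ψ) (h0 : s.int 4 0 = 1)
    (hout : ∀ p : Fin k, s.int 4 (ord p + 1 : ℕ) = (ψ p : ℕ))
    (hP : ∀ φ : T.Copy G, h.embOfCopy φ = ψ → P φ) : Outputs T G P s := by
  obtain ⟨φ, hφ⟩ := h.exists_copy hT hψ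
  refine Or.inl ⟨φ, hP φ hφ, h0, fun i => ?_⟩
  obtain ⟨p, rfl⟩ := h.vertex_bijective.2 i
  have := hout p
  rw [← hφ] at this
  exact_mod_cast this

theorem outputs_of_isEmpty {P : T.Copy G → Prop} (h : IsOrder k (adjNum T) ord par (k - 1))
    (hno : ¬ ∃ φ : Fin k → Fin n, IsEmb par (adjNum G) φ) (h0 : s.int 4 0 = 0) :
    Outputs T G P s :=
  Or.inr ⟨⟨fun φ => hno ⟨_, h.isEmb_embOfCopy φ⟩⟩, h0⟩

end

/-- Shift the weights by `M`, so that they are natural numbers, and search. -/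
def exactProg (c : ℕ) : Program :=
  ordProg ;; paramProg c ;;
  .forTo iE (.read 0 0 * .read 0 0) (.setInt aADJ (.var iE) (.read 2 (.var iE))) ;;
  .forTo iE (.read 0 0 * .read 0 0) (.setInt aWT (.var iE) (.read 3 (.var iE) + .read 0 2)) ;;
  .assign vNSLOTS ((.read 0 1 * (2 * .read 0 2) + 1) * .var vDEG) ;;
  coreProg

theorem exactProg_integerOnly (c : ℕ) : (exactProg c).IntegerOnly := by
  simp [exactProg, ordProg, paramProg, logProg, tossProg, coreProg, detectProg, edgeProg, evalProg,
    initProg, foldProg, fixProg, Program.IntegerOnly, Program.forTo, Program.assign,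
    Test.IntegerOnly]

section
variable {k n b d M : ℕ} {T : SimpleGraph (Fin k)} {G : SimpleGraph (Fin n)}
  {w : Sym2 (Fin n) → ℤ}

theorem abs_weightNum_le (hw : ∀ e ∈ G.edgeSet, |w e| ≤ (M : ℤ)) (v u : ℕ) :
    |weightNum G w v u| ≤ M := by
  unfold weightNum weightTable
  split_ifs with h1 h2
  · exact hw _ h2
  · simp
  · simp

theorem abs_rowMajor_weightTable_le (hw : ∀ e ∈ G.edgeSet, |w e| ≤ (M : ℤ)) (c : ℤ) :
    |rowMajor n (weightTable G w) c| ≤ M := by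
  rcases rowMajor_eq_zero_or (weightTable G w) c with h | ⟨i, j, h⟩
  · simp [h]
  · rw [h]
    unfold weightTable
    split_ifs with h2
    · exact hw _ h2
    · simp

theorem bits_rowMajor_adjTable_le {m : ℕ} (H : SimpleGraph (Fin m)) (c : ℤ) :
    bits (rowMajor m (adjTable H) c) ≤ 2 := by
  rcases rowMajor_eq_zero_or (adjTable H) c with h | ⟨i, j, h⟩
  · simp [h, bits]
  · rw [h]
    unfold adjTable
    split_ifs <;> simp [bits]

theorem memBdd_intInput {β : ℕ} (hw : ∀ e ∈ G.edgeSet, |w e| ≤ (M : ℤ)) (hn : bits (n : ℤ) ≤ β)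
    (hk : k + 1 ≤ β) (hM : M + 1 ≤ β) (h2 : 2 ≤ β) (ω : ℕ → Bool) :
    MemBdd β (intInput T G M w ω) := by
  have h0 : bits 0 ≤ β := by simp [bits]; omega
  intro a c
  rcases a with _ | _ | _ | _ | a
  · simp only [intInput]
    split_ifs
    exacts [hn, bits_natCast_le hk, bits_natCast_le hM, h0]
  · exact (bits_rowMajor_adjTable_le T c).trans h2
  · exact (bits_rowMajor_adjTable_le G c).trans h2
  · refine le_trans (bits_mono (b := (M : ℤ)) ?_) (bits_natCast_le hM)
    change (rowMajor n (weightTable G w) c).natAbs ≤ (M : ℤ).natAbs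
    zify
    simpa using abs_rowMajor_weightTable_le hw c
  · exact h0

/-- All copies have the same number of edges, so shifting the weights by `M` preserves the copies of
minimum weight. The parents `par` and the shifted weights `r` do not depend on the coins `ω`. -/
theorem ok_exactProg {β c : ℕ} (hT : T.IsTree) (hw : ∀ e ∈ G.edgeSet, |w e| ≤ (M : ℤ))
    (hk : 1 ≤ k) (hb : b = Nat.clog 2 (n + 1)) (hd : d = k + c * b)
    (hβ : wordBits k b d (2 * M) ≤ β) :
    ∃ (par : ℕ → ℕ) (r : ℕ → ℕ → ℕ), ∀ ω, Ok β (exactProg c) (intInput T G M w ω)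
      (k * (k * (k * 6 + 4) + 10) + 10 + paramSteps n k b d + (n * n * 6 + 5 + coreSteps n k))
      fun s' => Favorable n k d par (adjNum G) r ω →
        Outputs T G (fun φ => ∀ ψ : T.Copy G, copyWeight w φ ≤ copyWeight w ψ) s' := by
  have hβ' := hβ
  unfold wordBits at hβ'
  have hnb : n + 1 ≤ 2 ^ b := by rw [hb]; exact Nat.le_pow_clog (by norm_num) _
  have hsq : bits (n * n : ℕ) ≤ β := bits_sq_le hnb (by omega)
  have hS1 : 1 ≤ slotBits k b d := by unfold slotBits; omega
  have hJ := Nat.mul_le_mul_right ((k * (2 * M) + 1) * (2 * k * d)) hS1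
  have hmem : ∀ ω, MemBdd β (intInput T G M w ω) := fun ω =>
    memBdd_intInput hw ((bits_le_of_lt (m := b) (by positivity)
      (by exact_mod_cast hnb)).trans (by omega)) (by omega) (by omega) (by omega) ω
  obtain ⟨ord, par, hord, hrun⟩ := exists_order (A := adjNum T) (hmem fun _ => false)
    (k := k) (by simp [intInput]) hk
    (fun u hu v hv => ⟨rowMajor_adjTable T hu hv, adjNum_le_one T u v⟩)
    (fun P h0 h => exists_adjNum_boundary hT.connected P h0 h) (fun _ _ => rfl) rfl (by omega)
  have hr0 : ∀ v u, ((weightNum G w v u + M).toNat : ℤ) = weightNum G w v u + M := fun v u =>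
    Int.toNat_of_nonneg (by have := abs_le.1 (abs_weightNum_le hw v u); omega)
  refine ⟨par, fun v u => (weightNum G w v u + M).toNat, fun ω => ?_⟩
  refine ok_seq _ (paramSteps n k b d + (n * n * 6 + 5 + coreSteps n k)) (by omega) (hrun ω) ?_
  rintro s₁ hf₁ ⟨hO₁, hP₁⟩
  have e1 : s₁.int 0 = (intInput T G M w ω).int 0 := hf₁.int 0 (by decide)
  refine ok_seq (paramSteps n k b d) (n * n * 6 + 5 + coreSteps n k) (by omega)
    (ok_paramProg (bL := 0) (c := c) (by rw [e1]; simp [intInput]) (by rw [e1]; simp [intInput]) hk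
      hord hO₁ hP₁ (by rw [hf₁.int vBL (by decide)]; rfl) hb (by omega) (by omega)) ?_
  intro s₂ hf₂ hR₂
  rw [hf₁.coins (by decide)] at hR₂
  -- with a numeral for `c`, the arrays of the program can be computed
  have hf₂ : Frame (paramProg 0) s₁ s₂ := ⟨hf₂.int, hf₂.real, hf₂.coins⟩
  have keep₂ : ∀ a, a ∉ (ordProg ;; paramProg 0).ints → s₂.int a = (intInput T G M w ω).int a := by
    intro a ha
    simp only [Program.ints, List.mem_append, not_or] at ha
    rw [hf₂.int a ha.2, hf₁.int a ha.1]
  refine ok_seq (n * n * 3 + 2) (n * n * 3 + 3 + coreSteps n k) (by omega)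
    (ok_fill (a := aADJ) (n * n) 1 (fun j => rowMajor n (adjTable G) j) le_rfl hsq (by decide)
      (by decide) ?_ ?_) ?_
  · intro t _ hf
    simp [hf.int 0 (by decide), hR₂.n_eq]
  · intro j hj t ht hf hij _
    have h2 : t.int 2 = rowMajor n (adjTable G) := by
      rw [hf.int 2 (by decide), keep₂ 2 (by decide)]; rfl
    refine ok_setInt le_rfl (by simp) (by simp) (ht _ _) ?_
    simp [hij, h2]
  rintro s₃ hf₃ ⟨hA₃, -⟩
  have hR₃ := hR₂.congr (s' := s₃) (hf₃.int _ (by decide)) (hf₃.int _ (by decide))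
    (hf₃.int _ (by decide)) (hf₃.int _ (by decide)) (hf₃.int _ (by decide))
    (hf₃.int _ (by decide))
  refine ok_seq (n * n * 3 + 2) (1 + coreSteps n k) (by omega)
    (ok_fill (a := aWT) (n * n) 1 (fun j => rowMajor n (weightTable G w) j + M) le_rfl hsq
      (by decide) (by decide) ?_ ?_) ?_
  · intro t _ hf
    simp [hf.int 0 (by decide), hR₃.n_eq]
  · intro j hj t ht hf hij _
    have h3 : t.int 3 = rowMajor n (weightTable G w) := by
      rw [hf.int 3 (by decide), hf₃.int 3 (by decide), keep₂ 3 (by decide)]; rfl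
    have hM : t.int 0 2 = M := by
      rw [hf.int 0 (by decide), hf₃.int 0 (by decide), keep₂ 0 (by decide)]
      simp [intInput]
    have hv : (IntExpr.read 3 (.var iE) + .read 0 2).eval t =
        rowMajor n (weightTable G w) j + M := by
      simp [hij, h3, hM]
    refine ok_setInt le_rfl (by simp) (by simp) ?_ ?_
    · rw [hv]
      refine le_trans (bits_mono (b := ((2 * M : ℕ) : ℤ)) ?_) (bits_natCast_le (by omega))
      have := abs_le.1 (abs_rowMajor_weightTable_le hw (j : ℤ))
      omega
    · rw [hv]
      simp [hij]
  rintro s₄ hf₄ ⟨hW₄, -⟩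
  have hR₄ := hR₃.congr (s' := s₄) (hf₄.int _ (by decide)) (hf₄.int _ (by decide))
    (hf₄.int _ (by decide)) (hf₄.int _ (by decide)) (hf₄.int _ (by decide))
    (hf₄.int _ (by decide))
  have hM₄ : s₄.int 0 2 = M := by
    rw [hf₄.int 0 (by decide), hf₃.int 0 (by decide), keep₂ 0 (by decide)]
    simp [intInput]
  have hv : ((IntExpr.read 0 1 * (2 * .read 0 2) + 1) * .var vDEG).eval s₄ =
      ((k * (2 * M) + 1) * (2 * k * d) : ℕ) := by
    simp [hR₄.k_eq, hR₄.deg_eq, hM₄]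
  refine ok_seq (R := fun t => t.int vNSLOTS 0 = ((k * (2 * M) + 1) * (2 * k * d) : ℕ)) 1
    (coreSteps n k) (by omega) (ok_assign le_rfl (by simp) ?_ ?_) ?_
  · rw [hv]; exact bits_natCast_le (by omega)
  · rw [hv]; simp
  intro s₅ hf₅ hJ₅
  have hR₅ := hR₄.congr (s' := s₅) (hf₅.int _ (by decide)) (hf₅.int _ (by decide))
    (hf₅.int _ (by decide)) (hf₅.int _ (by decide)) (hf₅.int _ (by decide))
    (hf₅.int _ (by decide))
  refine (hR₅.ok_coreProg (a := adjNum G) (r := fun v u => (weightNum G w v u + M).toNat)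
    (W := 2 * M) hk (by omega) hnb ?_ ?_ hJ₅ ?_ hβ).mono le_rfl ?_
  · intro v hv u hu
    rw [hf₅.int aADJ (by decide), hf₄.int aADJ (by decide), hA₃ _ (cell_lt hv hu),
      rowMajor_adjTable G hv hu]
    exact ⟨rfl, adjNum_le_one G v u⟩
  · intro v hv u hu
    rw [hf₅.int aWT (by decide), hW₄ _ (cell_lt hv hu), rowMajor_weightTable G w hv hu]
    have := abs_le.1 (abs_weightNum_le hw v u)
    omega
  · intro p _
    rw [hf₅.int aFIX (by decide), hf₄.int aFIX (by decide), hf₃.int aFIX (by decide),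
      keep₂ aFIX (by decide)]
    rfl
  · intro s' _ hs' hfav
    rcases hs' hfav with ⟨hno, h4⟩ | ⟨ψ, hψ, hmin, h0, hout⟩
    · refine outputs_of_isEmpty hord hno ?_
      rw [h4, hf₅.int 4 (by decide), hf₄.int 4 (by decide), hf₃.int 4 (by decide),
        keep₂ 4 (by decide)]
      rfl
    · refine outputs_of_isEmb hord hT hψ h0 hout ?_
      rintro φ rfl φ'
      have h := hmin _ (hord.isEmb_embOfCopy φ')
      rw [hord.copyWeight_eq hT, hord.copyWeight_eq hT]
      unfold embWeight at h
      zify at h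
      simp only [hr0, Finset.sum_add_distrib] at h
      linarith

end


/-! ### Running time and error for integer weights -/

/-- Runs that are correct unless the coins are in a set of small probability. -/
theorem solves_of_ok {β N : ℕ} {p : Program} {input : (ℕ → Bool) → State} {Good : State → Prop}
    {Fav : (ℕ → Bool) → Prop} {time δ : ℝ} (hmem : ∀ ω, MemBdd β (input ω))
    (h : ∀ ω, Ok β p (input ω) N fun s => Fav ω → Good s)
    (ht : ((p.weight * (β + 1) * N : ℕ) : ℝ) ≤ time)
    (hδ : coinMeasure {ω | ¬ Fav ω} ≤ ENNReal.ofReal δ) : Solves p input Good time δ where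
  halts ω := by
    obtain ⟨t, s, hr, h1, -, -⟩ := h ω (hmem ω)
    exact ⟨t, s, hr, (Nat.cast_le.2 h1).trans ht⟩
  error := by
    refine (measure_mono ?_).trans hδ
    rintro ω ⟨t, s, hr, hbad⟩ hfav
    obtain ⟨t', s', hr', -, -, hgood⟩ := h ω (hmem ω)
    obtain ⟨-, rfl⟩ := hr.unique hr'
    exact hbad (hgood hfav)

theorem one_le_log {f : ℝ} (h1 : 1 ≤ f) : 1 ≤ Real.log (f + 2) := by
  rw [Real.le_log_iff_exp_le (by linarith)]
  have := Real.exp_one_lt_d9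
  linarith

/-- The factor `16` absorbs the constants in the arguments of the logarithms that occur. -/
theorem clog_add_one_le {N : ℕ} {f : ℝ} (hN : (N : ℝ) ≤ 16 * (f + 2)) (h1 : 1 ≤ f) :
    ((Nat.clog 2 N : ℕ) : ℝ) + 1 ≤ 8 * Real.log (f + 2) := by
  have hl2 : (0.69 : ℝ) < Real.log 2 := by have := Real.log_two_gt_d9; linarith
  have h3 : 1 ≤ Real.log (f + 2) := one_le_log h1
  rcases Nat.lt_or_ge 1 N with hN1 | hN1
  · have hc : 2 ^ (Nat.clog 2 N - 1) < N := Nat.pow_pred_clog_lt_self (by norm_num) hN1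
    have hpos : 1 ≤ Nat.clog 2 N := Nat.clog_pos (by norm_num) hN1
    set m := Nat.clog 2 N with hm
    have h4 : ((m : ℝ) - 1) * Real.log 2 ≤ 4 * Real.log 2 + Real.log (f + 2) := by
      have e : ((m - 1 : ℕ) : ℝ) = (m : ℝ) - 1 := by push_cast [hpos]; ring
      have e4 : 4 * Real.log 2 = Real.log 16 := by
        rw [show (16 : ℝ) = 2 ^ 4 by norm_num, Real.log_pow]
        norm_num
      rw [← e, ← Real.log_pow, e4, ← Real.log_mul (by norm_num) (by linarith)]
      refine Real.log_le_log (by positivity) (le_trans ?_ hN)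
      exact_mod_cast hc.le
    nlinarith
  · rw [Nat.clog_of_right_le_one hN1]
    simp only [Nat.cast_zero, zero_add]
    linarith

theorem mul_le_softBound {K C : ℕ} {f g ℓ : ℝ} (hK : K ≤ C) (hC : 8 ≤ C) (hg0 : 0 ≤ g) (hg : g ≤ f)
    (hℓ : ℓ = Real.log (f + 2)) (h1 : 1 ≤ ℓ) {t : ℝ} (ht : t ≤ K * g * ℓ ^ 8) :
    t ≤ softBound C f := by
  unfold softBound
  rw [← hℓ]
  refine ht.trans ?_
  have : (0 : ℝ) ≤ ℓ := by linarith
  have : (0 : ℝ) ≤ f := by linarith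
  gcongr

/-- With `u = O(k * log f)` bounding the parameters, the integers have `O(u⁵ M)` bits and there are
`O(2 ^ k * u³ * n³)` steps, so that the factors `k` and `log f` are needed to the power eight. -/
theorem exact_solution (c : ℕ) : ∃ (p : Program) (C : ℕ), p.IntegerOnly ∧
    ∀ (n k M : ℕ) (T : SimpleGraph (Fin k)) (G : SimpleGraph (Fin n)) (w : Sym2 (Fin n) → ℤ),
      1 ≤ n → 1 ≤ M → T.IsTree → (∀ e ∈ G.edgeSet, |w e| ≤ (M : ℤ)) →
      Solves p (intInput T G M w)
        (Outputs T G fun φ => ∀ ψ : T.Copy G, copyWeight w φ ≤ copyWeight w ψ)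
        (softBound C (2 ^ k * (k : ℝ) ^ C * M * (n : ℝ) ^ 3))
        (1 / ((n : ℝ) + 1) ^ c) := by
  obtain ⟨wt, hwt⟩ : ∃ x, (exactProg c).weight = x := ⟨_, rfl⟩
  set K := wt * 24000 * (8 * (c + 2)) ^ 8 with hK
  refine ⟨exactProg c, K + 8, exactProg_integerOnly c, ?_⟩
  intro n k M T G w hn hM hT hw
  have hk : 1 ≤ k := by
    obtain ⟨v⟩ := hT.connected.nonempty
    exact v.pos
  set b := Nat.clog 2 (n + 1) with hb
  set d := k + c * b with hd
  set β := wordBits k b d (2 * M) with hβ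
  have hnb : n + 1 ≤ 2 ^ b := by rw [hb]; exact Nat.le_pow_clog (by norm_num) _
  obtain ⟨par, r, hrun⟩ := ok_exactProg (c := c) hT hw hk hb hd le_rfl
  have hβ' := hβ
  unfold wordBits at hβ'
  refine solves_of_ok (fun ω => memBdd_intInput hw ((bits_le_of_lt (m := b) (by positivity)
    (by exact_mod_cast hnb)).trans (by omega)) (by omega) (by omega) (by omega) ω) hrun ?_ ?_
  · rw [hwt]
    have hu : b + d + 1 ≤ (c + 2) * k * (b + 1) := by
      have h1 : 1 * b ≤ k * b := Nat.mul_le_mul_right _ hk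
      have h2 : c * (1 * b) ≤ c * (k * b) := Nat.mul_le_mul_left _ h1
      have h3 : (c + 2) * k * (b + 1) = c * (k * b) + c * k + 2 * (k * b) + 2 * k := by ring
      rw [one_mul] at h1 h2
      omega
    set u := (c + 2) * k * (b + 1) with hu'
    have h1 := wordBits_le (W := 2 * M) (by omega : k ≤ d) hu
    have h2 := coreSteps_le (u := u) hn hk (by omega)
    have h3 := paramSteps_le hn hk (by omega : k ≤ d) hu
    have h4 : n * n ≤ 2 ^ k * u ^ 3 * n ^ 3 := by
      have hu1 : 1 ≤ u := by omega
      calc n * n = n ^ 2 := (sq n).symm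
        _ ≤ n ^ 3 := Nat.pow_le_pow_right hn (by norm_num)
        _ ≤ _ := Nat.le_mul_of_pos_left _ (by positivity)
    have h5 : 1 * 1 ≤ n * n := Nat.mul_le_mul hn hn
    have h6 : k * (k * (k * 6 + 4) + 10) + 10 + paramSteps n k b d +
        (n * n * 6 + 5 + coreSteps n k) ≤ 200 * (2 ^ k * u ^ 3 * n ^ 3) := by omega
    have h7 : wt * (β + 1) * (k * (k * (k * 6 + 4) + 10) + 10 +
        paramSteps n k b d + (n * n * 6 + 5 + coreSteps n k)) ≤
        wt * (40 * u ^ 5 * (3 * M)) * (200 * (2 ^ k * u ^ 3 * n ^ 3)) := by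
      gcongr
      exact h1.trans (Nat.mul_le_mul_left _ (by omega))
    set f : ℝ := 2 ^ k * (k : ℝ) ^ (K + 8) * M * (n : ℝ) ^ 3 with hf
    have hn' : (1 : ℝ) ≤ n := by exact_mod_cast hn
    have hk' : (1 : ℝ) ≤ k := by exact_mod_cast hk
    have hM' : (1 : ℝ) ≤ M := by exact_mod_cast hM
    have hg : 2 ^ k * (k : ℝ) ^ 8 * M * (n : ℝ) ^ 3 ≤ f := by
      rw [hf]
      gcongr
      omega
    have hnf : (n : ℝ) ≤ f := by
      refine le_trans ?_ hg
      have e1 : (1 : ℝ) ≤ 2 ^ k * (k : ℝ) ^ 8 * M :=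
        one_le_mul_of_one_le_of_one_le (one_le_mul_of_one_le_of_one_le
          (one_le_pow₀ (by norm_num)) (one_le_pow₀ hk')) hM'
      calc (n : ℝ) ≤ (n : ℝ) ^ 3 := le_self_pow₀ hn' (by norm_num)
        _ ≤ _ := le_mul_of_one_le_left (by positivity) e1
    have hf1 : 1 ≤ f := hn'.trans hnf
    have hlog := clog_add_one_le (N := n + 1) (f := f) (by push_cast; linarith) hf1
    rw [← hb] at hlog
    refine mul_le_softBound (K := K) (g := 2 ^ k * (k : ℝ) ^ 8 * M * (n : ℝ) ^ 3) (by omega)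
      (by omega) (by positivity) hg rfl (one_le_log hf1) ?_
    refine (Nat.cast_le.2 h7).trans ?_
    calc ((wt * (40 * u ^ 5 * (3 * M)) * (200 * (2 ^ k * u ^ 3 * n ^ 3)) : ℕ) : ℝ)
        = (wt * 24000 * (c + 2) ^ 8 : ℕ) *
          (2 ^ k * (k : ℝ) ^ 8 * M * (n : ℝ) ^ 3) * ((b : ℝ) + 1) ^ 8 := by
          rw [hu']
          push_cast
          ring
      _ ≤ (wt * 24000 * (c + 2) ^ 8 : ℕ) *
          (2 ^ k * (k : ℝ) ^ 8 * M * (n : ℝ) ^ 3) * (8 * Real.log (f + 2)) ^ 8 := by gcongr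
      _ = _ := by
          rw [hK]
          push_cast
          ring
  · refine coinMeasure_not_favorable_le.trans (ENNReal.ofReal_le_ofReal ?_)
    have := two_mul_div_two_pow_le (j := 0) hk hnb (by omega : k + c * b + 0 ≤ d)
    simpa using this


/-! ### The scale of the minimum weight -/

/-- Compute the numbers `2 ^ 2 ^ i` up to the first one that is not less than the bound for the
weights, by repeated squaring. -/
def sqProg : Program :=
  .setReal 2 0 (.ofInt 2) ;; .assign vL 0 ;;
  .loop (.realLt (.read 2 (.var vL)) (.read 0 0))
    (.setReal 2 (.var vL + 1) (.read 2 (.var vL) * .read 2 (.var vL)) ;;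
      .assign vL (.var vL + 1))

theorem ok_sqProg {β : ℕ} {s : State} {M : ℝ} {L : ℕ} (hM : s.real 0 0 = M)
    (h1 : M ≤ 2 ^ 2 ^ L) (h2 : ∀ j < L, (2 : ℝ) ^ 2 ^ j < M) (hβ : bits (L : ℤ) ≤ β) :
    Ok β sqProg s (L * 3 + 3) fun s' =>
      s'.int vL 0 = L ∧ ∀ i ≤ L, s'.real 2 i = 2 ^ 2 ^ i := by
  have h0 : bits 0 ≤ β := le_trans (by simp [bits]) hβ
  refine ok_seq (R := fun t => t.real 2 0 = 2) 1 (L * 3 + 2) (by omega)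
    (ok_setReal le_rfl (by simp) (by simp) (by simp)) ?_
  intro s₁ hf₁ hB₁
  have hM₁ : s₁.real 0 0 = M := by rw [hf₁.real 0 (by decide), hM]
  refine ok_seq (R := fun t => t.int vL 0 = 0 ∧ t.real = s₁.real) 1 (L * 3 + 1) (by omega)
    (ok_assign le_rfl (by simp) (by simpa using h0) (by simp)) ?_
  rintro s₂ hf₂ ⟨hL₂, hr₂⟩
  refine ok_loop L 2 (fun j t => t.int vL 0 = j ∧ ∀ i ≤ j, t.real 2 i = 2 ^ 2 ^ i) le_rfl
    ⟨by simpa using hL₂, fun i hi => ?_⟩ ?_ ?_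
  · obtain rfl : i = 0 := by omega
    simp [hr₂, hB₁]
  · rintro j hj t _ hf ⟨hL, hB⟩
    have hMt : t.real 0 0 = M := by rw [hf.real 0 (by decide), hr₂, hM₁]
    refine ⟨by simp, ?_, ?_⟩
    · simpa [hL, hB j le_rfl, hMt] using h2 j hj
    · refine ok_seq (R := fun t' => t'.int vL 0 = j ∧ ∀ i ≤ j + 1, t'.real 2 i = 2 ^ 2 ^ i) 1 1
        le_rfl (ok_setReal le_rfl (by simp) (by simp) ⟨by simpa using hL, fun i hi => ?_⟩) ?_
      · rw [State.setReal_real_same, Function.update_apply]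
        simp only [IntExpr.eval_add, IntExpr.eval_var, IntExpr.eval_one, hL]
        split_ifs with h
        · obtain rfl : i = j + 1 := by exact_mod_cast h
          simp only [RealExpr.eval_mul, RealExpr.eval_read, IntExpr.eval_var, hL, hB j le_rfl]
          rw [← pow_add]
          congr 1
          rw [pow_succ]
          ring
        · exact hB i (by
            have : i ≠ j + 1 := fun h' => h (by exact_mod_cast h')
            omega)
      · rintro t' - ⟨hL', hB'⟩
        have hv : (IntExpr.var vL + 1).eval t' = ((j + 1 : ℕ) : ℤ) := by simp [hL']
        refine ok_assign le_rfl (by simp) ?_ ⟨?_, ?_⟩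
        · rw [hv]; exact (bits_natCast_mono (by omega)).trans hβ
        · rw [hv]; simp
        · simpa using hB'
  · rintro t _ hf ⟨hL, hB⟩
    have hMt : t.real 0 0 = M := by rw [hf.real 0 (by decide), hr₂, hM₁]
    refine ⟨by simp, ?_, hL, hB⟩
    simpa [hL, hB L le_rfl, hMt] using h1

/-- The adjacency matrix of the graph of the edges of weight at most `θ`. -/
noncomputable def adjLe {n : ℕ} (G : SimpleGraph (Fin n)) (w : Sym2 (Fin n) → ℝ) (θ : ℝ)
    (v u : ℕ) : ℕ :=
  open Classical in if weightNum G w v u ≤ θ then adjNum G v u else 0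

theorem adjLe_le_one {n : ℕ} (G : SimpleGraph (Fin n)) (w : Sym2 (Fin n) → ℝ) (θ : ℝ)
    (v u : ℕ) : adjLe G w θ v u ≤ 1 := by
  unfold adjLe
  have := adjNum_le_one G v u
  split_ifs <;> omega

theorem adjLe_eq_one {n : ℕ} {G : SimpleGraph (Fin n)} {w : Sym2 (Fin n) → ℝ} {θ : ℝ}
    {v u : ℕ} : adjLe G w θ v u = 1 ↔ adjNum G v u = 1 ∧ weightNum G w v u ≤ θ := by
  unfold adjLe
  split_ifs with h <;> simp [h]

/-- Keep the edges of weight at most the threshold in the real variable `6`. -/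
def thresholdProg : Program :=
  .forTo iE (.read 0 0 * .read 0 0)
    (.cond (.realLe (.read 1 (.var iE)) (.var 6))
      (.setInt aADJ (.var iE) (.read 2 (.var iE))) (.setInt aADJ (.var iE) 0))

theorem ok_thresholdProg {β n : ℕ} {s : State} {G : SimpleGraph (Fin n)} {w : Sym2 (Fin n) → ℝ}
    {θ : ℝ} (hn : s.int 0 0 = n) (hG : s.int 2 = rowMajor n (adjTable G))
    (hw : s.real 1 = rowMajor n (weightTable G w)) (hθ : s.real 6 0 = θ)
    (hβ : bits (n * n : ℕ) ≤ β) :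
    Ok β thresholdProg s (n * n * 4 + 2) fun s' => ∀ v < n, ∀ u < n,
      s'.int aADJ (v * n + u : ℕ) = adjLe G w θ v u ∧ adjLe G w θ v u ≤ 1 := by
  classical
  refine (ok_fill (a := aADJ) (n * n) 2 (fun j => if rowMajor n (weightTable G w) j ≤ θ then
    rowMajor n (adjTable G) j else 0) le_rfl hβ (by decide) (by decide) ?_ ?_).mono le_rfl ?_
  · intro t _ hf
    simp [hf.int 0 (by decide), hn]
  · intro j hj t ht hf hij _
    have h1 : t.int 2 = s.int 2 := hf.int 2 (by decide)
    have h2 : t.real = s.real := funext fun a => hf.real a (by simp [Program.forTo,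
      Program.assign, Program.reals])
    refine ok_cond 1 le_rfl (by simp) (fun h => ?_) (fun h => ?_)
    · simp only [Test.holds_realLe, RealExpr.eval_read, RealExpr.eval_var, IntExpr.eval_var, hij,
        h2, hw, hθ] at h
      refine ok_setInt le_rfl (by simp) (by simp) (ht _ _) ?_
      simp [hij, h1, hG, if_pos h]
    · simp only [Test.holds_realLe, RealExpr.eval_read, RealExpr.eval_var, IntExpr.eval_var, hij,
        h2, hw, hθ] at h
      refine ok_setInt le_rfl (by simp) (by simp) (le_trans ?_ (ht 0 0)) ?_
      · simp [bits]
      · simp [hij, if_neg h]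
  · rintro s' - ⟨h, -⟩ v hv u hu
    refine ⟨?_, adjLe_le_one G w θ v u⟩
    rw [h _ (cell_lt hv hu), rowMajor_weightTable G w hv hu, rowMajor_adjTable G hv hu, adjLe]
    split_ifs <;> simp

/-- A binary search for the scale: the thresholds for which `E` fails are enlarged. -/
noncomputable def scale (E : ℝ → Prop) (L : ℕ) : ℕ → ℝ
  | 0 => 1
  | j + 1 => open Classical in if E (scale E L j * 2 ^ 2 ^ (L - 1 - j)) then scale E L j
      else scale E L j * 2 ^ 2 ^ (L - 1 - j)

/-- After `j` rounds the threshold is known up to a factor `2 ^ 2 ^ (L - j)`, finally up to two. -/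
theorem scale_spec {E : ℝ → Prop} {L : ℕ} (hE : E (2 ^ 2 ^ L)) : ∀ j ≤ L,
    1 ≤ scale E L j ∧ (scale E L j = 1 ∨ ¬ E (scale E L j)) ∧
      E (scale E L j * 2 ^ 2 ^ (L - j))
  | 0, _ => by simpa [scale] using hE
  | j + 1, hj => by
    obtain ⟨h1, h2, h3⟩ := scale_spec hE j (by omega)
    have e1 : L - 1 - j = L - (j + 1) := by omega
    have h4 : (1 : ℝ) ≤ 2 ^ 2 ^ (L - 1 - j) := one_le_pow₀ (by norm_num)
    rw [scale]
    split_ifs with h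
    · exact ⟨h1, h2, e1 ▸ h⟩
    · refine ⟨one_le_mul_of_one_le_of_one_le h1 h4, Or.inr h, ?_⟩
      rw [← e1, mul_assoc, ← pow_add, ← two_mul, ← pow_succ', show L - 1 - j + 1 = L - j by omega]
      exact h3

/-- Find the scale of the bottleneck weight: a number, in the real variable `3`, such that some
embedding uses only edges of at most twice that weight, but unless the number is one, none uses
only edges of at most that weight. -/
def scaleProg : Program :=
  .setReal 3 0 (.ofInt 1) ;;
  .assign vNSLOTS (.var vDEG) ;;
  .forTo iI (.var vL)
    (.setReal 6 0 (.var 3 * .read 2 (.var vL - .var iI - 1)) ;;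
      thresholdProg ;; detectProg ;;
      .cond (.intEq (.var vQ) 0) (.setReal 3 0 (.var 6)) .skip)

/-- A bound for the number of steps of `scaleProg`. -/
def scaleSteps (n k L : ℕ) : ℕ := L * (n * n * 7 + evalSteps n k + 11) + 4

section
variable {n k b d L : ℕ} {G : SimpleGraph (Fin n)} {ord par : ℕ → ℕ} {ω : ℕ → Bool} {s : State}
  {w : Sym2 (Fin n) → ℝ}

/-- The thresholds that are tested when all tests are correct are given by `scale E L` and do not
depend on the coins. Therefore it suffices that the coins are favorable for these `L` thresholds.
-/
theorem ok_scaleProg {β : ℕ} {A : ℕ → ℕ → ℕ} (h : Ready s n k b d A ord par ω) (hk : 1 ≤ k)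
    (hd : 1 ≤ d) (hb : n + 1 ≤ 2 ^ b) (hG : s.int 2 = rowMajor n (adjTable G))
    (hw : s.real 1 = rowMajor n (weightTable G w)) (hL : s.int vL 0 = L)
    (hB : ∀ i ≤ L, s.real 2 i = 2 ^ 2 ^ i) (hW : s.int aWT = fun _ => 0)
    (hF : s.int aFIX = fun _ => 0) (hβL : bits (L : ℤ) ≤ β) (hβ : wordBits k b d 0 ≤ β) :
    let E := fun θ => ∃ φ : Fin k → Fin n, IsEmb par (adjLe G w θ) φ
    Ok β scaleProg s (scaleSteps n k L) fun s' => ∃ cur : ℝ, s'.real 3 0 = cur ∧ 1 ≤ cur ∧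
      ((∀ j < L, Favorable n k d par (adjLe G w (scale E L j * 2 ^ 2 ^ (L - 1 - j)))
        (fun _ _ => 0) ω) → cur = scale E L L) := by
  intro E
  have hβ' := hβ
  unfold wordBits at hβ'
  have hsq : bits (n * n : ℕ) ≤ β := bits_sq_le hb (by omega)
  have hS1 : 1 ≤ slotBits k b d := by unfold slotBits; omega
  have hDS := Nat.mul_le_mul_right ((k * 0 + 1) * (2 * k * d)) hS1
  refine ok_seq (R := fun t => t.real 3 0 = 1) 1
    (L * (n * n * 7 + evalSteps n k + 11) + 3) (by unfold scaleSteps; omega)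
    (ok_setReal le_rfl (by simp) (by simp) (by simp)) ?_
  intro s₁ hf₁ hc₁
  have hD₁ : s₁.int vDEG 0 = (2 * k * d : ℕ) := by rw [hf₁.int _ (by decide), h.deg_eq]
  refine ok_seq (R := fun t => t.int vNSLOTS 0 = (2 * k * d : ℕ) ∧ t.real = s₁.real) 1
    (L * (n * n * 7 + evalSteps n k + 11) + 2) (by omega)
    (ok_assign le_rfl (by simp) ?_ ?_) ?_
  · rw [IntExpr.eval_var, hD₁]; exact bits_natCast_le (by omega)
  · simp [hD₁]
  rintro s₂ hf₂ ⟨hN₂, hr₂⟩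
  have keep₂ : ∀ a, a ≠ vNSLOTS → s₂.int a = s.int a := fun a ha => by
    rw [hf₂.int a (by simpa [Program.ints, Program.assign] using ha), hf₁.int a (by simp
      [Program.ints])]
  have hB₂ : s₂.real 2 = s.real 2 := by rw [hr₂, hf₁.real 2 (by decide)]
  have hw₂ : s₂.real 1 = s.real 1 := by rw [hr₂, hf₁.real 1 (by decide)]
  -- without any assumption on the coins, the number stays at least one, and the program halts
  refine ok_forTo L (n * n * 7 + evalSteps n k + 9) (fun j t => ∃ cur : ℝ, t.real 3 0 = cur ∧
    1 ≤ cur ∧ ((∀ i < j, Favorable n k d par (adjLe G w (scale E L i * 2 ^ 2 ^ (L - 1 - i)))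
        (fun _ _ => 0) ω) → cur = scale E L j)) le_rfl hβL (by decide) ?_ ?_ ?_ ?_
  · intro t _ hf
    simp [hf.int vL (by decide), keep₂ vL (by decide), hL]
  · exact ⟨1, by simp [hr₂, hc₁], le_rfl, fun _ => rfl⟩
  · rintro j hj t _ hf hij ⟨cur, hcur, hcur1, hfav⟩
    have keep : ∀ a, a ∉ (Program.assign vNSLOTS 0 ;; Program.forTo iI 0 (thresholdProg ;;
        detectProg)).ints → t.int a = s.int a := fun a ha => by
      rw [hf.int a (fun h' => ha ?_), keep₂ a (fun h' => ha (by subst h'; decide))]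
      simp only [Program.ints, Program.forTo, Program.assign, List.mem_append, List.mem_cons,
        List.append_nil, List.nil_append] at h' ⊢
      tauto
    have hvi : (IntExpr.var vL - .var iI - 1).eval t = ((L - 1 - j : ℕ) : ℤ) := by
      simp only [IntExpr.eval_sub, IntExpr.eval_var, IntExpr.eval_one, hij, keep vL (by decide), hL]
      omega
    have hB : t.real 2 (L - 1 - j : ℕ) = 2 ^ 2 ^ (L - 1 - j) := by
      rw [hf.real 2 (by decide), hB₂, hB _ (by omega)]
    refine ok_seq (R := fun t' => t'.real 6 0 = cur * 2 ^ 2 ^ (L - 1 - j) ∧ t'.real 3 0 = cur) 1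
      (n * n * 7 + evalSteps n k + 8) (by omega) (ok_setReal le_rfl (by simp) (by simp) ⟨?_, ?_⟩) ?_
    · rw [State.setReal_real_same, IntExpr.eval_zero, Function.update_self, RealExpr.eval_mul,
        RealExpr.eval_read, hvi, hB, RealExpr.eval_var, hcur]
    · rw [State.setReal_real_ne _ _ _ (by decide), hcur]
    rintro t₁ hg₁ ⟨hθ₁, hcur₁⟩
    have i1 : ∀ a, t₁.int a = t.int a := fun a => hg₁.int a (by simp [Program.ints])
    refine ok_seq _ (n * n * 3 + evalSteps n k + 6) (by omega) (ok_thresholdProg (G := G) (w := w)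
      (by rw [i1, keep 0 (by decide), h.n_eq]) (by rw [i1, keep 2 (by decide), hG])
      (by rw [hg₁.real 1 (by decide), hf.real 1 (by decide), hw₂, hw]) hθ₁ hsq) ?_
    intro t₂ hg₂ hA₂
    have hR₂ := h.congr (s' := t₂) (by rw [hg₂.int _ (by decide), i1, keep _ (by decide)])
      (by rw [hg₂.int _ (by decide), i1, keep _ (by decide)])
      (by rw [hg₂.int _ (by decide), i1, keep _ (by decide)])
      (by rw [hg₂.int _ (by decide), i1, keep _ (by decide)])
      (by rw [hg₂.int _ (by decide), i1, keep _ (by decide)])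
      (by rw [hg₂.int _ (by decide), i1, keep _ (by decide)])
    have hinst := hR₂.toInstance (r := fun _ _ => 0) (W := 0) hk (by omega) hA₂ (fun v _ u _ => by
      rw [hg₂.int _ (by decide), i1, keep _ (by decide), hW]; simp)
    have hN₂' : t₂.int vNSLOTS 0 = (2 * k * d : ℕ) := by
      rw [hg₂.int _ (by decide), i1, hf.int _ (by decide), hN₂]
    refine ok_seq _ 2 (by omega) (ok_detectProg hinst hN₂' (fun p _ => by
      rw [hg₂.int _ (by decide), i1, keep _ (by decide), hF]) (by omega) (by
      have : (k * 0 + 1) * (2 * k * d) = 2 * k * d := by ring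
      rw [this] at hβ'
      omega) (by omega) hsq) ?_
    rintro t₃ hg₃ ⟨-, hQ₃⟩
    have hdet : Favorable n k d par (adjLe G w (cur * 2 ^ 2 ^ (L - 1 - j))) (fun _ _ => 0) ω →
        (t₃.int vQ 0 = 0 ↔ ¬ E (cur * 2 ^ 2 ^ (L - 1 - j))) := fun hfv => by
      rw [hQ₃, Nat.cast_eq_zero]
      exact detect_eq_zero_iff (W := 0) hfv hk hd (by omega)
        (fun p h1 h2 => (h.isOrder.par_lt p h1 (by omega)).1) (fun v _ u _ => adjLe_le_one G w _ v u)
        (fun _ _ _ _ => le_rfl) (by simp)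
    have h3 : t₃.real 3 0 = cur := by
      rw [hg₃.real _ (by decide), hg₂.real _ (by decide), hcur₁]
    have h6 : t₃.real 6 0 = cur * 2 ^ 2 ^ (L - 1 - j) := by
      rw [hg₃.real _ (by decide), hg₂.real _ (by decide), hθ₁]
    refine ok_cond 1 le_rfl (by simp) (fun hQ => ?_) (fun hQ => ?_)
    · simp only [Test.holds_intEq, IntExpr.eval_var, IntExpr.eval_zero] at hQ
      refine ok_setReal le_rfl (by simp) (by simp) ⟨cur * 2 ^ 2 ^ (L - 1 - j), by simp [h6],
        one_le_mul_of_one_le_of_one_le hcur1 (one_le_pow₀ (by norm_num)), fun hfv => ?_⟩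
      have h7 := hfav fun i hi => hfv i (by omega)
      have h8 := hfv j (by omega)
      rw [← h7] at h8
      rw [scale, if_neg (by rw [← h7]; exact (hdet h8).1 hQ), ← h7]
    · simp only [Test.holds_intEq, IntExpr.eval_var, IntExpr.eval_zero] at hQ
      refine ok_skip le_rfl ⟨cur, by simpa using h3, hcur1, fun hfv => ?_⟩
      have h7 := hfav fun i hi => hfv i (by omega)
      have h8 := hfv j (by omega)
      rw [← h7] at h8
      rw [scale, if_pos (by rw [← h7]; exact not_not.1 fun hn => hQ ((hdet h8).2 hn)), ← h7]
  · exact fun t _ ht => ht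

end


/-! ### Rounding the weights -/

/-- Round the weights of the edges that are not too heavy down to multiples of a unit, which is
the scale times the accuracy divided by `k`. -/
def roundProg : Program :=
  .cond (.realLt (.read 0 1) (.ofInt 1)) (.setReal 4 0 (.read 0 1)) (.setReal 4 0 (.ofInt 1)) ;;
  .setReal 5 0 (.var 4 * .var 3 / .ofInt (.read 0 1)) ;;
  .setReal 6 0 (.ofInt (2 * .read 0 1) * .var 3) ;;
  .assign vMI 0 ;;
  .loop (.realLt (.ofInt (.var vMI) * .var 4) (.ofInt (2 * .read 0 1 * .read 0 1)))
    (.assign vMI (.var vMI + 1)) ;;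
  thresholdProg ;;
  .forTo iE (.read 0 0 * .read 0 0) (.assign vR 0 ;;
    .cond (.realLe (.read 1 (.var iE)) (.var 6))
      (.loop (.realLe (.ofInt (.var vR + 1) * .var 5) (.read 1 (.var iE)))
        (.assign vR (.var vR + 1))) .skip ;;
    .setInt aWT (.var iE) (.var vR))

/-- The rounded weights. -/
noncomputable def roundWeight {n : ℕ} (G : SimpleGraph (Fin n)) (w : Sym2 (Fin n) → ℝ) (θ δ : ℝ)
    (v u : ℕ) : ℕ :=
  open Classical in if weightNum G w v u ≤ θ then ⌊weightNum G w v u / δ⌋₊ else 0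

/-- A bound for the rounded weights. -/
noncomputable def maxRounded (k : ℕ) (ε : ℝ) : ℕ := ⌈2 * k * k / min ε 1⌉₊

theorem roundWeight_le {n k : ℕ} {G : SimpleGraph (Fin n)} {w : Sym2 (Fin n) → ℝ} {cur ε : ℝ}
    (hk : 1 ≤ k) (hcur : 1 ≤ cur) (hε : 0 < ε) (v u : ℕ) :
    roundWeight G w (2 * k * cur) (min ε 1 * cur / k) v u ≤ maxRounded k ε := by
  have hk' : (0 : ℝ) < k := by exact_mod_cast hk
  have hm : 0 < min ε 1 := lt_min hε one_pos
  unfold roundWeight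
  split_ifs with h
  · refine (Nat.floor_le_floor ?_).trans (Nat.floor_le_ceil _)
    rw [div_le_div_iff₀ (by positivity) hm]
    calc weightNum G w v u * min ε 1 ≤ 2 * k * cur * min ε 1 := by gcongr
      _ = _ := by field_simp
  · exact Nat.zero_le _

/-- A bound for the number of steps of `roundProg`. -/
def roundSteps (n m : ℕ) : ℕ := n * n * (2 * m + 10) + 2 * m + 12

section
variable {n k : ℕ} {G : SimpleGraph (Fin n)} {s : State} {w : Sym2 (Fin n) → ℝ}

theorem rowMajor_weightTable_nonneg (hw0 : ∀ e ∈ G.edgeSet, 0 ≤ w e) (c : ℤ) :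
    0 ≤ rowMajor n (weightTable G w) c := by
  rcases rowMajor_eq_zero_or (weightTable G w) c with h | ⟨i, j, h⟩
  · rw [h]
  · rw [h]
    unfold weightTable
    split_ifs with h2
    · exact hw0 _ h2
    · exact le_rfl

/-- There are no conversions of reals to integers, so the rounded weights are found by counting up;
the counter is bounded, because heavier edges are left out. -/
theorem ok_roundProg {β : ℕ} {cur ε : ℝ} (hn : s.int 0 0 = n) (hk : s.int 0 1 = k) (hk1 : 1 ≤ k)
    (hG : s.int 2 = rowMajor n (adjTable G)) (hw : s.real 1 = rowMajor n (weightTable G w))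
    (hw0 : ∀ e ∈ G.edgeSet, 0 ≤ w e) (hε : s.real 0 1 = ε) (hε0 : 0 < ε)
    (hcur : s.real 3 0 = cur) (hcur1 : 1 ≤ cur)
    (hβm : bits (maxRounded k ε : ℕ) ≤ β) (hβ : bits (n * n : ℕ) ≤ β) :
    Ok β roundProg s (roundSteps n (maxRounded k ε)) fun s' => s'.int vMI 0 = maxRounded k ε ∧
      ∀ v < n, ∀ u < n,
        (s'.int aADJ (v * n + u : ℕ) = adjLe G w (2 * k * cur) v u ∧
          adjLe G w (2 * k * cur) v u ≤ 1) ∧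
        s'.int aWT (v * n + u : ℕ) = roundWeight G w (2 * k * cur) (min ε 1 * cur / k) v u := by
  classical
  have hk' : (0 : ℝ) < k := by exact_mod_cast hk1
  have hm : 0 < min ε 1 := lt_min hε0 one_pos
  have h0 : bits 0 ≤ β := le_trans (by simp [bits]) hβ
  set m := maxRounded k ε with hmdef
  set δ := min ε 1 * cur / k with hδdef
  have hδ : 0 < δ := by positivity
  refine ok_seq (R := fun t => t.real 4 0 = min ε 1) 2 (n * n * (2 * m + 10) + 2 * m + 10)
    (by unfold roundSteps; omega) (ok_cond 1 le_rfl (by simp) (fun h => ?_) (fun h => ?_)) ?_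
  · simp only [Test.holds_realLt, RealExpr.eval_read, IntExpr.eval_one, hε, RealExpr.eval_ofInt,
      Int.cast_one] at h
    exact ok_setReal le_rfl (by simp) (by simp) (by simp [hε, h.le])
  · simp only [Test.holds_realLt, RealExpr.eval_read, IntExpr.eval_one, hε, RealExpr.eval_ofInt,
      Int.cast_one, not_lt] at h
    exact ok_setReal le_rfl (by simp) (by simp) (by simp [h])
  intro s₁ hf₁ he₁
  have i₁ : s₁.int = s.int := funext fun a => hf₁.int a (by simp [Program.ints])
  refine ok_seq (R := fun t => t.real 5 0 = δ ∧ t.real 4 0 = min ε 1 ∧ t.real 3 0 = cur ∧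
      t.int = s.int) 1 (n * n * (2 * m + 10) + 2 * m + 9) (by omega)
    (ok_setReal le_rfl (by simp) (by simp) ?_) ?_
  · simp [he₁, hf₁.real 3 (by decide), hcur, i₁, hk, hδdef]
  rintro s₂ hf₂ ⟨hd₂, he₂, hc₂, i₂⟩
  refine ok_seq (R := fun t => t.real 6 0 = 2 * k * cur ∧ t.real 5 0 = δ ∧
      t.real 4 0 = min ε 1 ∧ t.int = s.int) 1 (n * n * (2 * m + 10) + 2 * m + 8) (by omega)
    (ok_setReal le_rfl (by simp) (by simp) ?_) ?_
  · simp [hd₂, he₂, hc₂, i₂, hk]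
  rintro s₃ hf₃ ⟨ht₃, hd₃, he₃, i₃⟩
  have hw₃ : s₃.real 1 = rowMajor n (weightTable G w) := by
    rw [hf₃.real _ (by decide), hf₂.real _ (by decide), hf₁.real _ (by decide), hw]
  refine ok_seq (R := fun t => t.int vMI 0 = 0) 1 (n * n * (2 * m + 10) + 2 * m + 7) (by omega)
    (ok_assign le_rfl (by simp) (by simpa using h0) (by simp)) ?_
  intro s₄ hf₄ hm₄
  have r₄ : s₄.real = s₃.real := funext fun a => hf₄.real a (by simp [Program.assign,
    Program.reals])
  refine ok_seq (R := fun t => t.int vMI 0 = m) (m * 2 + 1) (n * n * (2 * m + 10) + 6) (by omega)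
    (ok_loop m 1 (fun j t => t.int vMI 0 = j) le_rfl (by simpa using hm₄) ?_ ?_) ?_
  · intro j hj t _ hf ht
    refine ⟨by simp, ?_, ok_assign le_rfl (by simp) ?_ ?_⟩
    · rw [hmdef, maxRounded, Nat.lt_ceil, lt_div_iff₀ hm] at hj
      simpa [ht, hf.real 4 (by decide), r₄, he₃, hf.int 0 (by decide), hf₄.int 0 (by decide), i₃,
        hk] using hj
    · simp only [IntExpr.eval_add, IntExpr.eval_var, IntExpr.eval_one, ht]
      exact le_trans (by exact_mod_cast bits_natCast_mono (m := j + 1) (m' := m) hj) hβm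
    · simp [ht]
  · intro t _ hf ht
    refine ⟨by simp, ?_, ht⟩
    have h1 : 2 * k * k / min ε 1 ≤ (m : ℝ) := Nat.le_ceil _
    rw [div_le_iff₀ hm] at h1
    simpa [ht, hf.real 4 (by decide), r₄, he₃, hf.int 0 (by decide), hf₄.int 0 (by decide), i₃,
      hk] using h1
  intro s₅ hf₅ hm₅
  have k₅ : ∀ a, a ≠ vMI → s₅.int a = s.int a := fun a ha => by
    rw [hf₅.int a (by simpa [Program.ints, Program.assign] using ha),
      hf₄.int a (by simpa [Program.ints, Program.assign] using ha), i₃]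
  have r₅ : s₅.real = s₃.real := by
    rw [← r₄]
    exact funext fun a => hf₅.real a (by simp [Program.assign, Program.reals])
  refine ok_seq (n * n * 4 + 2) (n * n * (2 * m + 6) + 2) (by nlinarith)
    (ok_thresholdProg (G := G) (w := w) (by rw [k₅ _ (by decide), hn])
      (by rw [k₅ _ (by decide), hG]) (by rw [r₅, hw₃]) (by rw [r₅, ht₃]) hβ) ?_
  intro s₆ hf₆ hA₆
  have r₆ : s₆.real = s₃.real := by
    rw [← r₅]
    exact funext fun a => hf₆.real a (by simp [thresholdProg, Program.forTo, Program.assign,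
      Program.reals])
  -- the loop for cell `j` stops at the rounded weight, which is at most `m`
  refine (ok_fill (a := aWT) (n * n) (2 * m + 4) (fun j =>
    if rowMajor n (weightTable G w) j ≤ 2 * k * cur then
      (⌊rowMajor n (weightTable G w) j / δ⌋₊ : ℤ) else 0) le_rfl hβ (by decide) (by decide)
    ?_ ?_).mono le_rfl ?_
  · intro t _ hf
    simp [hf.int 0 (by decide), hf₆.int 0 (by decide), k₅, hn]
  · intro j hj t ht hf hij _
    have rt : t.real = s₃.real := by
      rw [← r₆]
      exact funext fun a => hf.real a (by simp [Program.forTo, Program.assign, Program.reals])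
    set wj := rowMajor n (weightTable G w) j with hwj
    have hwj0 : 0 ≤ wj / δ := div_nonneg (rowMajor_weightTable_nonneg hw0 _) hδ.le
    have hle : wj ≤ 2 * k * cur → ⌊wj / δ⌋₊ ≤ m := fun h => by
      refine (Nat.floor_le_floor ?_).trans (Nat.floor_le_ceil _)
      rw [div_le_div_iff₀ (by positivity) hm]
      calc wj * min ε 1 ≤ 2 * k * cur * min ε 1 := by gcongr
        _ = _ := by rw [hδdef]; field_simp
    refine ok_seq (R := fun t' => t'.int vR 0 = 0 ∧ t'.int aWT = t.int aWT) 1 (2 * m + 3)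
      (by omega) (ok_assign le_rfl (by simp) (by simpa using h0) (by simp)) ?_
    rintro t₁ hg₁ ⟨hr₁, hw₁⟩
    have rt₁ : t₁.real = s₃.real := by
      rw [← rt]
      exact funext fun a => hg₁.real a (by simp [Program.assign, Program.reals])
    have hij₁ : t₁.int iE 0 = j := by rw [hg₁.int _ (by decide), hij]
    refine ok_seq (R := fun t' => t'.int vR 0 = (if wj ≤ 2 * k * cur then (⌊wj / δ⌋₊ : ℤ) else 0))
      (2 * m + 2) 1 (by omega) (ok_cond (2 * m + 1) le_rfl (by simp) (fun h => ?_) (fun h => ?_)) ?_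
    · simp only [Test.holds_realLe, RealExpr.eval_read, RealExpr.eval_var, IntExpr.eval_var, hij₁,
        rt₁, hw₃, ht₃] at h
      rw [if_pos h]
      refine ok_loop ⌊wj / δ⌋₊ 1 (fun i t' => t'.int vR 0 = i) (by have := hle h; omega)
        (by simpa using hr₁) ?_ ?_
      · intro i hi t' _ hf' ht'
        refine ⟨by simp, ?_, ok_assign le_rfl (by simp) ?_ ?_⟩
        · have h1 : ((i + 1 : ℕ) : ℝ) ≤ wj / δ := (Nat.le_floor_iff hwj0).1 hi
          rw [le_div_iff₀ hδ] at h1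
          simpa [ht', hf'.real 5 (by decide), hf'.real 1 (by decide), rt₁, hd₃, hw₃,
            hf'.int iE (by decide), hij₁] using h1
        · simp only [IntExpr.eval_add, IntExpr.eval_var, IntExpr.eval_one, ht']
          have h1 : i + 1 ≤ m := hi.trans_le (hle h)
          exact le_trans (by exact_mod_cast bits_natCast_mono h1) hβm
        · simp [ht']
      · intro t' _ hf' ht'
        refine ⟨by simp, ?_, ht'⟩
        have h1 : wj / δ < (⌊wj / δ⌋₊ : ℝ) + 1 := Nat.lt_floor_add_one _
        rw [div_lt_iff₀ hδ] at h1
        simpa [ht', hf'.real 5 (by decide), hf'.real 1 (by decide), rt₁, hd₃, hw₃,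
            hf'.int iE (by decide), hij₁] using h1
    · simp only [Test.holds_realLe, RealExpr.eval_read, RealExpr.eval_var, IntExpr.eval_var, hij₁,
        rt₁, hw₃, ht₃] at h
      refine ok_skip (by omega) ?_
      rw [if_neg h, hr₁]
    · intro t₂ hg₂ hr₂
      refine ok_of_memBdd fun hb₂ => ok_setInt le_rfl (by simp) (by simp) (hb₂ _ _) ?_
      simp only [State.setInt_int_same, IntExpr.eval_var, hr₂, hg₂.int iE (by decide), hij₁,
        hg₂.int aWT (by decide), hw₁]
  · rintro s' hf' ⟨hW, -⟩
    refine ⟨by rw [hf'.int _ (by decide), hf₆.int _ (by decide), hm₅], fun v hv u hu => ⟨?_, ?_⟩⟩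
    · rw [hf'.int _ (by decide)]
      exact hA₆ v hv u hu
    · rw [hW _ (cell_lt hv hu), rowMajor_weightTable G w hv hu, roundWeight]
      split_ifs <;> simp

end


/-! ### The approximation algorithm -/

/-- Everything but the final search. -/
def approxPrep (c : ℕ) : Program :=
  ordProg ;; sqProg ;; logProg vBL (.var vL + 2) ;; paramProg c ;; scaleProg ;; roundProg

/-- Determine the scale of the minimum weight, round the weights, and search. -/
def approxProg (c : ℕ) : Program :=
  approxPrep c ;; .assign vNSLOTS ((.read 0 1 * .var vMI + 1) * .var vDEG) ;; coreProg

section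
variable {k n b d L : ℕ} {T : SimpleGraph (Fin k)} {G : SimpleGraph (Fin n)}
  {w : Sym2 (Fin n) → ℝ} {M ε : ℝ} {ord par : ℕ → ℕ}

theorem isEmb_adjLe {θ : ℝ} {φ : Fin k → Fin n} : IsEmb par (adjLe G w θ) φ ↔
    IsEmb par (adjNum G) φ ∧
      ∀ p < k - 1, weightNum G w (ext φ (par (p + 1))) (ext φ (p + 1)) ≤ θ := by
  simp only [IsEmb, adjLe_eq_one]
  exact ⟨fun h => ⟨⟨h.1, fun p hp => (h.2 p hp).1⟩, fun p hp => (h.2 p hp).2⟩,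
    fun h => ⟨h.1.1, fun p hp => ⟨h.1.2 p hp, h.2 p hp⟩⟩⟩

theorem weightNum_mem {S : Set ℝ} (hw : ∀ e ∈ G.edgeSet, w e ∈ S) {v u : ℕ}
    (h : adjNum G v u = 1) : weightNum G w v u ∈ S := by
  unfold adjNum at h
  split_ifs at h with h1 h2
  · rw [weightNum, dif_pos h1, weightTable, if_pos h2]
    exact hw _ h2

/-- Rounding down to multiples of a unit that is small compared to the minimum weight loses little,
and edges that are much heavier than the bottleneck weight are not needed. -/
theorem copyWeight_le_of_rounded (h : IsOrder k (adjNum T) ord par (k - 1)) (hT : T.IsTree)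
    (hk : 1 ≤ k) (hw : ∀ e ∈ G.edgeSet, w e ∈ Set.Icc 1 M) (hε : 0 < ε) {cur : ℝ} (hcur : 1 ≤ cur)
    (hlow : cur = 1 ∨ ¬ ∃ φ : Fin k → Fin n, IsEmb par (adjLe G w cur) φ)
    (hhigh : ∃ φ : Fin k → Fin n, IsEmb par (adjLe G w (2 * cur)) φ) {φ : T.Copy G}
    (hφ : IsEmb par (adjLe G w (2 * k * cur)) (h.embOfCopy φ))
    (hmin : ∀ ψ : Fin k → Fin n, IsEmb par (adjLe G w (2 * k * cur)) ψ →
      embWeight par (roundWeight G w (2 * k * cur) (min ε 1 * cur / k)) (h.embOfCopy φ) ≤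
        embWeight par (roundWeight G w (2 * k * cur) (min ε 1 * cur / k)) ψ)
    (ψ : T.Copy G) : copyWeight w φ ≤ (1 + ε) * copyWeight w ψ := by
  classical
  have hk' : (1 : ℝ) ≤ k := by exact_mod_cast hk
  have hm : 0 < min ε 1 := lt_min hε one_pos
  set δ := min ε 1 * cur / k with hδdef
  have hδ : 0 < δ := by positivity
  let wt : (Fin k → Fin n) → ℕ → ℝ := fun χ p =>
    weightNum G w (ext χ (par (p + 1))) (ext χ (p + 1))
  have h1 : ∀ χ, IsEmb par (adjNum G) χ → ∀ p ∈ Finset.range (k - 1), 1 ≤ wt χ p :=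
    fun χ hχ p hp => (weightNum_mem hw (hχ.2 p (Finset.mem_range.1 hp))).1
  have hsingle : ∀ χ, IsEmb par (adjNum G) χ → ∀ p < k - 1,
      wt χ p ≤ ∑ p ∈ Finset.range (k - 1), wt χ p := fun χ hχ p hp =>
    Finset.single_le_sum (fun q hq => zero_le_one.trans (h1 χ hχ q hq)) (Finset.mem_range.2 hp)
  -- every embedding weighs at least `cur`, unless the tree has no edges
  have hlower : ∀ χ, IsEmb par (adjNum G) χ → 2 ≤ k →
      cur ≤ ∑ p ∈ Finset.range (k - 1), wt χ p := by
    intro χ hχ h2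
    rcases hlow with rfl | hno
    · exact (h1 χ hχ 0 (Finset.mem_range.2 (by omega))).trans (hsingle χ hχ 0 (by omega))
    · have : ¬ ∀ p < k - 1, wt χ p ≤ cur := fun hall => hno ⟨χ, isEmb_adjLe.2 ⟨hχ, hall⟩⟩
      push Not at this
      obtain ⟨p, hp, hlt⟩ := this
      exact hlt.le.trans (hsingle χ hχ p hp)
  -- rounding loses less than one unit for each of the `k - 1` edges
  have hround : ∀ χ, IsEmb par (adjLe G w (2 * k * cur)) χ →
      (embWeight par (roundWeight G w (2 * k * cur) δ) χ : ℝ) * δ ≤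
        ∑ p ∈ Finset.range (k - 1), wt χ p ∧
      ∑ p ∈ Finset.range (k - 1), wt χ p ≤
        (embWeight par (roundWeight G w (2 * k * cur) δ) χ : ℝ) * δ + ((k : ℝ) - 1) * δ := by
    intro χ hχ
    obtain ⟨h2, h3⟩ := isEmb_adjLe.1 hχ
    have h4 : ∀ p ∈ Finset.range (k - 1), roundWeight G w (2 * k * cur) δ
        (ext χ (par (p + 1))) (ext χ (p + 1)) = ⌊wt χ p / δ⌋₊ := fun p hp => by
      rw [roundWeight, if_pos (h3 p (Finset.mem_range.1 hp))]
    have h5 : ((k : ℝ) - 1) * δ = ∑ _p ∈ Finset.range (k - 1), δ := by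
      rw [Finset.sum_const, Finset.card_range, nsmul_eq_mul, Nat.cast_sub hk, Nat.cast_one]
    rw [embWeight, Finset.sum_congr rfl h4, Nat.cast_sum, Finset.sum_mul, h5,
      ← Finset.sum_add_distrib]
    refine ⟨Finset.sum_le_sum fun p hp => ?_, Finset.sum_le_sum fun p hp => ?_⟩
    · rw [← le_div_iff₀ hδ]
      exact Nat.floor_le (div_nonneg (zero_le_one.trans (h1 χ h2 p hp)) hδ.le)
    · have := Nat.lt_floor_add_one (wt χ p / δ)
      rw [div_lt_iff₀ hδ, add_mul, one_mul] at this
      exact this.le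
  -- the total loss is at most `min ε 1 * cur`
  have hloss : ∀ χ, IsEmb par (adjNum G) χ →
      ((k : ℝ) - 1) * δ ≤ ε * ∑ p ∈ Finset.range (k - 1), wt χ p := by
    intro χ hχ
    rcases Nat.lt_or_ge k 2 with h2 | h2
    · obtain rfl : k = 1 := by omega
      simp
    · have h3 : ((k : ℝ) - 1) * δ ≤ k * δ := by gcongr; linarith
      have h4 : k * δ = min ε 1 * cur := by rw [hδdef]; field_simp
      have h5 := hlower χ hχ h2
      have h6 : min ε 1 ≤ ε := min_le_left _ _
      calc ((k : ℝ) - 1) * δ ≤ min ε 1 * cur := h3.trans_eq h4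
        _ ≤ ε * ∑ p ∈ Finset.range (k - 1), wt χ p := by gcongr
  have hmain : ∀ χ, IsEmb par (adjLe G w (2 * k * cur)) χ →
      copyWeight w φ ≤ (1 + ε) * ∑ p ∈ Finset.range (k - 1), wt χ p := by
    intro χ hχ
    have h2 := (hround _ hφ).2
    have h3 := (hround χ hχ).1
    have h4 := hloss χ (isEmb_adjLe.1 hχ).1
    have h5 : (embWeight par (roundWeight G w (2 * k * cur) δ) (h.embOfCopy φ) : ℝ) * δ ≤
        embWeight par (roundWeight G w (2 * k * cur) δ) χ * δ := by
      have := hmin χ hχ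
      gcongr
    rw [h.copyWeight_eq hT]
    linarith
  have hψ := h.isEmb_embOfCopy ψ
  rw [h.copyWeight_eq hT w ψ]
  by_cases hlight : ∀ p < k - 1, wt (h.embOfCopy ψ) p ≤ 2 * k * cur
  · exact hmain _ (isEmb_adjLe.2 ⟨hψ, hlight⟩)
  · -- a copy with a heavy edge weighs more than one of the lightest bottleneck copies
    push Not at hlight
    obtain ⟨p, hp, hlt⟩ := hlight
    obtain ⟨χ, hχ⟩ := hhigh
    obtain ⟨h2, h3⟩ := isEmb_adjLe.1 hχ
    have h4 : ∑ p ∈ Finset.range (k - 1), wt χ p ≤ 2 * k * cur := by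
      calc ∑ p ∈ Finset.range (k - 1), wt χ p ≤ ∑ _p ∈ Finset.range (k - 1), 2 * cur :=
            Finset.sum_le_sum fun q hq => h3 q (Finset.mem_range.1 hq)
        _ = ((k : ℝ) - 1) * (2 * cur) := by
            rw [Finset.sum_const, Finset.card_range, nsmul_eq_mul, Nat.cast_sub hk, Nat.cast_one]
        _ ≤ 2 * k * cur := by nlinarith
    have h5 : IsEmb par (adjLe G w (2 * k * cur)) χ :=
      isEmb_adjLe.2 ⟨h2, fun q hq => (h3 q hq).trans (by nlinarith)⟩
    refine (hmain χ h5).trans ?_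
    have h6 := hsingle _ hψ p hp
    have : ∑ p ∈ Finset.range (k - 1), wt χ p ≤
        ∑ p ∈ Finset.range (k - 1), wt (h.embOfCopy ψ) p := by linarith
    gcongr

theorem memBdd_realInput {β : ℕ} (hn : bits (n : ℤ) ≤ β) (hk : k + 1 ≤ β) (h2 : 2 ≤ β)
    (ω : ℕ → Bool) : MemBdd β (realInput T G M ε w ω) := by
  have h0 : bits 0 ≤ β := by simp [bits]; omega
  intro a c
  rcases a with _ | _ | _ | a
  · simp only [realInput]
    split_ifs
    exacts [hn, bits_natCast_le hk, h0]
  · exact (bits_rowMajor_adjTable_le T c).trans h2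
  · exact (bits_rowMajor_adjTable_le G c).trans h2
  · exact h0

/-- The search for the scale and the final search succeed. -/
def FavorableApprox (n d L : ℕ) (par : ℕ → ℕ) {k : ℕ} (G : SimpleGraph (Fin n))
    (w : Sym2 (Fin n) → ℝ) (ε : ℝ) (ω : ℕ → Bool) (E : ℝ → Prop) : Prop :=
  (∀ j < L, Favorable n k d par (adjLe G w (scale E L j * 2 ^ 2 ^ (L - 1 - j)))
    (fun _ _ => 0) ω) ∧
  Favorable n k d par (adjLe G w (2 * k * scale E L L))
    (roundWeight G w (2 * k * scale E L L) (min ε 1 * scale E L L / k)) ω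

/-- A bound for the number of steps of `approxPrep`. -/
def approxSteps (n k b d L m : ℕ) : ℕ :=
  k * (k * (k * 6 + 4) + 10) + 10 + paramSteps n k b d + (L * 3 + 3) + (2 * d + 2) +
    scaleSteps n k L + roundSteps n m

theorem ok_approxPrep {β c : ℕ} (hT : T.IsTree) (hw : ∀ e ∈ G.edgeSet, w e ∈ Set.Icc 1 M)
    (hε : 0 < ε) (hk : 1 ≤ k) (hb : b = Nat.clog 2 (n + 1))
    (hd : d = k + c * b + Nat.clog 2 (L + 2)) (hL1 : M ≤ 2 ^ 2 ^ L)
    (hL2 : ∀ j < L, (2 : ℝ) ^ 2 ^ j < M) (hβ : wordBits k b d 0 ≤ β)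
    (hβL : bits (L : ℤ) ≤ β) (hβm : bits (maxRounded k ε : ℕ) ≤ β) :
    ∃ ord par : ℕ → ℕ, IsOrder k (adjNum T) ord par (k - 1) ∧ ∀ ω,
      Ok β (approxPrep c) (realInput T G M ε w ω) (approxSteps n k b d L (maxRounded k ε))
      fun s' => Ready s' n k b d (adjNum T) ord par ω ∧ s'.int vMI 0 = maxRounded k ε ∧
        s'.int 4 = (fun _ => 0) ∧ s'.int aFIX = (fun _ => 0) ∧
        ∃ cur : ℝ, 1 ≤ cur ∧
        ((∀ j < L, Favorable n k d par (adjLe G w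
          (scale (fun θ => ∃ φ : Fin k → Fin n, IsEmb par (adjLe G w θ) φ) L j *
            2 ^ 2 ^ (L - 1 - j))) (fun _ _ => 0) ω) →
          cur = scale (fun θ => ∃ φ : Fin k → Fin n, IsEmb par (adjLe G w θ) φ) L L) ∧
        ∀ v < n, ∀ u < n, (s'.int aADJ (v * n + u : ℕ) = adjLe G w (2 * k * cur) v u ∧
            adjLe G w (2 * k * cur) v u ≤ 1) ∧
          s'.int aWT (v * n + u : ℕ) =
            roundWeight G w (2 * k * cur) (min ε 1 * cur / k) v u := by
  have hβ' := hβ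
  unfold wordBits at hβ'
  have hnb : n + 1 ≤ 2 ^ b := by rw [hb]; exact Nat.le_pow_clog (by norm_num) _
  have hsq : bits (n * n : ℕ) ≤ β := bits_sq_le hnb (by omega)
  have hSd := slotBits_ge (b := b) (d := d) hk
  have hkd : 1 * d ≤ 2 * k * d := Nat.mul_le_mul_right d (by omega)
  have hmem : ∀ ω, MemBdd β (realInput T G M ε w ω) := fun ω =>
    memBdd_realInput ((bits_le_of_lt (m := b) (by positivity)
      (by exact_mod_cast hnb)).trans (by omega)) (by omega) (by omega) ω
  obtain ⟨ord, par, hord, hrun⟩ := exists_order (A := adjNum T) (hmem fun _ => false)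
    (k := k) (by simp [realInput]) hk
    (fun u hu v hv => ⟨rowMajor_adjTable T hu hv, adjNum_le_one T u v⟩)
    (fun P h0 h => exists_adjNum_boundary hT.connected P h0 h) (fun _ _ => rfl) rfl (by omega)
  refine ⟨ord, par, hord, fun ω => ?_⟩
  set N₁ := k * (k * (k * 6 + 4) + 10) + 10 with hN₁
  refine ok_seq N₁ (L * 3 + 3 + (2 * d + 2) + paramSteps n k b d + scaleSteps n k L +
    roundSteps n (maxRounded k ε)) (by unfold approxSteps; omega) (hrun ω) ?_
  rintro s₁ hf₁ ⟨hO₁, hP₁⟩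
  have r₁ : s₁.real = (realInput T G M ε w ω).real := funext fun a => hf₁.real a (by
    simp [show ordProg.reals = [] from rfl])
  refine ok_seq (L * 3 + 3) ((2 * d + 2) + paramSteps n k b d + scaleSteps n k L +
    roundSteps n (maxRounded k ε)) (by omega)
    (ok_sqProg (by rw [r₁]; simp [realInput]) hL1 hL2 hβL) ?_
  rintro s₂ hf₂ ⟨hL₂, hB₂⟩
  refine ok_seq (2 * d + 2) (paramSteps n k b d + scaleSteps n k L +
    roundSteps n (maxRounded k ε)) (by omega)
    ((ok_logProg (N := L + 2) (fun t ht => ?_) (by omega)).mono (by omega) fun t _ ht => ht) ?_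
  · rw [IntExpr.eval_add, IntExpr.eval_var, ht vL (by decide), hL₂]
    simp
  intro s₃ hf₃ hBL₃
  have keep₃ : ∀ a, a ∉ (ordProg ;; sqProg ;; logProg vBL 0).ints →
      s₃.int a = (realInput T G M ε w ω).int a := fun a ha => by
    simp only [Program.ints, List.mem_append, not_or] at ha
    rw [hf₃.int a ha.2.2, hf₂.int a ha.2.1, hf₁.int a ha.1]
  refine ok_seq (paramSteps n k b d) (scaleSteps n k L + roundSteps n (maxRounded k ε)) (by omega)
    (ok_paramProg (c := c) (bL := Nat.clog 2 (L + 2)) (by rw [keep₃ _ (by decide)]; simp [realInput])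
      (by rw [keep₃ _ (by decide)]; simp [realInput]) hk hord
      (fun p hp => by rw [hf₃.int _ (by decide), hf₂.int _ (by decide), hO₁ p hp])
      (fun p h1 h2 => by rw [hf₃.int _ (by decide), hf₂.int _ (by decide), hP₁ p h1 h2])
      hBL₃ hb hd (by omega)) ?_
  intro s₄ hf₄ hR₄
  rw [hf₃.coins (by decide), hf₂.coins (by decide), hf₁.coins (by decide)] at hR₄
  have hf₄ : Frame (paramProg 0) s₃ s₄ := ⟨hf₄.int, hf₄.real, hf₄.coins⟩
  have r₄ : ∀ a, a ≠ 2 → s₄.real a = (realInput T G M ε w ω).real a := fun a ha => by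
    rw [hf₄.real a (by simp [show (paramProg 0).reals = [] from rfl]),
      hf₃.real a (by simp [logProg, Program.assign, Program.reals]),
      hf₂.real a (by simpa [sqProg, Program.assign, Program.reals] using ha), r₁]
  refine ok_seq (scaleSteps n k L) (roundSteps n (maxRounded k ε)) (by omega)
    (ok_scaleProg (L := L) (w := w) hR₄ hk (by omega) hnb
      (by rw [hf₄.int _ (by decide), keep₃ _ (by decide)]; rfl) (by rw [r₄ _ (by decide)]; rfl)
      (by rw [hf₄.int _ (by decide), hf₃.int _ (by decide), hL₂])
      (fun i hi => by rw [hf₄.real _ (by decide), hf₃.real _ (by decide), hB₂ i hi])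
      (by rw [hf₄.int _ (by decide), keep₃ _ (by decide)]; rfl)
      (by rw [hf₄.int _ (by decide), keep₃ _ (by decide)]; rfl) hβL hβ) ?_
  rintro s₅ hf₅ ⟨cur, hc₅, hcur1, hfav⟩
  have hR₅ := hR₄.congr (s' := s₅) (hf₅.int _ (by decide)) (hf₅.int _ (by decide))
    (hf₅.int _ (by decide)) (hf₅.int _ (by decide)) (hf₅.int _ (by decide))
    (hf₅.int _ (by decide))
  refine (ok_roundProg (G := G) (w := w) (ε := ε) hR₅.n_eq hR₅.k_eq hk
    (by rw [hf₅.int _ (by decide), hf₄.int _ (by decide), keep₃ _ (by decide)]; rfl)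
    (by rw [hf₅.real _ (by decide), r₄ _ (by decide)]; rfl)
    (fun e he => zero_le_one.trans (hw e he).1)
    (by rw [hf₅.real _ (by decide), r₄ _ (by decide)]; simp [realInput]) hε hc₅ hcur1 hβm
    hsq).mono le_rfl ?_
  rintro s₆ hf₆ ⟨hm₆, hG₆⟩
  refine ⟨hR₅.congr (hf₆.int _ (by decide)) (hf₆.int _ (by decide))
    (hf₆.int _ (by decide)) (hf₆.int _ (by decide)) (hf₆.int _ (by decide))
    (hf₆.int _ (by decide)), hm₆, ?_, ?_, cur, hcur1, hfav, hG₆⟩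
  · rw [hf₆.int _ (by decide), hf₅.int _ (by decide), hf₄.int _ (by decide),
      keep₃ _ (by decide)]
    rfl
  · rw [hf₆.int _ (by decide), hf₅.int _ (by decide), hf₄.int _ (by decide),
      keep₃ _ (by decide)]
    rfl

theorem exists_approxProg_runs {c : ℕ} (hT : T.IsTree)
    (hw : ∀ e ∈ G.edgeSet, w e ∈ Set.Icc 1 M) (hε : 0 < ε) (hk : 1 ≤ k)
    (hb : b = Nat.clog 2 (n + 1)) (hd : d = k + c * b + Nat.clog 2 (L + 2))
    (hL1 : M ≤ 2 ^ 2 ^ L) (hL2 : ∀ j < L, (2 : ℝ) ^ 2 ^ j < M) {β : ℕ}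
    (hβ : wordBits k b d 0 ≤ β) (hβL : bits (L : ℤ) ≤ β)
    (hβm : bits (maxRounded k ε : ℕ) ≤ β) :
    ∃ (par : ℕ → ℕ) (E : ℝ → Prop), ∀ ω, ∃ t s', Runs (approxProg c) (realInput T G M ε w ω) t s' ∧
      t ≤ (approxProg c).weight * ((β + 1) * approxSteps n k b d L (maxRounded k ε) +
        (β + wordBits k b d (maxRounded k ε) + 1) * (coreSteps n k + 1)) ∧
      (FavorableApprox (k := k) n d L par G w ε ω E →
        Outputs T G (fun φ => ∀ ψ : T.Copy G, copyWeight w φ ≤ (1 + ε) * copyWeight w ψ) s') := by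
  have hβ' := hβ
  unfold wordBits at hβ'
  have hnb : n + 1 ≤ 2 ^ b := by rw [hb]; exact Nat.le_pow_clog (by norm_num) _
  set m := maxRounded k ε with hm
  have hS1 : 1 ≤ slotBits k b d := by unfold slotBits; omega
  have hJ := Nat.mul_le_mul_right ((k * m + 1) * (2 * k * d)) hS1
  obtain ⟨ord, par, hord, hprep⟩ := ok_approxPrep (c := c) hT hw hε hk hb hd hL1 hL2 hβ hβL hβm
  set E := fun θ => ∃ φ : Fin k → Fin n, IsEmb par (adjLe G w θ) φ with hE
  refine ⟨par, E, fun ω => ?_⟩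
  obtain ⟨t₁, s₁, hrun₁, ht₁, hmem₁, hR₁, hm₁, h4, hF, cur, hcur1, hfav, hG₁⟩ := hprep ω
    (memBdd_realInput ((bits_le_of_lt (m := b) (by positivity)
      (by exact_mod_cast hnb)).trans (by omega)) (by omega) (by omega) ω)
  set β₂ := β + wordBits k b d m with hβ₂
  have hβ₂' : wordBits k b d m ≤ β₂ := by omega
  have hβ₂'' := hβ₂'
  unfold wordBits at hβ₂''
  have hv : ((IntExpr.read 0 1 * .var vMI + 1) * .var vDEG).eval s₁ =
      ((k * m + 1) * (2 * k * d) : ℕ) := by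
    simp [hR₁.k_eq, hR₁.deg_eq, hm₁, ← hm]
  have hcore : Ok β₂ (.assign vNSLOTS ((.read 0 1 * .var vMI + 1) * .var vDEG) ;; coreProg) s₁
      (coreSteps n k + 1) fun s' => FavorableApprox (k := k) n d L par G w ε ω E →
        Outputs T G (fun φ => ∀ ψ : T.Copy G, copyWeight w φ ≤ (1 + ε) * copyWeight w ψ) s' := by
    refine ok_seq (R := fun t => t.int vNSLOTS 0 = ((k * m + 1) * (2 * k * d) : ℕ)) 1
      (coreSteps n k) (by omega) (ok_assign le_rfl (by simp) ?_ ?_) ?_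
    · rw [hv]; exact bits_natCast_le (by omega)
    · rw [hv]; simp
    intro s₂ hf₂ hJ₂
    have hR₂ := hR₁.congr (s' := s₂) (hf₂.int _ (by decide)) (hf₂.int _ (by decide))
      (hf₂.int _ (by decide)) (hf₂.int _ (by decide)) (hf₂.int _ (by decide))
      (hf₂.int _ (by decide))
    refine (hR₂.ok_coreProg (a := adjLe G w (2 * k * cur))
      (r := roundWeight G w (2 * k * cur) (min ε 1 * cur / k)) (W := m) hk (by omega) hnb
      (fun v hv u hu => ?_) (fun v hv u hu => ⟨?_, roundWeight_le hk hcur1 hε v u⟩) hJ₂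
      (fun p _ => ?_) hβ₂').mono le_rfl ?_
    · rw [hf₂.int _ (by decide)]
      exact (hG₁ v hv u hu).1
    · rw [hf₂.int _ (by decide)]
      exact (hG₁ v hv u hu).2
    · rw [hf₂.int _ (by decide), hF]
    · rintro s' - hs' ⟨hF1, hF2⟩
      have hcur := hfav hF1
      rw [hcur] at hs' hcur1
      -- if there are copies, then the scale is right
      have hspec : (∃ φ : Fin k → Fin n, IsEmb par (adjNum G) φ) →
          (scale E L L = 1 ∨ ¬ E (scale E L L)) ∧ E (2 * scale E L L) := by
        rintro ⟨φ, hφ⟩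
        have h1 : E (2 ^ 2 ^ L) := ⟨φ, isEmb_adjLe.2 ⟨hφ, fun p hp =>
          (weightNum_mem hw (hφ.2 p hp)).2.trans hL1⟩⟩
        have h2 := (scale_spec h1 L le_rfl).2
        rw [Nat.sub_self, pow_zero, pow_one, mul_comm] at h2
        exact h2
      rcases hs' hF2 with ⟨hno, hout⟩ | ⟨ψ, hψ, hmin, h0, hout⟩
      · refine outputs_of_isEmpty hord (fun hex => ?_) (by rw [hout, hf₂.int _ (by decide), h4])
        obtain ⟨φ, hφ⟩ := (hspec hex).2
        obtain ⟨h1, h2⟩ := isEmb_adjLe.1 hφ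
        refine hno ⟨φ, isEmb_adjLe.2 ⟨h1, fun p hp => (h2 p hp).trans ?_⟩⟩
        have : (1 : ℝ) ≤ k := by exact_mod_cast hk
        nlinarith
      · have hemb := (isEmb_adjLe.1 hψ).1
        obtain ⟨hlow, hhigh⟩ := hspec ⟨ψ, hemb⟩
        refine outputs_of_isEmb hord hT hemb h0 hout ?_
        rintro φ rfl φ'
        exact copyWeight_le_of_rounded hord hT hk hw hε hcur1 hlow hhigh hψ hmin φ'
  obtain ⟨t₂, s₂, hrun₂, ht₂, -, hout⟩ := hcore (hmem₁.mono (by omega))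
  refine ⟨_, s₂, .seq hrun₁ hrun₂, ?_, hout⟩
  have hw1 : (approxPrep c).weight ≤ (approxProg c).weight := Nat.le_add_right _ _
  have hw2 : (Program.assign vNSLOTS ((.read 0 1 * .var vMI + 1) * .var vDEG) ;;
      coreProg).weight ≤ (approxProg c).weight := Nat.le_add_left _ _
  rw [mul_add, ← mul_assoc, ← mul_assoc]
  exact add_le_add (ht₁.trans (by gcongr)) (ht₂.trans (by gcongr))

end


/-! ### Running time and error of the approximation algorithm -/

/-- The number of squarings needed to exceed `M` is `O(log log M)`. -/
theorem exists_squarings {M : ℝ} (hM : 1 ≤ M) : ∃ L : ℕ, M ≤ 2 ^ 2 ^ L ∧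
    (∀ j < L, (2 : ℝ) ^ 2 ^ j < M) ∧ (L : ℝ) ≤ 5 * Real.log (2 + Real.log M) := by
  classical
  have hex : ∃ L : ℕ, M ≤ 2 ^ 2 ^ L := by
    obtain ⟨L, hL⟩ := pow_unbounded_of_one_lt M (one_lt_two (α := ℝ))
    exact ⟨L, hL.le.trans (pow_le_pow_right₀ (by norm_num) Nat.lt_two_pow_self.le)⟩
  have hl2 : (0.69 : ℝ) < Real.log 2 := by have := Real.log_two_gt_d9; linarith
  have hlM : 0 ≤ Real.log M := Real.log_nonneg hM
  have hΛ : Real.log 2 ≤ Real.log (2 + Real.log M) :=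
    Real.log_le_log (by norm_num) (by linarith)
  have hlt : ∀ j < Nat.find hex, (2 : ℝ) ^ 2 ^ j < M := fun j hj => not_le.1 (Nat.find_min hex hj)
  refine ⟨Nat.find hex, Nat.find_spec hex, hlt, ?_⟩
  rcases Nat.eq_zero_or_pos (Nat.find hex) with h0 | hpos
  · rw [h0, Nat.cast_zero]
    linarith
  · obtain ⟨j, hj⟩ : ∃ j, Nat.find hex = j + 1 := ⟨Nat.find hex - 1, by omega⟩
    have h1 := Real.log_le_log (by positivity) (hlt j (by omega)).le
    rw [Real.log_pow, Nat.cast_pow, Nat.cast_ofNat] at h1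
    have h2 : (2 : ℝ) ^ j ≤ 2 * (2 + Real.log M) := by
      have : (0 : ℝ) < 2 ^ j := by positivity
      nlinarith
    have h3 := Real.log_le_log (by positivity) h2
    rw [Real.log_pow, Real.log_mul (by norm_num) (by linarith)] at h3
    have hl2' : Real.log 2 < 0.7 := by have := Real.log_two_lt_d9; linarith
    rw [hj]
    push_cast
    nlinarith

theorem maxRounded_le {k : ℕ} {ε Λ : ℝ} (hk : 1 ≤ k) (hε : 0 < ε) (hΛ : Real.log 2 + 1 / ε ≤ Λ) :
    (maxRounded k ε : ℝ) ≤ 5 * (k ^ 2 * Λ) := by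
  have hl2 : (0.69 : ℝ) < Real.log 2 := by have := Real.log_two_gt_d9; linarith
  have hk' : (1 : ℝ) ≤ k := by exact_mod_cast hk
  have hinv : 0 < 1 / ε := by positivity
  have h1 : 1 / min ε 1 ≤ 1 + 1 / ε := by
    rcases min_choice ε 1 with h | h <;> rw [h]
    · linarith
    · rw [one_div_one]
      linarith
  have h2 : (maxRounded k ε : ℝ) ≤ 2 * k * k / min ε 1 + 1 :=
    (Nat.ceil_lt_add_one (by
      have := lt_min hε one_pos
      positivity)).le
  have h3 : 2 * (k : ℝ) * k / min ε 1 = 2 * k ^ 2 * (1 / min ε 1) := by ring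
  have h4 : 2 * (k : ℝ) ^ 2 * (1 / min ε 1) ≤ 2 * k ^ 2 * (1.5 * Λ) := by
    gcongr
    linarith
  have h5 : (1 : ℝ) ≤ k ^ 2 := one_le_pow₀ hk'
  have h6 : 1 ≤ 1.5 * Λ := by linarith
  nlinarith

theorem approxSteps_le {n k b d L m u : ℕ} (hn : 1 ≤ n) (hk : 1 ≤ k) (hkd : k ≤ d)
    (hu : b + d + 1 ≤ u) :
    approxSteps n k b d L m ≤ 100 * (2 ^ k * u ^ 3 * n ^ 3) * (L + m + 1) := by
  have h1 := paramSteps_le hn hk hkd hu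
  have h2 := evalSteps_le (u := u) hn hk (by omega)
  have hu1 : 1 ≤ u := by omega
  set P := 2 ^ k * u ^ 3 * n ^ 3 with hP
  have h3 : 2 ^ k * u ^ 2 * n ^ 2 ≤ P := by
    rw [hP]
    gcongr <;> omega
  have h4 : n * n ≤ P := by
    calc n * n = n ^ 2 := (sq n).symm
      _ ≤ n ^ 3 := Nat.pow_le_pow_right hn (by norm_num)
      _ ≤ P := Nat.le_mul_of_pos_left _ (by positivity)
  have h5 : u ≤ P := by
    calc u ≤ u ^ 3 := Nat.le_self_pow (by norm_num) u
      _ ≤ 2 ^ k * u ^ 3 := Nat.le_mul_of_pos_left _ (by positivity)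
      _ ≤ P := Nat.le_mul_of_pos_right _ (by positivity)
  have h6 : scaleSteps n k L ≤ L * (58 * P) + 4 * P := by
    unfold scaleSteps
    refine add_le_add (Nat.mul_le_mul_left _ ?_) ?_ <;> omega
  have h7 : roundSteps n m ≤ P * (2 * m + 10) + (2 * m + 12) * P := by
    unfold roundSteps
    have := Nat.mul_le_mul_right (2 * m + 10) h4
    have := Nat.le_mul_of_pos_right (2 * m + 12) (by omega : 0 < P)
    omega
  have h8 : 100 * P * (L + m + 1) = 100 * (L * P) + 100 * (P * m) + 100 * P := by ring
  have h9 : L * (58 * P) = 58 * (L * P) := by ring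
  have h10 : P * (2 * m + 10) + (2 * m + 12) * P = 4 * (P * m) + 22 * P := by ring
  have h11 : L ≤ L * P := Nat.le_mul_of_pos_right _ (by omega)
  unfold approxSteps
  omega

/-- The preparations need integers with `O(u⁵)` bits only, while the final search needs few steps
with long integers. This keeps the factors `L` and `m` from being multiplied with each other. -/
theorem cost_sum_le {A B₁ B₂ D k n u L m : ℕ}
    (hA : A ≤ 100 * (2 ^ k * u ^ 3 * n ^ 3) * (L + m + 1)) (h₁ : B₁ ≤ 41 * u ^ 5)
    (h₂ : B₂ ≤ 81 * u ^ 5 * (m + 1)) (hD : D ≤ 121 * (2 ^ k * u ^ 3 * n ^ 3)) :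
    B₁ * A + B₂ * D ≤ 14000 * (2 ^ k * u ^ 8 * n ^ 3) * (L + m + 1) := by
  calc B₁ * A + B₂ * D
      ≤ 41 * u ^ 5 * (100 * (2 ^ k * u ^ 3 * n ^ 3) * (L + m + 1)) +
        81 * u ^ 5 * (L + m + 1) * (121 * (2 ^ k * u ^ 3 * n ^ 3)) := by
        refine add_le_add (Nat.mul_le_mul h₁ hA) (Nat.mul_le_mul (h₂.trans ?_) hD)
        exact Nat.mul_le_mul_left _ (by omega)
    _ = 13901 * (2 ^ k * u ^ 8 * n ^ 3) * (L + m + 1) := by ring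
    _ ≤ _ := by gcongr; norm_num

theorem cast_cost_le {wt k n u c L m : ℕ} {Λ ℓ : ℝ}
    (h : (L : ℝ) + m + 1 ≤ 12 * (k ^ 2 * Λ)) (hu : (u : ℝ) ≤ 8 * (c + 4) * (k * ℓ)) :
    ((wt * (14000 * (2 ^ k * u ^ 8 * n ^ 3) * (L + m + 1)) : ℕ) : ℝ) ≤
      (wt * 168000 * (8 * (c + 4)) ^ 8 : ℕ) * (2 ^ k * (k : ℝ) ^ 10 * (n : ℝ) ^ 3 * Λ) *
        ℓ ^ 8 := by
  calc ((wt * (14000 * (2 ^ k * u ^ 8 * n ^ 3) * (L + m + 1)) : ℕ) : ℝ)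
      = wt * (14000 * (2 ^ k * (u : ℝ) ^ 8 * n ^ 3) * ((L : ℝ) + m + 1)) := by push_cast; ring
    _ ≤ wt * (14000 * (2 ^ k * (8 * (c + 4) * (k * ℓ)) ^ 8 * n ^ 3) *
        (12 * (k ^ 2 * Λ))) := by gcongr
    _ = wt * (14000 * (2 ^ k * ((8 * (c + 4)) ^ 8 * (k ^ 8 * ℓ ^ 8)) * n ^ 3) *
        (12 * (k ^ 2 * Λ))) := by rw [mul_pow _ ((k : ℝ) * ℓ), mul_pow (k : ℝ)]
    _ = _ := by
        push_cast
        generalize (8 * ((c : ℝ) + 4)) ^ 8 = A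
        ring

/-- A union bound over the `L` thresholds and the final search; the summand `Nat.clog 2 (L + 2)`
in `d` pays for the number of events. -/
theorem coinMeasure_not_favorableApprox_le {n k b c d L : ℕ} {par : ℕ → ℕ}
    {G : SimpleGraph (Fin n)} {w : Sym2 (Fin n) → ℝ} {ε : ℝ} {E : ℝ → Prop} (hk : 1 ≤ k)
    (hb : n + 1 ≤ 2 ^ b) (hd : d = k + c * b + Nat.clog 2 (L + 2)) :
    coinMeasure {ω | ¬ FavorableApprox (k := k) n d L par G w ε ω E} ≤
      ENNReal.ofReal (1 / ((n : ℝ) + 1) ^ c) := by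
  set bL := Nat.clog 2 (L + 2) with hbL
  have hL : L + 2 ≤ 2 ^ bL := by rw [hbL]; exact Nat.le_pow_clog (by norm_num) _
  have hsub : {ω | ¬ FavorableApprox (k := k) n d L par G w ε ω E} ⊆
      (⋃ j ∈ Finset.range L, {ω | ¬ Favorable n k d par
        (adjLe G w (scale E L j * 2 ^ 2 ^ (L - 1 - j))) (fun _ _ => 0) ω}) ∪
      {ω | ¬ Favorable n k d par (adjLe G w (2 * k * scale E L L))
        (roundWeight G w (2 * k * scale E L L) (min ε 1 * scale E L L / k)) ω} := by
    intro ω hω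
    by_contra hn
    simp only [Set.mem_union, Set.mem_iUnion, Set.mem_ofPred_eq, Finset.mem_range, not_or,
      not_exists, not_not] at hn
    exact hω ⟨fun j hj => hn.1 j hj, hn.2⟩
  refine (measure_mono hsub).trans ((measure_union_le _ _).trans ?_)
  refine (add_le_add (measure_biUnion_finset_le _ _) coinMeasure_not_favorable_le).trans ?_
  refine (add_le_add_left (Finset.sum_le_sum fun j _ => coinMeasure_not_favorable_le) _).trans ?_
  rw [Finset.sum_const, Finset.card_range, nsmul_eq_mul, ← ENNReal.ofReal_natCast,
    ← ENNReal.ofReal_mul (by positivity), ← ENNReal.ofReal_add (by positivity) (by positivity)]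
  refine ENNReal.ofReal_le_ofReal ?_
  have h1 := two_mul_div_two_pow_le (j := bL) hk hb hd.ge
  have h2 : ((L : ℝ) + 1) * (1 / 2 ^ bL) ≤ 1 := by
    rw [mul_one_div, div_le_one (by positivity)]
    have : ((L + 2 : ℕ) : ℝ) ≤ ((2 ^ bL : ℕ) : ℝ) := by exact_mod_cast hL
    push_cast at this
    linarith
  have h3 : (0 : ℝ) ≤ 1 / ((n : ℝ) + 1) ^ c := by positivity
  calc (L : ℝ) * (2 * k / 2 ^ d) + 2 * k / 2 ^ d = ((L : ℝ) + 1) * (2 * k / 2 ^ d) := by ring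
    _ ≤ ((L : ℝ) + 1) * ((1 / 2 ^ bL) * (1 / ((n : ℝ) + 1) ^ c)) := by gcongr
    _ = ((L : ℝ) + 1) * (1 / 2 ^ bL) * (1 / ((n : ℝ) + 1) ^ c) := by ring
    _ ≤ 1 * (1 / ((n : ℝ) + 1) ^ c) := by gcongr
    _ = _ := one_mul _

set_option maxHeartbeats 800000 in
/-- Both the number `L` of thresholds and the bound `m` for the rounded weights enter the time
linearly, and `L + m` is `O(k² (log (2 + log M) + 1 / ε))`. -/
theorem approximate_solution (c : ℕ) : ∃ (p : Program) (C : ℕ),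
    ∀ (n k : ℕ) (M ε : ℝ) (T : SimpleGraph (Fin k)) (G : SimpleGraph (Fin n))
      (w : Sym2 (Fin n) → ℝ),
      1 ≤ n → 1 ≤ M → 0 < ε → T.IsTree → (∀ e ∈ G.edgeSet, w e ∈ Set.Icc 1 M) →
      Solves p (realInput T G M ε w)
        (Outputs T G fun φ => ∀ ψ : T.Copy G, copyWeight w φ ≤ (1 + ε) * copyWeight w ψ)
        (softBound C
          (2 ^ k * (k : ℝ) ^ C * (n : ℝ) ^ 3 * (Real.log (2 + Real.log M) + 1 / ε)))
        (1 / ((n : ℝ) + 1) ^ c) := by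
  obtain ⟨wt, hwt⟩ : ∃ x, (approxProg c).weight = x := ⟨_, rfl⟩
  set K := wt * 168000 * (8 * (c + 4)) ^ 8 with hK
  refine ⟨approxProg c, K + 10, ?_⟩
  intro n k M ε T G w hn hM hε hT hw
  have hk : 1 ≤ k := by
    obtain ⟨v⟩ := hT.connected.nonempty
    exact v.pos
  obtain ⟨L, hL1, hL2, hL3⟩ := exists_squarings hM
  set b := Nat.clog 2 (n + 1) with hb
  set bL := Nat.clog 2 (L + 2) with hbL
  set d := k + c * b + bL with hd
  set m := maxRounded k ε with hm
  set bm := Nat.clog 2 (m + 1) with hbm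
  have hnb : n + 1 ≤ 2 ^ b := by rw [hb]; exact Nat.le_pow_clog (by norm_num) _
  have hLb : L + 2 ≤ 2 ^ bL := by rw [hbL]; exact Nat.le_pow_clog (by norm_num) _
  have hmb : m + 1 ≤ 2 ^ bm := by rw [hbm]; exact Nat.le_pow_clog (by norm_num) _
  set β := wordBits k b d 0 + bm with hβ
  have hSd := slotBits_ge (b := b) (d := d) hk
  have hkd : 1 * d ≤ 2 * k * d := Nat.mul_le_mul_right d (by omega)
  have hwb : d + 4 ≤ wordBits k b d 0 := by unfold wordBits; omega
  obtain ⟨par, E, hrun⟩ := exists_approxProg_runs (c := c) (β := β) hT hw hε hk hb hd hL1 hL2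
    (by omega)
    ((bits_le_of_lt (m := bL) (by positivity) (by exact_mod_cast (by omega : L < 2 ^ bL))).trans
      (by omega))
    ((bits_le_of_lt (m := bm) (by positivity) (by exact_mod_cast (by omega : m < 2 ^ bm))).trans
      (by omega))
  rw [hwt, ← hm] at hrun
  -- the bound for the time
  obtain ⟨u, hu⟩ : ∃ x, x = b + d + bm + 1 := ⟨_, rfl⟩
  have hu1 : 1 ≤ u := by omega
  have t1 := approxSteps_le (L := L) (m := m) (u := u) hn hk (by omega : k ≤ d)
    (by omega : b + d + 1 ≤ u)
  have t2 := coreSteps_le (u := u) hn hk (by omega)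
  have t3 := wordBits_le (W := 0) (u := u) (by omega : k ≤ d) (by omega : b + d + 1 ≤ u)
  have t4 := wordBits_le (W := m) (u := u) (by omega : k ≤ d) (by omega : b + d + 1 ≤ u)
  have t5 : u ≤ u ^ 5 := Nat.le_self_pow (by norm_num) u
  have t6 : 1 ≤ 2 ^ k * u ^ 3 * n ^ 3 := Nat.one_le_iff_ne_zero.2 (by positivity)
  have ht : wt * ((β + 1) * approxSteps n k b d L m +
      (β + wordBits k b d m + 1) * (coreSteps n k + 1)) ≤
      wt * (14000 * (2 ^ k * u ^ 8 * n ^ 3) * (L + m + 1)) := by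
    refine Nat.mul_le_mul_left _ (cost_sum_le t1 (by omega) ?_ (by omega))
    have : 1 * u ^ 5 ≤ (m + 1) * u ^ 5 := Nat.mul_le_mul_right _ (by omega)
    have h1 : 40 * u ^ 5 * (m + 1) = 40 * ((m + 1) * u ^ 5) := by ring
    have h2 : 81 * u ^ 5 * (m + 1) = 81 * ((m + 1) * u ^ 5) := by ring
    omega
  set Λ := Real.log (2 + Real.log M) + 1 / ε with hΛ
  set f : ℝ := 2 ^ k * (k : ℝ) ^ (K + 10) * (n : ℝ) ^ 3 * Λ with hf
  have hl2 : (0.69 : ℝ) < Real.log 2 := by have := Real.log_two_gt_d9; linarith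
  have hlog2 : Real.log 2 ≤ Real.log (2 + Real.log M) :=
    Real.log_le_log (by norm_num) (by linarith [Real.log_nonneg hM])
  have hinv : 0 < 1 / ε := by positivity
  have hΛ1 : 0.69 ≤ Λ := by linarith
  have hn' : (1 : ℝ) ≤ n := by exact_mod_cast hn
  have hk' : (1 : ℝ) ≤ k := by exact_mod_cast hk
  have hn3 : (n : ℝ) ≤ (n : ℝ) ^ 3 := le_self_pow₀ hn' (by norm_num)
  have h2k : (2 : ℝ) ≤ 2 ^ k := le_self_pow₀ (by norm_num) (by omega)
  have hg : 2 ^ k * (k : ℝ) ^ 10 * (n : ℝ) ^ 3 * Λ ≤ f := by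
    rw [hf]
    gcongr
    omega
  have hΛf : (k : ℝ) ^ 2 * Λ ≤ f := by
    refine le_trans ?_ hg
    have h1 : (k : ℝ) ^ 2 ≤ (k : ℝ) ^ 10 := pow_le_pow_right₀ hk' (by norm_num)
    have h2 : (1 : ℝ) * k ^ 2 * 1 ≤ 2 ^ k * (k : ℝ) ^ 10 * (n : ℝ) ^ 3 := by
      gcongr <;> linarith
    have h3 : (0 : ℝ) ≤ Λ := by linarith
    rw [one_mul, mul_one] at h2
    gcongr
  have hnf : (n : ℝ) ≤ f := by
    refine le_trans ?_ hg
    have h1 : (1 : ℝ) ≤ k ^ 10 := one_le_pow₀ hk'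
    calc (n : ℝ) ≤ 2 * 1 * n * 0.69 := by linarith
      _ ≤ 2 ^ k * (k : ℝ) ^ 10 * (n : ℝ) ^ 3 * Λ := by gcongr
  have hf1 : 1 ≤ f := hn'.trans hnf
  have hk2 : (1 : ℝ) ≤ k ^ 2 := one_le_pow₀ hk'
  have hΛk : Λ ≤ k ^ 2 * Λ := le_mul_of_one_le_left (by linarith) hk2
  have hmΛ : (m : ℝ) ≤ 5 * (k ^ 2 * Λ) := maxRounded_le hk hε (by linarith)
  have hℓ := one_le_log hf1
  set ℓ := Real.log (f + 2) with hℓdef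
  have l1 : (b : ℝ) + 1 ≤ 8 * ℓ := clog_add_one_le (by push_cast; linarith) hf1
  have l2 : (bL : ℝ) + 1 ≤ 8 * ℓ := clog_add_one_le (by push_cast; linarith) hf1
  have l3 : (bm : ℝ) + 1 ≤ 8 * ℓ := clog_add_one_le (by push_cast; linarith) hf1
  have hkℓ : ℓ ≤ k * ℓ := le_mul_of_one_le_left (by linarith) hk'
  have hkℓ' : (k : ℝ) ≤ k * ℓ := le_mul_of_one_le_right (by linarith) hℓ
  have huℓ : (u : ℝ) ≤ 8 * (c + 4) * (k * ℓ) := by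
    have h1 : (c : ℝ) * b ≤ c * (8 * (k * ℓ)) := by
      refine mul_le_mul_of_nonneg_left ?_ (by positivity)
      linarith
    rw [hu, hd]
    push_cast
    linarith
  have htime : ((wt * (14000 * (2 ^ k * u ^ 8 * n ^ 3) * (L + m + 1)) : ℕ) : ℝ) ≤
      softBound (K + 10) f := by
    refine mul_le_softBound (K := K) (g := 2 ^ k * (k : ℝ) ^ 10 * (n : ℝ) ^ 3 * Λ) (by omega)
      (by omega) (by positivity) hg rfl hℓ ?_
    have h1 : (L : ℝ) + m + 1 ≤ 12 * (k ^ 2 * Λ) := by linarith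
    rw [hK]
    exact cast_cost_le h1 huℓ
  refine ⟨fun ω => ?_, ?_⟩
  · obtain ⟨t, s, h1, h2, -⟩ := hrun ω
    exact ⟨t, s, h1, (Nat.cast_le.2 (h2.trans ht)).trans htime⟩
  · refine (measure_mono ?_).trans (coinMeasure_not_favorableApprox_le (par := par) (G := G)
      (w := w) (ε := ε) (E := E) hk hnb hd)
    rintro ω ⟨t, s, hr, hbad⟩ hfav
    obtain ⟨t', s', hr', -, hgood⟩ := hrun ω
    obtain ⟨-, rfl⟩ := hr.unique hr'
    exact hbad (hgood hfav)

end MinWeightTree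

theorem mainTheorem3 (c : ℕ) :
    (∃ (p : Program) (C : ℕ), p.IntegerOnly ∧
      ∀ (n k M : ℕ) (T : SimpleGraph (Fin k)) (G : SimpleGraph (Fin n)) (w : Sym2 (Fin n) → ℤ),
        1 ≤ n → 1 ≤ M → T.IsTree → (∀ e ∈ G.edgeSet, |w e| ≤ (M : ℤ)) →
        Solves p (intInput T G M w)
          (Outputs T G fun φ => ∀ ψ : T.Copy G, copyWeight w φ ≤ copyWeight w ψ)
          (softBound C (2 ^ k * (k : ℝ) ^ C * M * (n : ℝ) ^ 3))
          (1 / ((n : ℝ) + 1) ^ c)) ∧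
    (∃ (p : Program) (C : ℕ),
      ∀ (n k : ℕ) (M ε : ℝ) (T : SimpleGraph (Fin k)) (G : SimpleGraph (Fin n))
        (w : Sym2 (Fin n) → ℝ),
        1 ≤ n → 1 ≤ M → 0 < ε → T.IsTree → (∀ e ∈ G.edgeSet, w e ∈ Set.Icc 1 M) →
        Solves p (realInput T G M ε w)
          (Outputs T G fun φ => ∀ ψ : T.Copy G, copyWeight w φ ≤ (1 + ε) * copyWeight w ψ)
          (softBound C
            (2 ^ k * (k : ℝ) ^ C * (n : ℝ) ^ 3 * (Real.log (2 + Real.log M) + 1 / ε)))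
          (1 / ((n : ℝ) + 1) ^ c)) := ⟨exact_solution c, approximate_solution c⟩
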